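/- Lemma 1.9. (Hard-sphere case $\gamma=1$.) For $v,v^*\in\mathbb{R}^3$ let $$\nu(v)=2^{-3/2}\Big[e^{-|v|^2}+\Big(2|v|+\frac1{|v|}\Big)\int_0^{|v|}e^{-\eta^2}\,d\eta\Big]\quad(v\ne0),\qquad \nu(0)=2^{-1/2},$$ $$k(v,v^*)=2^{-3/2}\pi^{-1}\Big\{\frac{2}{|v^*-v|}\exp\Big(-\frac14\frac{(|v^*|^2-|v|^2)^2}{|v^*-v|^2}-\frac14|v^*-v|^2\Big)-|v^*-v|\exp\Big(-\frac12(|v^*|^2+|v|^2)\Big)\Big\},$$ and $Kf(x,v)=\int_{\mathbb{R}^3}k(v,v^*)f(x,v^*)\,dv^*$. For a bounded convex domain $\Omega\subset\mathbb{R}^3$ with $C^2$ boundary and outward unit normal $n$, let $\Gamma^-=\{(x,v)\in\partial\Omega\times\mathbb{R}^3 : n(x)\cdot v<0\}$, and for $x\in\Omega$, $v\neq0$ put $\tau(x,v)=\inf\{s>0 : x-sv\notin\Omega\}$ and $q(x,v)=x-\tau(x,v)v$. A solution of $$v\cdot\nabla_xf=-\nu f+Kf\ \text{ in }\Omega\times\mathbb{R}^3,\qquad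 f=g\ \text{ on }\Gamma^-,$$ is a function $f$ which for almost every $(x,v)\in\Omega\times\mathbb{R}^3$ satisfies, with absolutely convergent integrals, $$f(x,v)=e^{-\nu(v)\tau(x,v)}g(q(x,v),v)+\int_0^{\tau(x,v)}e^{-\nu(v)s}\,Kf(x-sv,v)\,ds.$$ For $1\le p<\infty$ and $\alpha\ge0$ let $L^p_\alpha(\Omega\times\mathbb{R}^3)$ be the space of measurable $f$ with $\int_{\Omega\times\mathbb{R}^3}|f|^pe^{p\alpha|v|^2}\,dx\,dv<\infty$, let $L^p=L^p_0$, and let $W^{1,p}_\alpha(\Omega\times\mathbb{R}^3)$ be the space of those $f\in L^p_\alpha$ whose weak gradients $\nabla_xf$, $\nabla_vf$ also belong to $L^p_\alpha$. Let $0<\rho<1$, $2\le p<3$ and $0\le\alpha<(1-\rho)/2$. Then there is $r_0>0$ such that for every $0<r<r_0$ the ball $\Omega=\{x\in\mathbb{R}^3:|x|<r\}$, which is a bounded convex domain with $C^2$ boundary of positive Gaussian curvature, has the following property. For $x\in\partial\Omega$ let $\theta(x)\in[0,\pi]$ be the angle between $x$ and $(1,0,0)$. There is $\theta_0\in(0,\pi)$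 such that for all $0<\theta_1<\theta_2<\theta_0$ and every smooth function $\varphi:\partial\Omega\to[0,1]$ with $\varphi=1$ where $\theta(x)<\theta_1$ and $\varphi=0$ where $\theta(x)\ge\theta_2$, the boundary value problem with the boundary data $g(x,v)=\varphi(x)e^{-|v|^2/2}$ has a solution $f\in L^3(\Omega\times\mathbb{R}^3)\cap W^{1,p}_\alpha(\Omega\times\mathbb{R}^3)$ that does not belong to $W^{1,3}_\alpha(\Omega\times\mathbb{R}^3)$. In particular, for each such $p$ and $\alpha$ there exist a bounded convex domain $\Omega$ with $C^2$ boundary of positive Gaussian curvature and boundary data $g$ for which the problem has a solution in $L^3(\Omega\times\mathbb{R}^3)\cap W^{1,p}_\alpha(\Omega\times\mathbb{R}^3)$ that does not belong to $W^{1,3}_\alpha(\Omega\times\mathbb{R}^3)$. -/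

import Mathlib

open MeasureTheory Set
open scoped ContDiff

noncomputable section

namespace Boltzmann

/-- The physical space and the velocity space `ℝ³` with its Euclidean norm. -/
abbrev E3 : Type := EuclideanSpace ℝ (Fin 3)

/-- The `i`-th vector of the standard basis of `ℝ³`. -/
def basisVec (i : Fin 3) : E3 := EuclideanSpace.single i (1 : ℝ)

/-! ### Domains -/

/-- The coordinates of the gradient of `ψ` at `x`. -/
def gradVec (ψ : E3 → ℝ) (x : E3) : Fin 3 → ℝ := fun i => fderiv ℝ ψ x (basisVec i)

/-- The Hessian matrix of `ψ` at `x`. -/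
def hessMat (ψ : E3 → ℝ) (x : E3) : Matrix (Fin 3) (Fin 3) ℝ :=
  Matrix.of fun i j => fderiv ℝ (fun y => fderiv ℝ ψ y (basisVec j)) x (basisVec i)

/-- The Gaussian curvature at `x` of the level surface of `ψ` through `x`, by the classical formula
`K = (∇ψ)ᵀ adj(Hess ψ) (∇ψ) / |∇ψ|⁴` for implicitly given surfaces (for `∇ψ(x) ≠ 0`). -/
def gaussCurvature (ψ : E3 → ℝ) (x : E3) : ℝ :=
  (gradVec ψ x ⬝ᵥ Matrix.mulVec (hessMat ψ x).adjugate (gradVec ψ x)) /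
    (gradVec ψ x ⬝ᵥ gradVec ψ x) ^ 2

/-- `Ω` is a bounded convex domain in `ℝ³` with `C²` boundary of positive Gaussian curvature:
near each boundary point, `Ω` is the sublevel set `{ψ < 0}` of a `C²` function with nonvanishing
gradient whose level surface (that is, `∂Ω`) has positive Gaussian curvature there. -/
structure IsConvexDomainPosCurvature (Ω : Set E3) : Prop where
  isOpen : IsOpen Ω
  nonempty : Ω.Nonempty
  convex : Convex ℝ Ω
  bounded : Bornology.IsBounded Ω
  boundary : ∀ z ∈ frontier Ω, ∃ U : Set E3, ∃ ψ : E3 → ℝ,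
    IsOpen U ∧ z ∈ U ∧ ContDiff ℝ 2 ψ ∧ (∀ x ∈ U, x ∈ Ω ↔ ψ x < 0) ∧
      gradVec ψ z ≠ 0 ∧ 0 < gaussCurvature ψ z

/-! ### The stationary linearized Boltzmann equation in integral form -/

/-- The backward exit time `τ(x, v) = inf {s > 0 | x - s v ∈ Ωᶜ}`
(for `x ∈ Ω`, `Ω` bounded and `v ≠ 0` this set is nonempty). -/
def exitTime (Ω : Set E3) (x v : E3) : ℝ := sInf {s : ℝ | 0 < s ∧ x - s • v ∈ Ωᶜ}

/-- The backward exit point `q(x, v) = x - τ(x, v) v`. -/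
def exitPoint (Ω : Set E3) (x v : E3) : E3 := x - exitTime Ω x v • v

/-- `K f (x, v) = ∫ k(v, v⁎) f(x, v⁎) dv⁎`. -/
def opK (k : E3 → E3 → ℝ) (f : E3 × E3 → ℝ) (z : E3 × E3) : ℝ :=
  ∫ w : E3, k z.2 w * f (z.1, w)

/-- `J g (x, v) = exp(-ν(v) τ(x, v)) g(q(x, v), v)`. Only the values of `g` at the points
`(q(x, v), v)` enter; for a ball these lie in `Γ⁻` whenever `x ∈ Ω` and `v ≠ 0`. -/
def opJ (ν : E3 → ℝ) (Ω : Set E3) (g : E3 × E3 → ℝ) (z : E3 × E3) : ℝ :=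
  Real.exp (-(ν z.2 * exitTime Ω z.1 z.2)) * g (exitPoint Ω z.1 z.2, z.2)

/-- `S_Ω h (x, v) = ∫₀^{τ(x, v)} exp(-ν(v) s) h(x - s v, v) ds`. -/
def opS (ν : E3 → ℝ) (Ω : Set E3) (h : E3 × E3 → ℝ) (z : E3 × E3) : ℝ :=
  ∫ s in (0 : ℝ)..exitTime Ω z.1 z.2, Real.exp (-(ν z.2 * s)) * h (z.1 - s • z.2, z.2)

/-- `f` is a solution of `v · ∇ₓ f = -ν f + K f` in `Ω × ℝ³` with incoming boundary data `g`:
almost everywhere in `Ω × ℝ³` the integrals defining `S_Ω K f` converge absolutely and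
`f = J g + S_Ω K f`. -/
def IsSolution (ν : E3 → ℝ) (k : E3 → E3 → ℝ) (Ω : Set E3) (g f : E3 × E3 → ℝ) : Prop :=
  ∀ᵐ z : E3 × E3 ∂(volume.restrict (Ω ×ˢ univ)),
    (∀ᵐ s : ℝ ∂(volume.restrict (Ioo 0 (exitTime Ω z.1 z.2))),
      Integrable (fun w : E3 => k z.2 w * f (z.1 - s • z.2, w))) ∧
    IntervalIntegrable
      (fun s : ℝ => Real.exp (-(ν z.2 * s)) * opK k f (z.1 - s • z.2, z.2))
      volume 0 (exitTime Ω z.1 z.2) ∧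
    f z = opJ ν Ω g z + opS ν Ω (opK k f) z

/-! ### The hard-sphere model -/

/-- The hard-sphere collision frequency, with its continuous value `2^(-1/2)` at `v = 0`. -/
def hardSphereNu (v : E3) : ℝ :=
  if v = 0 then (2 : ℝ) ^ (-(1 / 2) : ℝ)
  else (2 : ℝ) ^ (-(3 / 2) : ℝ) *
    (Real.exp (-‖v‖ ^ 2) + (2 * ‖v‖ + 1 / ‖v‖) * ∫ η in (0 : ℝ)..‖v‖, Real.exp (-η ^ 2))

/-- The hard-sphere integral kernel (its value on the null set `v = w` is irrelevant). -/
def hardSphereK (v w : E3) : ℝ :=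
  (2 : ℝ) ^ (-(3 / 2) : ℝ) * Real.pi⁻¹ *
    (2 * ‖w - v‖⁻¹ *
        Real.exp (-(1 / 4) * ((‖w‖ ^ 2 - ‖v‖ ^ 2) ^ 2 / ‖w - v‖ ^ 2) - (1 / 4) * ‖w - v‖ ^ 2)
      - ‖w - v‖ * Real.exp (-(1 / 2) * (‖w‖ ^ 2 + ‖v‖ ^ 2)))

/-! ### Weighted Lebesgue and Sobolev spaces on the phase space -/

/-- `f ∈ L^p_α(Ω × ℝ³)`: `f` is measurable and `∫ |f(x, v)|^p e^{p α |v|²} dx dv < ∞`. -/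
def MemLpWeighted {F : Type*} [NormedAddCommGroup F] [NormedSpace ℝ F]
    (p α : ℝ) (Ω : Set E3) (f : E3 × E3 → F) : Prop :=
  MemLp (fun z => Real.exp (α * ‖z.2‖ ^ 2) • f z) (ENNReal.ofReal p)
    (volume.restrict (Ω ×ˢ univ))

/-- `g` is the weak derivative of `f` in the direction `e` on the open set `U`. -/
def IsWeakDeriv (U : Set (E3 × E3)) (e : E3 × E3) (f g : E3 × E3 → ℝ) : Prop :=
  LocallyIntegrableOn f U ∧ LocallyIntegrableOn g U ∧
    ∀ φ : E3 × E3 → ℝ, ContDiff ℝ ∞ φ → HasCompactSupport φ → tsupport φ ⊆ U →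
      ∫ z in U, f z * fderiv ℝ φ z e = -∫ z in U, g z * φ z

/-- `f ∈ W^{1,p}_α(Ω × ℝ³)`: `f` and its weak gradients `∇ₓ f`, `∇ᵥ f` are in
`L^p_α(Ω × ℝ³)`. -/
def MemW1pWeighted (p α : ℝ) (Ω : Set E3) (f : E3 × E3 → ℝ) : Prop :=
  MemLpWeighted p α Ω f ∧
    ∃ Gx Gv : E3 × E3 → E3,
      (∀ i, IsWeakDeriv (Ω ×ˢ univ) (basisVec i, 0) f (fun z => Gx z i)) ∧
      (∀ i, IsWeakDeriv (Ω ×ˢ univ) (0, basisVec i) f (fun z => Gv z i)) ∧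
      MemLpWeighted p α Ω Gx ∧ MemLpWeighted p α Ω Gv

/-! ### Boundary data supported in a polar cap -/

/-- The points of the sphere of radius `r` about `0` whose polar angle, measured from the first
coordinate axis, is less than `θ`. -/
def polarCap (r θ : ℝ) : Set E3 :=
  {x | x ∈ Metric.sphere (0 : E3) r ∧ InnerProductGeometry.angle x (basisVec 0) < θ}

/-- `φ` restricts to a smooth cut-off function on the sphere of radius `r` about `0`, equal to `1`
on the cap of angle `θ₁`, to `0` off the cap of angle `θ₂`, and with values in `[0, 1]` in between.
(Smooth functions on the sphere are the restrictions of smooth functions on `ℝ³`.) -/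
structure IsCapCutoff (r θ₁ θ₂ : ℝ) (φ : E3 → ℝ) : Prop where
  smooth : ContDiff ℝ ∞ φ
  eq_one : ∀ x ∈ polarCap r θ₁, φ x = 1
  eq_zero : ∀ x ∈ Metric.sphere (0 : E3) r \ polarCap r θ₂, φ x = 0
  mem_Icc : ∀ x ∈ polarCap r θ₂ \ polarCap r θ₁, φ x ∈ Icc (0 : ℝ) 1

/-- The incoming boundary data `g(x, v) = φ(x) e^{-|v|²/2}`. -/
def capData (φ : E3 → ℝ) (z : E3 × E3) : ℝ := φ z.1 * Real.exp (-(1 / 2) * ‖z.2‖ ^ 2)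

end Boltzmann

end

/-!
On the ball of radius `r` everything is explicit. With the discriminant
`D(x, v) = ⟪x, v⟫² + |v|² (r² - |x|²)` the backward exit time is `τ = (⟪x, v⟫ + √D) / |v|²`, and the
gradient of `τ` is of the order `1 / √D`: it is singular at the grazing set, where the chord
degenerates to a point of the sphere. The solution inherits this singularity and no worse one, and
`1 / √D` is integrable to the power `p` exactly when `p < 3`.

*Existence.* With `h = K f` the equation `f = J g + S K f` becomes `h = K J g + K S h`, which is
solved by a geometric series when `r` is small, because `S` integrates over chords of length at most
`2 r`. The kernel of `K` is weakly singular; one derivative in `v` may be put on it, and the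
derivative in `x` falls on the function. Hence `K` maps functions that are `C¹` for `v ≠ 0`, with
`x`-gradient bounded by a multiple of `|v|⁻¹ (r² - |x|²)^(-1/2)` (`TransportBound`), to functions that
are `C¹` on all of phase space, with `x`-gradient bounded by `(r² - |x|²)^(-1/2)` (`GainBound`); see
`exists_opK_gainBound`. Conversely `S` maps the second class to the first (`opS_transportBound`):
by strict convexity, `(r² - |x|²)^(-1/2)` restricted to a chord is at most the arcsine density
divided by the length of the chord, so its integral over the chord is bounded. The fixed point is
`exists_gain_fixedPoint`; it comes with the estimate `|h - K J g| ≤ C r`.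

*Regularity below the exponent `3`.* The solution is `C¹` for `v ≠ 0` and its gradient is at most
`C e^{-β|v|²} / √D` for some `β > α` (`exists_grazingBound_transportSolution`). Powers less than `3`
of this bound are integrable (`integrable_grazing_rpow`), and the set `v = 0` has codimension `3`, so
the classical gradient is the weak one (`GrazingBound.isWeakDeriv`).

*Failure at the exponent `3`.* Let `M = e^{-|v|²/2}` and let `ξ` be the unit vector in the direction
of the exit point. The terms of `∂_ξ f` that contain `∂_ξ τ = -r / √D` combine to
`(r / √D) e^{-ντ} (ν M - h)` up to an error that is bounded for `|v|` bounded below, when the exit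
point is in the cap where the data equal `M` (`le_fderiv_transportSolution`). For the full
Maxwellian `M` this has no singularity, as `K M = ν M`. Here, near the pole of a small cap, a slow
particle receives data only from slightly more than a half-space of velocities, since the other
backward rays leave the ball outside the cap. So `K J g`, and by `|h - K J g| ≤ C r` also `h`, falls
short of `ν M` by a fixed amount (`exists_gain_gap`), and `|∇ₓ f| ≥ c / √D` near the pole. The set
where `√D` is at most of the order `s` there has measure at least of the order `s³`: a factor `s`
comes from `|⟪x, v⟫| ≤ s` and a factor `s²` from the depth below the sphere
(`le_volume_grazingRegion`). If `|∇ₓ f|³` were integrable, its integral over these sets would tend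
to zero with their measure, but it stays bounded below (`lintegral_eq_top_of_grazing`).
-/

open Filter Topology
open scoped RealInnerProductSpace

noncomputable section

namespace Boltzmann

/-! ### Geometry of the ball -/

/-- The points of phase space over the ball of radius `r`, without the velocity `0`. -/
def movingPhase (r : ℝ) : Set (E3 × E3) := Metric.ball (0 : E3) r ×ˢ {0}ᶜ

/-- The discriminant of the quadratic equation `|x - s v|² = r²` for `s`. In terms of the length
`ℓ` of the chord through `x` in the direction `v`, it is `(|v| ℓ / 2)²`. -/
def chordDiscr (r : ℝ) (z : E3 × E3) : ℝ := ⟪z.1, z.2⟫ ^ 2 + ‖z.2‖ ^ 2 * (r ^ 2 - ‖z.1‖ ^ 2)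

/-- The explicit backward exit time from the ball of radius `r`. -/
def ballTime (r : ℝ) (z : E3 × E3) : ℝ := (⟪z.1, z.2⟫ + √(chordDiscr r z)) / ‖z.2‖ ^ 2

/-- The backward exit point from the ball of radius `r`. -/
def ballExit (r : ℝ) (z : E3 × E3) : E3 := z.1 - ballTime r z • z.2

lemma mem_movingPhase {r : ℝ} {z : E3 × E3} : z ∈ movingPhase r ↔ ‖z.1‖ < r ∧ z.2 ≠ 0 := by
  simp [movingPhase]

lemma isOpen_movingPhase (r : ℝ) : IsOpen (movingPhase r) :=
  Metric.isOpen_ball.prod isOpen_compl_singleton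

lemma sq_sub_sq_pos {r : ℝ} {x : E3} (hx : ‖x‖ < r) : 0 < r ^ 2 - ‖x‖ ^ 2 := by
  nlinarith [norm_nonneg x]

lemma chordDiscr_ge (r : ℝ) (z : E3 × E3) :
    ‖z.2‖ ^ 2 * (r ^ 2 - ‖z.1‖ ^ 2) ≤ chordDiscr r z := by
  unfold chordDiscr; nlinarith [sq_nonneg ⟪z.1, z.2⟫]

lemma chordDiscr_pos {r : ℝ} {z : E3 × E3} (hz : z ∈ movingPhase r) : 0 < chordDiscr r z := by
  obtain ⟨h1, h2⟩ := mem_movingPhase.1 hz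
  have := norm_pos_iff.2 h2
  exact lt_of_lt_of_le (mul_pos (by positivity) (sq_sub_sq_pos h1)) (chordDiscr_ge r z)

lemma chordDiscr_le (r : ℝ) (z : E3 × E3) : chordDiscr r z ≤ (r * ‖z.2‖) ^ 2 := by
  have h := abs_real_inner_le_norm z.1 z.2
  have : ⟪z.1, z.2⟫ ^ 2 ≤ (‖z.1‖ * ‖z.2‖) ^ 2 := by
    rw [← sq_abs]; gcongr
  unfold chordDiscr; nlinarith

lemma sqrt_chordDiscr_le {r : ℝ} (hr : 0 < r) (z : E3 × E3) : √(chordDiscr r z) ≤ r * ‖z.2‖ :=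
  (Real.sqrt_le_sqrt (chordDiscr_le r z)).trans_eq (Real.sqrt_sq (by positivity))

lemma abs_inner_lt_sqrt_chordDiscr {r : ℝ} {z : E3 × E3} (hz : z ∈ movingPhase r) :
    |⟪z.1, z.2⟫| < √(chordDiscr r z) := by
  obtain ⟨h1, h2⟩ := mem_movingPhase.1 hz
  have := norm_pos_iff.2 h2
  rw [← Real.sqrt_sq_eq_abs]
  refine Real.sqrt_lt_sqrt (sq_nonneg _) ?_
  unfold chordDiscr
  have := mul_pos (pow_pos this 2) (sq_sub_sq_pos h1)
  linarith

lemma ballTime_pos {r : ℝ} {z : E3 × E3} (hz : z ∈ movingPhase r) : 0 < ballTime r z := by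
  have h2 := norm_pos_iff.2 (mem_movingPhase.1 hz).2
  have := (abs_lt.1 (abs_inner_lt_sqrt_chordDiscr hz)).1
  exact div_pos (by linarith) (by positivity)

lemma ballTime_le {r : ℝ} {z : E3 × E3} (hz : z ∈ movingPhase r) :
    ballTime r z ≤ 2 * √(chordDiscr r z) / ‖z.2‖ ^ 2 := by
  have := (abs_lt.1 (abs_inner_lt_sqrt_chordDiscr hz)).2
  unfold ballTime; gcongr; linarith

lemma ballTime_mul_norm_le {r : ℝ} (hr : 0 < r) {z : E3 × E3} (hz : z ∈ movingPhase r) :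
    ballTime r z * ‖z.2‖ ≤ 2 * r := by
  have h2 := norm_pos_iff.2 (mem_movingPhase.1 hz).2
  calc _ ≤ (2 * √(chordDiscr r z) / ‖z.2‖ ^ 2) * ‖z.2‖ := by gcongr; exact ballTime_le hz
    _ ≤ (2 * (r * ‖z.2‖) / ‖z.2‖ ^ 2) * ‖z.2‖ := by gcongr; exact sqrt_chordDiscr_le hr z
    _ = 2 * r := by field_simp

lemma ballTime_mul_sq {r : ℝ} {z : E3 × E3} (hz : z.2 ≠ 0) :
    ballTime r z * ‖z.2‖ ^ 2 = ⟪z.1, z.2⟫ + √(chordDiscr r z) := by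
  have h2 := norm_pos_iff.2 hz
  unfold ballTime; field_simp

lemma inner_ballExit {r : ℝ} {z : E3 × E3} (hz : z.2 ≠ 0) :
    ⟪ballExit r z, z.2⟫ = -√(chordDiscr r z) := by
  rw [ballExit, inner_sub_left, inner_smul_left, real_inner_self_eq_norm_sq]
  have := ballTime_mul_sq (r := r) hz
  simp only [conj_trivial]; linarith

lemma norm_sub_smul_sq (x v : E3) (s : ℝ) :
    ‖x - s • v‖ ^ 2 = ‖x‖ ^ 2 - 2 * s * ⟪x, v⟫ + s ^ 2 * ‖v‖ ^ 2 := by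
  rw [norm_sub_sq_real, inner_smul_right, norm_smul, mul_pow, Real.norm_eq_abs, sq_abs]; ring

lemma norm_ballExit {r : ℝ} (hr : 0 < r) {z : E3 × E3} (hz : z ∈ movingPhase r) :
    ‖ballExit r z‖ = r := by
  have h2 := (mem_movingPhase.1 hz).2
  have h := ballTime_mul_sq (r := r) h2
  have hD := Real.sq_sqrt (chordDiscr_pos hz).le
  have hv := norm_pos_iff.2 h2
  have : ‖ballExit r z‖ ^ 2 = r ^ 2 := by
    rw [ballExit, norm_sub_smul_sq]
    have hs : √(chordDiscr r z) = ballTime r z * ‖z.2‖ ^ 2 - ⟪z.1, z.2⟫ := by linarith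
    rw [hs] at hD
    unfold chordDiscr at hD
    have : ‖z.2‖ ^ 2 * (‖z.1‖ ^ 2 - 2 * ballTime r z * ⟪z.1, z.2⟫ +
      ballTime r z ^ 2 * ‖z.2‖ ^ 2) = ‖z.2‖ ^ 2 * r ^ 2 := by linarith
    exact mul_left_cancel₀ (by positivity) this
  exact (sq_eq_sq₀ (norm_nonneg _) hr.le).1 this

/-- Strict convexity of the ball, quantitatively along the backward chord. -/
lemma chord_gap {r : ℝ} (hr : 0 < r) {z : E3 × E3} (hz : z ∈ movingPhase r) {θ : ℝ}
    (h0 : 0 ≤ θ) (h1 : θ ≤ 1) :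
    θ * (1 - θ) * (ballTime r z * ‖z.2‖) ^ 2 ≤ r ^ 2 - ‖z.1 - (θ * ballTime r z) • z.2‖ ^ 2 := by
  have hq : ‖ballExit r z‖ ^ 2 = r ^ 2 := by rw [norm_ballExit hr hz]
  rw [ballExit, norm_sub_smul_sq] at hq
  rw [norm_sub_smul_sq]
  have := sq_sub_sq_pos (mem_movingPhase.1 hz).1
  nlinarith [mul_nonneg (sub_nonneg.2 h1) this.le]

lemma chord_mem_ball {r : ℝ} (hr : 0 < r) {z : E3 × E3} (hz : z ∈ movingPhase r) {θ : ℝ}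
    (h0 : 0 ≤ θ) (h1 : θ < 1) : z.1 - (θ * ballTime r z) • z.2 ∈ Metric.ball (0 : E3) r := by
  rcases h0.eq_or_lt with rfl | h0
  · simpa using (mem_movingPhase.1 hz).1
  have h2 := norm_pos_iff.2 (mem_movingPhase.1 hz).2
  have ht := ballTime_pos hz
  have := chord_gap hr hz h0.le h1.le
  have h3 : 0 < θ * (1 - θ) * (ballTime r z * ‖z.2‖) ^ 2 :=
    mul_pos (mul_pos h0 (by linarith)) (by positivity)
  simp only [Metric.mem_ball, dist_zero_right]
  exact lt_of_pow_lt_pow_left₀ 2 hr.le (by linarith)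

/-- The first exit is at the larger root of the quadratic equation: the open chord up to there lies
in the ball. -/
lemma exitTime_ball {r : ℝ} (hr : 0 < r) {z : E3 × E3} (hz : z ∈ movingPhase r) :
    exitTime (Metric.ball (0 : E3) r) z.1 z.2 = ballTime r z := by
  have ht := ballTime_pos hz
  refine IsLeast.csInf_eq ⟨⟨ht, ?_⟩, ?_⟩
  · have := norm_ballExit hr hz
    rw [ballExit] at this
    simp [this]
  · rintro s ⟨hs0, hs⟩
    by_contra! hlt
    refine hs ?_
    have := chord_mem_ball hr hz (θ := s / ballTime r z) (by positivity)
      ((div_lt_one ht).2 hlt)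
    rwa [div_mul_cancel₀ _ ht.ne'] at this

lemma exitPoint_ball {r : ℝ} (hr : 0 < r) {z : E3 × E3} (hz : z ∈ movingPhase r) :
    exitPoint (Metric.ball (0 : E3) r) z.1 z.2 = ballExit r z := by
  rw [exitPoint, exitTime_ball hr hz, ballExit]

lemma contDiffOn_ballTime (r : ℝ) : ContDiffOn ℝ ∞ (ballTime r) (movingPhase r) := by
  intro z hz
  have h2 := (mem_movingPhase.1 hz).2
  have hD : ContDiffAt ℝ ∞ (chordDiscr r) z := by
    unfold chordDiscr
    have h1 : ContDiffAt ℝ ∞ (fun z : E3 × E3 => ⟪z.1, z.2⟫) z :=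
      contDiffAt_fst.inner ℝ contDiffAt_snd
    have h3 : ContDiffAt ℝ ∞ (fun z : E3 × E3 => ‖z.2‖ ^ 2) z := contDiffAt_snd.norm_sq ℝ
    have h4 : ContDiffAt ℝ ∞ (fun z : E3 × E3 => ‖z.1‖ ^ 2) z := contDiffAt_fst.norm_sq ℝ
    exact (h1.pow 2).add (h3.mul (contDiffAt_const.sub h4))
  refine ContDiffAt.contDiffWithinAt ?_
  unfold ballTime
  refine ((contDiffAt_fst.inner ℝ contDiffAt_snd).add
    (hD.sqrt (chordDiscr_pos hz).ne')).div (contDiffAt_snd.norm_sq ℝ) ?_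
  simpa using h2

lemma differentiableAt_ballTime {r : ℝ} {z : E3 × E3} (hz : z ∈ movingPhase r) :
    DifferentiableAt ℝ (ballTime r) z :=
  ((contDiffOn_ballTime r).contDiffAt ((isOpen_movingPhase r).mem_nhds hz)).differentiableAt
    (by simp)

/-- Obtained by implicit differentiation of `‖ballExit r z‖ ^ 2 = r ^ 2`. -/
lemma fderiv_ballTime {r : ℝ} (hr : 0 < r) {z : E3 × E3} (hz : z ∈ movingPhase r) (ζ : E3 × E3) :
    fderiv ℝ (ballTime r) z ζ =
      -⟪ballExit r z, ζ.1 - ballTime r z • ζ.2⟫ / √(chordDiscr r z) := by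
  have hd := (differentiableAt_ballTime hz).hasFDerivAt
  have hE : HasFDerivAt (ballExit r) (ContinuousLinearMap.fst ℝ E3 E3 -
      (ballTime r z • ContinuousLinearMap.snd ℝ E3 E3 +
        (fderiv ℝ (ballTime r) z).smulRight z.2)) z :=
    hasFDerivAt_fst.sub (hd.smul hasFDerivAt_snd)
  have h1 := hE.norm_sq
  have h2 : HasFDerivAt (fun z => ‖ballExit r z‖ ^ 2) (0 : E3 × E3 →L[ℝ] ℝ) z := by
    refine (hasFDerivAt_const (r ^ 2) z).congr_of_eventuallyEq ?_
    filter_upwards [(isOpen_movingPhase r).mem_nhds hz] with y hy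
    rw [norm_ballExit hr hy]
  have h3 := congrArg (fun L => L ζ) (h1.unique h2)
  have h4 : ⟪ballExit r z, ζ.1 - ballTime r z • ζ.2 - (fderiv ℝ (ballTime r) z ζ) • z.2⟫ = 0 := by
    simp at h3
    rw [← h3, inner_sub_right, inner_sub_right, inner_smul_right, inner_smul_right]; ring
  rw [inner_sub_right, inner_smul_right, inner_ballExit (mem_movingPhase.1 hz).2] at h4
  have hs := Real.sqrt_pos.2 (chordDiscr_pos hz)
  rw [eq_div_iff hs.ne']; linarith

/-- The gradient of the exit time is singular exactly at the grazing set. -/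
lemma abs_fderiv_ballTime_le {r : ℝ} (hr : 0 < r) {z : E3 × E3} (hz : z ∈ movingPhase r)
    (ζ : E3 × E3) : |fderiv ℝ (ballTime r) z ζ| ≤
      r * (‖ζ.1‖ + ballTime r z * ‖ζ.2‖) / √(chordDiscr r z) := by
  rw [fderiv_ballTime hr hz, abs_div, abs_neg, abs_of_nonneg (Real.sqrt_nonneg _)]
  gcongr
  refine (abs_real_inner_le_norm _ _).trans ?_
  rw [norm_ballExit hr hz]
  gcongr
  refine (norm_sub_le _ _).trans ?_
  rw [norm_smul, Real.norm_of_nonneg (ballTime_pos hz).le]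

/-- The reciprocal of the square root of the distance to the sphere of radius `r`, up to bounded
factors; it controls the `x`-derivatives of `K f`. -/
def boundaryWeight (r : ℝ) (x : E3) : ℝ := (√(r ^ 2 - ‖x‖ ^ 2))⁻¹

lemma boundaryWeight_pos {r : ℝ} {x : E3} (hx : ‖x‖ < r) : 0 < boundaryWeight r x :=
  inv_pos.2 (Real.sqrt_pos.2 (sq_sub_sq_pos hx))

lemma inv_sqrt_chordDiscr_le {r : ℝ} {z : E3 × E3} (hz : z ∈ movingPhase r) :
    (√(chordDiscr r z))⁻¹ ≤ ‖z.2‖⁻¹ * boundaryWeight r z.1 := by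
  obtain ⟨h1, h2⟩ := mem_movingPhase.1 hz
  have hv := norm_pos_iff.2 h2
  have h0 := Real.sqrt_pos.2 (sq_sub_sq_pos h1)
  rw [boundaryWeight, ← mul_inv]
  refine inv_anti₀ (by positivity) ?_
  calc ‖z.2‖ * √(r ^ 2 - ‖z.1‖ ^ 2) = √(‖z.2‖ ^ 2 * (r ^ 2 - ‖z.1‖ ^ 2)) := by
        rw [Real.sqrt_mul (by positivity), Real.sqrt_sq hv.le]
    _ ≤ _ := Real.sqrt_le_sqrt (chordDiscr_ge r z)

/-- Along a chord, the boundary weight is at most the arcsine density divided by the chord length,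
however close to the boundary the chord is. -/
lemma boundaryWeight_chord_le {r : ℝ} (hr : 0 < r) {z : E3 × E3} (hz : z ∈ movingPhase r) {θ : ℝ}
    (h0 : 0 < θ) (h1 : θ < 1) : boundaryWeight r (z.1 - (θ * ballTime r z) • z.2) ≤
      (ballTime r z * ‖z.2‖)⁻¹ * (√(θ * (1 - θ)))⁻¹ := by
  have hv := norm_pos_iff.2 (mem_movingPhase.1 hz).2
  have ht := ballTime_pos hz
  have h3 : 0 < θ * (1 - θ) := mul_pos h0 (by linarith)
  rw [boundaryWeight, ← mul_inv]
  refine inv_anti₀ (by positivity) ?_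
  calc _ = √(θ * (1 - θ) * (ballTime r z * ‖z.2‖) ^ 2) := by
        rw [Real.sqrt_mul h3.le, Real.sqrt_sq (by positivity), mul_comm]
    _ ≤ _ := Real.sqrt_le_sqrt (chord_gap hr hz h0.le h1.le)

lemma gradVec_sqNorm (r : ℝ) (x : E3) :
    gradVec (fun y : E3 => ‖y‖ ^ 2 - r ^ 2) x = fun i => 2 * x i := by
  funext i
  have h := ((hasFDerivAt_id x).norm_sq).sub_const (r ^ 2)
  simp only [id] at h
  rw [gradVec, h.fderiv]
  simp [basisVec, EuclideanSpace.inner_single_right]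

lemma hessMat_sqNorm (r : ℝ) (x : E3) :
    hessMat (fun y : E3 => ‖y‖ ^ 2 - r ^ 2) x = (2 : ℝ) • (1 : Matrix (Fin 3) (Fin 3) ℝ) := by
  ext i j
  have h1 : (fun y => fderiv ℝ (fun y : E3 => ‖y‖ ^ 2 - r ^ 2) y (basisVec j)) =
      fun y : E3 => 2 * y j := by
    funext y; exact congrFun (gradVec_sqNorm r y) j
  have h2 : HasFDerivAt (fun y : E3 => 2 * y j) ((2 : ℝ) • (EuclideanSpace.proj j : E3 →L[ℝ] ℝ)) x :=
    ((EuclideanSpace.proj j : E3 →L[ℝ] ℝ).hasFDerivAt).const_mul 2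
  rw [hessMat, Matrix.of_apply, h1, h2.fderiv]
  simp [basisVec, Matrix.one_apply, eq_comm]

theorem isConvexDomainPosCurvature_ball {r : ℝ} (hr : 0 < r) :
    IsConvexDomainPosCurvature (Metric.ball (0 : E3) r) where
  isOpen := Metric.isOpen_ball
  nonempty := Metric.nonempty_ball.2 hr
  convex := convex_ball _ _
  bounded := Metric.isBounded_ball
  boundary := by
    intro z hz
    rw [frontier_ball _ hr.ne', mem_sphere_zero_iff_norm] at hz
    have hsum : (fun i => 2 * z i) ⬝ᵥ (fun i => 2 * z i) = 4 * r ^ 2 := by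
      have := EuclideanSpace.real_norm_sq_eq z
      rw [hz] at this
      rw [this, dotProduct, Finset.mul_sum]
      exact Finset.sum_congr rfl fun i _ => by ring
    refine ⟨univ, fun y => ‖y‖ ^ 2 - r ^ 2, isOpen_univ, mem_univ _,
      (contDiff_norm_sq ℝ).sub contDiff_const, fun x _ => ?_, ?_, ?_⟩
    · rw [mem_ball_zero_iff, sub_neg, sq_lt_sq₀ (norm_nonneg _) hr.le]
    · intro h0
      rw [gradVec_sqNorm] at h0
      rw [h0] at hsum
      simp at hsum
      exact hr.ne' hsum
    · rw [gaussCurvature, hessMat_sqNorm, gradVec_sqNorm, Matrix.adjugate_smul]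
      simp only [Matrix.adjugate_one, Matrix.smul_mulVec, Matrix.one_mulVec, dotProduct_smul, hsum,
        Fintype.card_fin]
      simp only [smul_eq_mul]
      positivity

/-! ### Singular integrals over `ℝ³` -/

lemma ae_ne_point (a : E3) : ∀ᵐ w : E3, w ≠ a := by
  simp [ae_iff]

lemma integrable_exp_neg_mul_sq_norm {c : ℝ} (hc : 0 < c) :
    Integrable (fun u : E3 => Real.exp (-c * ‖u‖ ^ 2)) := by
  have h := integrable_fun_norm_addHaar (E := E3) volume (f := fun y => Real.exp (-c * y ^ 2))
  refine h.2 ?_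
  have h2 := (integrable_rpow_mul_exp_neg_mul_sq hc (s := 2) (by norm_num)).integrableOn
    (s := Ioi 0)
  refine h2.congr_fun (fun y _ => ?_) measurableSet_Ioi
  simp

lemma integrable_inv_sq_norm_mul_exp {c : ℝ} (hc : 0 < c) :
    Integrable (fun u : E3 => (‖u‖ ^ 2)⁻¹ * Real.exp (-c * ‖u‖ ^ 2)) := by
  have h := integrable_fun_norm_addHaar (E := E3) volume
    (f := fun y => (y ^ 2)⁻¹ * Real.exp (-c * y ^ 2))
  refine h.2 ?_
  refine (integrable_exp_neg_mul_sq hc).integrableOn.congr_fun (fun y hy => ?_) measurableSet_Ioi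
  have hy : 0 < y := hy
  simp only [finrank_euclideanSpace, Fintype.card_fin, smul_eq_mul]
  norm_num
  field_simp

/-- The majorant of the integrands of `K` and of its derivatives: it has a singularity of order `2`
both at `w = v` and at `w = 0`. -/
def singularMajorant (c : ℝ) (v w : E3) : ℝ :=
  ((‖w - v‖ ^ 2)⁻¹ + (‖w‖ ^ 2)⁻¹) * Real.exp (-c * ‖w - v‖ ^ 2)

lemma singularMajorant_nonneg (c : ℝ) (v w : E3) : 0 ≤ singularMajorant c v w := by
  unfold singularMajorant; positivity

lemma singularMajorant_le (c : ℝ) (hc : 0 < c) (v w : E3) : singularMajorant c v w ≤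
    (‖w - v‖ ^ 2)⁻¹ * Real.exp (-c * ‖w - v‖ ^ 2) +
      (Real.exp 1 * ((‖w‖ ^ 2)⁻¹ * Real.exp (-1 * ‖w‖ ^ 2)) + Real.exp (-c * ‖w - v‖ ^ 2)) := by
  unfold singularMajorant
  rw [add_mul]
  gcongr
  rcases le_total (‖w‖ ^ 2) 1 with h | h
  · have h1 : Real.exp (-c * ‖w - v‖ ^ 2) ≤ 1 := Real.exp_le_one_iff.2 (by nlinarith [sq_nonneg ‖w - v‖])
    have h2 : 1 ≤ Real.exp 1 * Real.exp (-1 * ‖w‖ ^ 2) := by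
      rw [← Real.exp_add]; exact Real.one_le_exp (by linarith)
    have h3 : (0 : ℝ) ≤ (‖w‖ ^ 2)⁻¹ := by positivity
    have h4 := Real.exp_pos (-c * ‖w - v‖ ^ 2)
    nlinarith [mul_le_mul_of_nonneg_left (h1.trans h2) h3]
  · have h3 : (‖w‖ ^ 2)⁻¹ ≤ 1 := inv_le_one_of_one_le₀ h
    have h4 := Real.exp_pos (-c * ‖w - v‖ ^ 2)
    have : 0 ≤ Real.exp 1 * ((‖w‖ ^ 2)⁻¹ * Real.exp (-1 * ‖w‖ ^ 2)) := by positivity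
    nlinarith

/-- Both singularities are integrable in dimension `3`, uniformly in `v`. -/
lemma exists_singularMajorant_bound {c : ℝ} (hc : 0 < c) : ∃ C : ℝ, 0 < C ∧ ∀ v : E3,
    Integrable (singularMajorant c v) ∧ ∫ w, singularMajorant c v w ≤ C := by
  obtain ⟨f, hf⟩ : ∃ f : E3 → ℝ, f = fun u => (‖u‖ ^ 2)⁻¹ * Real.exp (-c * ‖u‖ ^ 2) := ⟨_, rfl⟩
  obtain ⟨g, hg⟩ : ∃ g : E3 → ℝ, g = fun u => Real.exp 1 *
    ((‖u‖ ^ 2)⁻¹ * Real.exp (-1 * ‖u‖ ^ 2)) := ⟨_, rfl⟩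
  obtain ⟨k, hk⟩ : ∃ k : E3 → ℝ, k = fun u => Real.exp (-c * ‖u‖ ^ 2) := ⟨_, rfl⟩
  have if' : Integrable f := by rw [hf]; exact integrable_inv_sq_norm_mul_exp hc
  have ig : Integrable g := by rw [hg]; exact (integrable_inv_sq_norm_mul_exp one_pos).const_mul _
  have ik : Integrable k := by rw [hk]; exact integrable_exp_neg_mul_sq_norm hc
  refine ⟨|∫ u, f u| + (|∫ u, g u| + |∫ u, k u|) + 1, by positivity, fun v => ?_⟩
  have i1 := if'.comp_sub_right v
  have i3 := ik.comp_sub_right v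
  have hle : ∀ w, singularMajorant c v w ≤ f (w - v) + (g w + k (w - v)) := fun w => by
    rw [hf, hg, hk]; exact singularMajorant_le c hc v w
  have hm : Measurable (singularMajorant c v) := by
    unfold singularMajorant; fun_prop
  have i23 : Integrable (fun w => g w + k (w - v)) := ig.add i3
  have i4 : Integrable (fun w => f (w - v) + (g w + k (w - v))) := i1.add i23
  have hi : Integrable (singularMajorant c v) := i4.mono' hm.aestronglyMeasurable
    (ae_of_all _ fun w => by
      rw [Real.norm_of_nonneg (singularMajorant_nonneg _ _ _)]; exact hle w)
  refine ⟨hi, ?_⟩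
  have := integral_mono hi i4 hle
  rw [integral_add i1 i23, integral_add ig i3, integral_sub_right_eq_self f,
    integral_sub_right_eq_self k] at this
  have h1 := le_abs_self (∫ u, f u)
  have h2 := le_abs_self (∫ u, g u)
  have h3 := le_abs_self (∫ u, k u)
  linarith

/-- Dominated convergence for integrands with two singularities, one of which moves with the
parameter. The integrand is split into a part that is only singular at the moving point, which is
translated to `0`, and a part that is only singular at `0`. -/
theorem continuousAt_integral_of_singular {Z F : Type*} [TopologicalSpace Z]
    [FirstCountableTopology Z] [NormedAddCommGroup F] [NormedSpace ℝ F] {vel : Z → E3} {z₀ : Z}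
    (hvel : ContinuousAt vel z₀) {a : Z → E3 → F} {c C : ℝ} (hc : 0 < c)
    (hmeas : ∀ᶠ z in 𝓝 z₀, AEStronglyMeasurable (a z))
    (hbound : ∀ᶠ z in 𝓝 z₀, ∀ w, w ≠ 0 → w ≠ vel z → ‖a z w‖ ≤ C * singularMajorant c (vel z) w)
    (hcont : ∀ w, w ≠ 0 → w ≠ vel z₀ → ContinuousAt (Function.uncurry a) (z₀, w)) :
    ContinuousAt (fun z => ∫ w, a z w) z₀ := by
  -- `p` vanishes at `0`, `q` vanishes at the moving point, and `p + q = 1`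
  set p : Z → E3 → ℝ := fun z w => ‖w‖ ^ 2 / (‖w‖ ^ 2 + ‖w - vel z‖ ^ 2) with hp
  set q : Z → E3 → ℝ := fun z w => ‖w - vel z‖ ^ 2 / (‖w‖ ^ 2 + ‖w - vel z‖ ^ 2) with hq
  have hpm : ∀ z, Measurable (p z) := fun z => by simp only [hp]; fun_prop
  have hqm : ∀ z, Measurable (q z) := fun z => by simp only [hq]; fun_prop
  have hC : ∀ᶠ z in 𝓝 z₀, ∀ w, w ≠ 0 → w ≠ vel z → ‖p z w • a z w‖ ≤
      |C| * ((‖w - vel z‖ ^ 2)⁻¹ * Real.exp (-c * ‖w - vel z‖ ^ 2)) ∧ ‖q z w • a z w‖ ≤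
      |C| * ((‖w‖ ^ 2)⁻¹ * Real.exp (-c * ‖w - vel z‖ ^ 2)) := by
    filter_upwards [hbound] with z hz w h0 h1
    have n0 : 0 < ‖w‖ := norm_pos_iff.2 h0
    have n1 : 0 < ‖w - vel z‖ := norm_pos_iff.2 (sub_ne_zero.2 h1)
    have hb := (hz w h0 h1).trans
      (mul_le_mul_of_nonneg_right (le_abs_self C) (singularMajorant_nonneg c (vel z) w))
    have hp0 : 0 ≤ p z w := by simp only [hp]; positivity
    have hq0 : 0 ≤ q z w := by simp only [hq]; positivity
    rw [norm_smul, norm_smul, Real.norm_of_nonneg hp0, Real.norm_of_nonneg hq0]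
    constructor
    · refine (mul_le_mul_of_nonneg_left hb hp0).trans_eq ?_
      simp only [hp, singularMajorant]; field_simp
    · refine (mul_le_mul_of_nonneg_left hb hq0).trans_eq ?_
      simp only [hq, singularMajorant]; field_simp
  -- The moving Gaussian is dominated by a fixed one, since the velocity is bounded near `z₀`.
  have hR : ∀ᶠ z in 𝓝 z₀, ‖vel z‖ < ‖vel z₀‖ + 1 :=
    hvel.norm.eventually_lt_const (by linarith)
  set R := ‖vel z₀‖ + 1
  have hexp : ∀ z, ‖vel z‖ < R → ∀ w : E3, Real.exp (-c * ‖w - vel z‖ ^ 2) ≤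
      Real.exp (c * R ^ 2) * Real.exp (-(c / 2) * ‖w‖ ^ 2) := by
    intro z hz w
    rw [← Real.exp_add]
    refine Real.exp_le_exp.2 ?_
    have h1 : ‖w‖ ≤ ‖w - vel z‖ + ‖vel z‖ := by simpa using norm_add_le (w - vel z) (vel z)
    have h2 : ‖w‖ ^ 2 ≤ 2 * ‖w - vel z‖ ^ 2 + 2 * R ^ 2 := by
      nlinarith [norm_nonneg w, norm_nonneg (vel z), norm_nonneg (w - vel z),
        sq_nonneg (‖w - vel z‖ - R)]
    nlinarith
  have hshift : ∀ z, (∀ᵐ u : E3, u + vel z ≠ 0 ∧ u + vel z ≠ vel z) := fun z => by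
    filter_upwards [ae_ne_point 0, ae_ne_point (-vel z)] with u h1 h2
    exact ⟨fun h => h2 (eq_neg_of_add_eq_zero_left h), by simpa using h1⟩
  have c1 : ContinuousAt (fun z => ∫ u, p z (u + vel z) • a z (u + vel z)) z₀ := by
    refine continuousAt_of_dominated (bound := fun u => |C| * ((‖u‖ ^ 2)⁻¹ * Real.exp (-c * ‖u‖ ^ 2)))
      ?_ ?_ ((integrable_inv_sq_norm_mul_exp hc).const_mul _) ?_
    · filter_upwards [hmeas] with z hz
      exact ((hpm z).aestronglyMeasurable.smul hz).comp_measurePreserving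
        (measurePreserving_add_right volume (vel z))
    · filter_upwards [hC] with z hz
      filter_upwards [hshift z] with u hu
      simpa using (hz (u + vel z) hu.1 hu.2).1
    · filter_upwards [hshift z₀] with u hu
      have e : ContinuousAt (fun z => (z, u + vel z)) z₀ :=
        continuousAt_id.prodMk (continuousAt_const.add hvel)
      have e1 : ContinuousAt (fun z => a z (u + vel z)) z₀ :=
        ContinuousAt.comp (g := Function.uncurry a) (f := fun z => (z, u + vel z))
          (hcont _ hu.1 hu.2) e
      refine ContinuousAt.smul ?_ e1
      simp only [hp]
      have : 0 < ‖u + vel z₀‖ := norm_pos_iff.2 hu.1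
      refine ContinuousAt.div (by fun_prop) (by fun_prop) (by positivity)
  have c2 : ContinuousAt (fun z => ∫ w, q z w • a z w) z₀ := by
    refine continuousAt_of_dominated (bound := fun w => |C| * (Real.exp (c * R ^ 2) *
      ((‖w‖ ^ 2)⁻¹ * Real.exp (-(c / 2) * ‖w‖ ^ 2)))) ?_ ?_
      (((integrable_inv_sq_norm_mul_exp (half_pos hc)).const_mul _).const_mul _) ?_
    · filter_upwards [hmeas] with z hz
      exact (hqm z).aestronglyMeasurable.smul hz
    · filter_upwards [hC, hR] with z hz hzR
      filter_upwards [ae_ne_point 0, ae_ne_point (vel z)] with w h0 h1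
      refine (hz w h0 h1).2.trans ?_
      have := mul_le_mul_of_nonneg_left (hexp z hzR w) (show (0 : ℝ) ≤ (‖w‖ ^ 2)⁻¹ by positivity)
      refine mul_le_mul_of_nonneg_left (this.trans_eq (by ring)) (abs_nonneg C)
    · filter_upwards [ae_ne_point 0, ae_ne_point (vel z₀)] with w h0 h1
      have e1 : ContinuousAt (fun z => a z w) z₀ :=
        ContinuousAt.comp (g := Function.uncurry a) (f := fun z => (z, w))
          (hcont _ h0 h1) (continuousAt_id.prodMk continuousAt_const)
      refine ContinuousAt.smul ?_ e1
      simp only [hq]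
      have : 0 < ‖w‖ := norm_pos_iff.2 h0
      refine ContinuousAt.div (by fun_prop) (by fun_prop) (by positivity)
  refine (c1.add c2).congr ?_
  filter_upwards [hC, hmeas, hR] with z hz hm hzR
  have i1 : Integrable (fun w => p z w • a z w) := by
    refine (((integrable_inv_sq_norm_mul_exp hc).comp_sub_right (vel z)).const_mul |C|).mono'
      ((hpm z).aestronglyMeasurable.smul hm) ?_
    filter_upwards [ae_ne_point 0, ae_ne_point (vel z)] with w h0 h1 using (hz w h0 h1).1
  have i2 : Integrable (fun w => q z w • a z w) := by
    obtain ⟨C', -, hC'⟩ := exists_singularMajorant_bound hc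
    refine ((hC' (vel z)).1.const_mul |C|).mono' ((hqm z).aestronglyMeasurable.smul hm) ?_
    filter_upwards [ae_ne_point 0, ae_ne_point (vel z)] with w h0 h1
    refine (hz w h0 h1).2.trans ?_
    unfold singularMajorant
    gcongr
    simp only [le_add_iff_nonneg_left]; positivity
  change (∫ u, p z (u + vel z) • a z (u + vel z)) + (∫ w, q z w • a z w) = _
  rw [integral_add_right_eq_self (fun w => p z w • a z w) (vel z), ← integral_add i1 i2]
  refine integral_congr_ae ?_
  filter_upwards [ae_ne_point 0] with w h0
  have : 0 < ‖w‖ := norm_pos_iff.2 h0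
  rw [← add_smul]
  have e : p z w + q z w = 1 := by
    simp only [hp, hq]; field_simp
  rw [e, one_smul]

/-! ### Bounds for the collision kernel -/

/-- The exponential factor of the gain part of the kernel, against the weights `e^{-β|v|²}`. -/
lemma gain_exp_le {β : ℝ} (h0 : 0 ≤ β) {a N : ℝ} (ha : 0 < a) :
    Real.exp (-(1 / 4) * (N ^ 2 / a ^ 2) - 1 / 4 * a ^ 2) ≤
      Real.exp (-((1 - 2 * β) / 4) * (N ^ 2 / a ^ 2 + a ^ 2)) * Real.exp (β * N) := by
  rw [← Real.exp_add]
  refine Real.exp_le_exp.2 ?_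
  have h : 0 ≤ N ^ 2 / a ^ 2 + a ^ 2 + 2 * N := by
    have : N ^ 2 / a ^ 2 + a ^ 2 + 2 * N = (N / a + a) ^ 2 := by field_simp; ring
    rw [this]; positivity
  nlinarith

lemma sq_norm_sub_le_two_mul (v w : E3) : ‖w - v‖ ^ 2 ≤ 2 * (‖w‖ ^ 2 + ‖v‖ ^ 2) := by
  nlinarith [norm_sub_le w v, norm_nonneg w, norm_nonneg v, norm_nonneg (w - v),
    sq_nonneg (‖w‖ - ‖v‖)]

lemma loss_exp_le {β : ℝ} (h0 : 0 ≤ β) (h1 : β < 1 / 2) (v w : E3) :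
    Real.exp (-(1 / 2) * (‖w‖ ^ 2 + ‖v‖ ^ 2)) ≤
      Real.exp (-((1 - 2 * β) / 4) * ‖w - v‖ ^ 2) * Real.exp (β * (‖w‖ ^ 2 - ‖v‖ ^ 2)) := by
  rw [← Real.exp_add]
  refine Real.exp_le_exp.2 ?_
  have := sq_norm_sub_le_two_mul v w
  have h2 : 0 ≤ (1 - 2 * β) / 4 := by linarith
  nlinarith [mul_nonneg h0 (sq_nonneg ‖w‖)]

lemma mul_exp_neg_le {c : ℝ} (hc : 0 < c) (y : ℝ) :
    y * Real.exp (-c * y) ≤ 1 / c := by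
  have h := Real.add_one_le_exp (c * y)
  rw [neg_mul, Real.exp_neg, ← div_eq_mul_inv, div_le_div_iff₀ (Real.exp_pos _) hc]
  linarith

lemma exp_split (c y : ℝ) : Real.exp (-c * y) = Real.exp (-(c / 2) * y) * Real.exp (-(c / 2) * y) := by
  rw [← Real.exp_add]; congr 1; ring

/-- The rate of the Gaussian in `w - v` that remains of the kernel against the weights. -/
def kernelRate (β : ℝ) : ℝ := (1 - 2 * β) / 8

lemma kernelRate_pos {β : ℝ} (h1 : β < 1 / 2) : 0 < kernelRate β := by
  unfold kernelRate; linarith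

lemma hardSphereK_eq (v w : E3) : hardSphereK v w = (2 : ℝ) ^ (-(3 / 2) : ℝ) * Real.pi⁻¹ *
    (2 * ‖w - v‖⁻¹ * Real.exp (-(1 / 4) * ((‖w‖ ^ 2 - ‖v‖ ^ 2) ^ 2 / ‖w - v‖ ^ 2) -
      (1 / 4) * ‖w - v‖ ^ 2) - ‖w - v‖ * Real.exp (-(1 / 2) * (‖w‖ ^ 2 + ‖v‖ ^ 2))) := rfl

/-- The estimate of Grad: conjugation with the weight `e^{-β|v|²}` leaves a weakly singular kernel with
Gaussian decay in `w - v`. -/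
lemma exists_hardSphereK_bound {β : ℝ} (h0 : 0 ≤ β) (h1 : β < 1 / 2) :
    ∃ C : ℝ, 0 < C ∧ ∀ v w : E3, w ≠ v → |hardSphereK v w| ≤
      C * ‖w - v‖⁻¹ * Real.exp (-kernelRate β * ‖w - v‖ ^ 2) *
        Real.exp (β * (‖w‖ ^ 2 - ‖v‖ ^ 2)) := by
  have hκ := kernelRate_pos h1
  set κ := kernelRate β with hκdef
  have hκ2 : (1 - 2 * β) / 4 = 2 * κ := by rw [hκdef, kernelRate]; ring
  refine ⟨(2 : ℝ) ^ (-(3 / 2) : ℝ) * Real.pi⁻¹ * (2 + 1 / κ), by positivity, fun v w hw => ?_⟩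
  have ha : 0 < ‖w - v‖ := norm_pos_iff.2 (sub_ne_zero.2 hw)
  set a := ‖w - v‖
  set N := ‖w‖ ^ 2 - ‖v‖ ^ 2
  have hg := gain_exp_le h0 (N := N) ha
  have hl := loss_exp_le h0 h1 v w
  rw [hκ2] at hg hl
  set E := Real.exp (-κ * a ^ 2)
  have hE : Real.exp (-(2 * κ) * a ^ 2) = E * E := by
    rw [exp_split, show 2 * κ / 2 = κ by ring]
  have hg2 : Real.exp (-(2 * κ) * (N ^ 2 / a ^ 2 + a ^ 2)) ≤ E := by
    refine Real.exp_le_exp.2 ?_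
    have : 0 ≤ N ^ 2 / a ^ 2 := by positivity
    nlinarith [sq_nonneg a]
  have hE0 : 0 < E := Real.exp_pos _
  have hX := Real.exp_pos (β * N)
  have hy := mul_exp_neg_le hκ (a ^ 2)
  rw [hardSphereK_eq, abs_mul, abs_of_nonneg (by positivity : (0 : ℝ) ≤ 2 ^ (-(3 / 2) : ℝ) * Real.pi⁻¹)]
  have t1 : 2 * a⁻¹ * Real.exp (-(1 / 4) * (N ^ 2 / a ^ 2) - 1 / 4 * a ^ 2) ≤
      2 * a⁻¹ * (E * Real.exp (β * N)) := by
    gcongr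
    exact hg.trans (mul_le_mul_of_nonneg_right hg2 hX.le)
  have t2 : a * Real.exp (-(1 / 2) * (‖w‖ ^ 2 + ‖v‖ ^ 2)) ≤ a⁻¹ * (1 / κ) * (E * Real.exp (β * N)) := by
    calc _ ≤ a * (Real.exp (-(2 * κ) * a ^ 2) * Real.exp (β * N)) := by gcongr
      _ = a⁻¹ * (a ^ 2 * E) * (E * Real.exp (β * N)) := by rw [hE]; field_simp
      _ ≤ _ := by gcongr
  have t3 := (abs_sub _ _).trans ((congrArg₂ (· + ·) (abs_of_nonneg (by positivity))
    (abs_of_nonneg (by positivity))).trans_le (add_le_add t1 t2))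
  calc _ ≤ _ := mul_le_mul_of_nonneg_left t3 (by positivity)
    _ = _ := by ring

lemma contDiffAt_hardSphereK {v w : E3} (h : w ≠ v) :
    ContDiffAt ℝ ∞ (fun z : E3 × E3 => hardSphereK z.1 z.2) (v, w) := by
  have ha0 : w - v ≠ 0 := sub_ne_zero.2 h
  have ha : ‖w - v‖ ≠ 0 := norm_ne_zero_iff.2 ha0
  have hd : ContDiffAt ℝ ∞ (fun z : E3 × E3 => ‖z.2 - z.1‖) (v, w) :=
    (contDiffAt_snd.sub contDiffAt_fst).norm ℝ ha0
  have h1 : ContDiffAt ℝ ∞ (fun z : E3 × E3 => ‖z.1‖ ^ 2) (v, w) := contDiffAt_fst.norm_sq ℝ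
  have h2 : ContDiffAt ℝ ∞ (fun z : E3 × E3 => ‖z.2‖ ^ 2) (v, w) := contDiffAt_snd.norm_sq ℝ
  unfold hardSphereK
  refine contDiffAt_const.mul (ContDiffAt.sub ?_ ?_)
  · refine (contDiffAt_const.mul (hd.inv ha)).mul (ContDiffAt.exp ?_)
    refine ContDiffAt.sub (contDiffAt_const.mul ?_) (contDiffAt_const.mul (hd.pow 2))
    exact ((h2.sub h1).pow 2).div (hd.pow 2) (pow_ne_zero 2 ha)
  · exact hd.mul (ContDiffAt.exp (contDiffAt_const.mul (h2.add h1)))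

/-- The derivative of the kernel in its first variable. -/
def kernelDeriv (v w : E3) : E3 →L[ℝ] ℝ := fderiv ℝ (fun v' => hardSphereK v' w) v

/-- The partial derivative of the kernel in terms of the joint one. -/
lemma hasFDerivAt_hardSphereK_comp {v w : E3} (h : w ≠ v) :
    HasFDerivAt (fun v' => hardSphereK v' w)
      ((fderiv ℝ (fun z : E3 × E3 => hardSphereK z.1 z.2) (v, w)).comp
        (ContinuousLinearMap.inl ℝ E3 E3)) v := by
  obtain ⟨f, hf⟩ : ∃ f : E3 × E3 → ℝ, f = fun z => hardSphereK z.1 z.2 := ⟨_, rfl⟩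
  have hd : HasFDerivAt f (fderiv ℝ f (v, w)) (v, w) := by
    rw [hf]; exact ((contDiffAt_hardSphereK h).differentiableAt (by simp)).hasFDerivAt
  have hc : HasFDerivAt (fun v' => f (v', w)) _ v := hd.comp v (hasFDerivAt_prodMk_left v w)
  rw [hf] at hc
  exact hc

lemma kernelDeriv_eq {v w : E3} (h : w ≠ v) : kernelDeriv v w =
    (fderiv ℝ (fun z : E3 × E3 => hardSphereK z.1 z.2) (v, w)).comp
      (ContinuousLinearMap.inl ℝ E3 E3) :=
  (hasFDerivAt_hardSphereK_comp h).fderiv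

lemma hasFDerivAt_hardSphereK {v w : E3} (h : w ≠ v) :
    HasFDerivAt (fun v' => hardSphereK v' w) (kernelDeriv v w) v := by
  rw [kernelDeriv_eq h]; exact hasFDerivAt_hardSphereK_comp h

lemma continuousAt_kernelDeriv {v w : E3} (h : w ≠ v) :
    ContinuousAt (fun z : E3 × E3 => kernelDeriv z.1 z.2) (v, w) := by
  have h1 : ContinuousAt (fderiv ℝ (fun z : E3 × E3 => hardSphereK z.1 z.2)) (v, w) :=
    (contDiffAt_hardSphereK h).continuousAt_fderiv (by simp)
  have h2 : ContinuousAt (fun z : E3 × E3 => (fderiv ℝ (fun z : E3 × E3 =>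
      hardSphereK z.1 z.2) z).comp (ContinuousLinearMap.inl ℝ E3 E3)) (v, w) :=
    h1.clm_comp continuousAt_const
  refine h2.congr ?_
  have : IsOpen {z : E3 × E3 | z.2 ≠ z.1} := isOpen_ne_fun continuous_snd continuous_fst
  filter_upwards [this.mem_nhds h] with z hz using (kernelDeriv_eq hz).symm

/-- The derivative of the kernel along a line. -/
lemma kernelDeriv_apply {v w : E3} (h : w ≠ v) (e : E3) :
    let a := ‖w - v‖
    let N := ‖w‖ ^ 2 - ‖v‖ ^ 2
    let t := ⟪w - v, e⟫ / a
    let p := ⟪v, e⟫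
    kernelDeriv v w e = (2 : ℝ) ^ (-(3 / 2) : ℝ) * Real.pi⁻¹ *
      ((2 * t / a ^ 2 + 2 * a⁻¹ * (N * p / a ^ 2 - N ^ 2 * t / (2 * a ^ 3) + a * t / 2)) *
        Real.exp (-(1 / 4) * (N ^ 2 / a ^ 2) - (1 / 4) * a ^ 2) +
      (t + a * p) * Real.exp (-(1 / 2) * (‖w‖ ^ 2 + ‖v‖ ^ 2))) := by
  intro a N t p
  have ha : 0 < a := norm_pos_iff.2 (sub_ne_zero.2 h)
  have hline : HasDerivAt (fun s : ℝ => v + s • e) e 0 := by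
    simpa using ((hasDerivAt_id (0 : ℝ)).smul_const e).const_add v
  have hk : HasDerivAt (fun s : ℝ => hardSphereK (v + s • e) w) (kernelDeriv v w e) 0 := by
    have h0 : HasFDerivAt (fun v' => hardSphereK v' w) (kernelDeriv v w) (v + (0 : ℝ) • e) := by
      simpa using hasFDerivAt_hardSphereK h
    exact h0.comp_hasDerivAt 0 hline
  have hP : HasDerivAt (fun s : ℝ => ‖v + s • e‖ ^ 2) (2 * p) 0 := by
    simpa using hline.norm_sq
  have hQ : HasDerivAt (fun s : ℝ => ‖w - (v + s • e)‖ ^ 2) (-2 * (a * t)) 0 := by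
    have := (hline.const_sub w).norm_sq
    convert this using 1
    simp only [zero_smul, add_zero, inner_neg_right, t]
    field_simp
  have hA : HasDerivAt (fun s : ℝ => ‖w - (v + s • e)‖) (-t) 0 := by
    have h2 := hQ.sqrt (by simpa using sub_ne_zero.2 h)
    simp only [Real.sqrt_sq (norm_nonneg _), zero_smul, add_zero] at h2
    convert h2 using 1
    change -t = -2 * (a * t) / (2 * a)
    field_simp
  have hA0 : ‖w - (v + (0 : ℝ) • e)‖ = a := by simp [a]
  have hP0 : ‖v + (0 : ℝ) • e‖ = ‖v‖ := by simp
  have g1 := ((((hP.const_sub (‖w‖ ^ 2)).pow 2).div hQ (by rw [hA0]; positivity)).const_mul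
    (-(1 / 4))).sub (hQ.const_mul (1 / 4))
  have g2 := ((hA.inv (by rw [hA0]; positivity)).const_mul 2).mul g1.exp
  have g3 := hA.mul ((hP.const_add (‖w‖ ^ 2)).const_mul (-(1 / 2))).exp
  have g4 := (g2.sub g3).const_mul ((2 : ℝ) ^ (-(3 / 2) : ℝ) * Real.pi⁻¹)
  refine (hk.unique (g4.congr_of_eventuallyEq (Filter.Eventually.of_forall fun s => ?_))).trans ?_
  · simp [hardSphereK]
  · simp only [Pi.div_apply, Pi.sub_apply, Pi.inv_apply, Pi.pow_apply, hA0, hP0]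
    congr 1
    have hN : ‖w‖ ^ 2 - ‖v‖ ^ 2 = N := rfl
    rw [hN]
    field_simp
    ring

set_option maxHeartbeats 1000000 in
/-- One derivative costs one order of singularity and a factor `1 + |v|`; the kernel of the
derivative is still integrable. -/
lemma exists_kernelDeriv_bound {β : ℝ} (h0 : 0 ≤ β) (h1 : β < 1 / 2) :
    ∃ C : ℝ, 0 < C ∧ ∀ v w : E3, w ≠ v → ‖kernelDeriv v w‖ ≤
      C * (1 + ‖v‖) * (‖w - v‖ ^ 2)⁻¹ * Real.exp (-kernelRate β * ‖w - v‖ ^ 2) *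
        Real.exp (β * (‖w‖ ^ 2 - ‖v‖ ^ 2)) := by
  have hκ := kernelRate_pos h1
  set κ := kernelRate β with hκdef
  have hκ2 : (1 - 2 * β) / 4 = 2 * κ := by rw [hκdef, kernelRate]; ring
  set c₀ := (2 : ℝ) ^ (-(3 / 2) : ℝ) * Real.pi⁻¹ with hc₀
  have hc₀' : 0 < c₀ := by positivity
  refine ⟨c₀ * ((3 + 2 / κ) + 2 * (1 + 2 * (1 / κ) ^ 2 * 4)), by positivity, fun v w hw => ?_⟩
  have ha : 0 < ‖w - v‖ := norm_pos_iff.2 (sub_ne_zero.2 hw)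
  refine ContinuousLinearMap.opNorm_le_bound _ (by positivity) fun e => ?_
  rw [kernelDeriv_apply hw e, Real.norm_eq_abs]
  set a := ‖w - v‖
  set N := ‖w‖ ^ 2 - ‖v‖ ^ 2
  set t := ⟪w - v, e⟫ / a
  set p := ⟪v, e⟫
  have ht : |t| ≤ ‖e‖ := by
    simp only [t]
    rw [abs_div, abs_of_pos ha, div_le_iff₀ ha, mul_comm]
    exact abs_real_inner_le_norm _ _
  have hp : |p| ≤ ‖v‖ * ‖e‖ := abs_real_inner_le_norm _ _
  have hg := gain_exp_le h0 (N := N) ha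
  have hl := loss_exp_le h0 h1 v w
  rw [hκ2] at hg hl
  set E := Real.exp (-κ * a ^ 2)
  have hE0 : 0 < E := Real.exp_pos _
  have hX := Real.exp_pos (β * N)
  set X := Real.exp (β * N)
  set m := ‖e‖
  have hm : 0 ≤ m := norm_nonneg e
  have hv : 0 ≤ ‖v‖ := norm_nonneg v
  -- In terms of `s` the exponent of the gain part is `-(s² + a²) / 4`, and `s` is otherwise free.
  set s := |N| / a with hs
  have hs0 : 0 ≤ s := by positivity
  have hNs : |N| = s * a := by rw [hs]; field_simp
  have hs2 : N ^ 2 / a ^ 2 = s ^ 2 := by rw [← sq_abs, hNs]; field_simp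
  rw [hs2] at hg
  rw [hs2, abs_mul, abs_of_pos hc₀']
  -- The coefficient of the gain part is a polynomial in `s`, `a`, `|v|`, divided by `a²`.
  have b1 : |2 * t / a ^ 2 + 2 * a⁻¹ * (N * p / a ^ 2 - N ^ 2 * t / (2 * a ^ 3) + a * t / 2)| ≤
      (a ^ 2)⁻¹ * m * (2 + 2 * s * ‖v‖ + s ^ 2 + a ^ 2) := by
    have e1 : |2 * t / a ^ 2| ≤ 2 * m / a ^ 2 := by
      rw [abs_div, abs_mul, abs_of_pos (by positivity : (0 : ℝ) < a ^ 2), abs_two]; gcongr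
    have e2 : |N * p / a ^ 2| ≤ s * a * (‖v‖ * m) / a ^ 2 := by
      rw [abs_div, abs_mul, abs_of_pos (by positivity : (0 : ℝ) < a ^ 2), hNs]; gcongr
    have e3 : |N ^ 2 * t / (2 * a ^ 3)| ≤ (s * a) ^ 2 * m / (2 * a ^ 3) := by
      rw [abs_div, abs_mul, abs_of_pos (by positivity : (0 : ℝ) < 2 * a ^ 3), abs_pow, hNs]; gcongr
    have e4 : |a * t / 2| ≤ a * m / 2 := by
      rw [abs_div, abs_mul, abs_of_pos ha, abs_two]; gcongr
    calc _ ≤ |2 * t / a ^ 2| + 2 * a⁻¹ * (|N * p / a ^ 2| + |N ^ 2 * t / (2 * a ^ 3)| + |a * t / 2|) := by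
          refine (abs_add_le _ _).trans ?_
          rw [abs_mul, abs_of_pos (by positivity : (0 : ℝ) < 2 * a⁻¹)]
          gcongr
          exact (abs_add_le _ _).trans (add_le_add_left (abs_sub _ _) _)
      _ ≤ 2 * m / a ^ 2 + 2 * a⁻¹ * (s * a * (‖v‖ * m) / a ^ 2 + (s * a) ^ 2 * m / (2 * a ^ 3) +
          a * m / 2) := by gcongr
      _ = _ := by field_simp; ring
  have b2 : (2 + 2 * s * ‖v‖ + s ^ 2 + a ^ 2) * Real.exp (-(2 * κ) * (s ^ 2 + a ^ 2)) ≤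
      (3 + 2 / κ) * (1 + ‖v‖) * E := by
    have f1 : 2 + 2 * s * ‖v‖ + s ^ 2 + a ^ 2 ≤ (3 + 2 * (s ^ 2 + a ^ 2)) * (1 + ‖v‖) := by
      have g1 : 2 * s * ‖v‖ ≤ (s ^ 2 + 1) * ‖v‖ := by
        gcongr; linarith [sq_nonneg (s - 1)]
      have g2 : 0 ≤ (s ^ 2 + 2 * a ^ 2 + 2) * ‖v‖ := by positivity
      linarith [sq_nonneg s, sq_nonneg a]
    have f2 : Real.exp (-(2 * κ) * (s ^ 2 + a ^ 2)) =
        Real.exp (-κ * (s ^ 2 + a ^ 2)) * Real.exp (-κ * (s ^ 2 + a ^ 2)) := by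
      rw [← Real.exp_add]; congr 1; ring
    have f3 : Real.exp (-κ * (s ^ 2 + a ^ 2)) ≤ E :=
      Real.exp_le_exp.2 (by nlinarith [mul_nonneg hκ.le (sq_nonneg s)])
    have f4 := mul_exp_neg_le hκ (s ^ 2 + a ^ 2)
    have f5 : Real.exp (-κ * (s ^ 2 + a ^ 2)) ≤ 1 :=
      Real.exp_le_one_iff.2 (by nlinarith [sq_nonneg s, sq_nonneg a])
    have f6 : (3 + 2 * (s ^ 2 + a ^ 2)) * Real.exp (-κ * (s ^ 2 + a ^ 2)) ≤ 3 + 2 / κ := by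
      have : 2 / κ = 2 * (1 / κ) := by ring
      rw [this]; linarith
    rw [f2]
    calc _ ≤ ((3 + 2 * (s ^ 2 + a ^ 2)) * (1 + ‖v‖)) *
          (Real.exp (-κ * (s ^ 2 + a ^ 2)) * Real.exp (-κ * (s ^ 2 + a ^ 2))) := by gcongr
      _ = ((3 + 2 * (s ^ 2 + a ^ 2)) * Real.exp (-κ * (s ^ 2 + a ^ 2))) * (1 + ‖v‖) *
          Real.exp (-κ * (s ^ 2 + a ^ 2)) := by ring
      _ ≤ _ := by gcongr
  -- The loss part is bounded, and its Gaussian makes up for the factor `a²`.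
  have b3 : |t + a * p| ≤ m * (1 + a) * (1 + ‖v‖) := by
    refine (abs_add_le _ _).trans ?_
    rw [abs_mul, abs_of_pos ha]
    have : a * |p| ≤ a * (‖v‖ * m) := by gcongr
    linarith [mul_nonneg hm ha.le, mul_nonneg hm hv]
  have b4 : (1 + a) * Real.exp (-(2 * κ) * a ^ 2) ≤
      (a ^ 2)⁻¹ * (2 * (1 + 2 * (1 / κ) ^ 2 * 4)) * E := by
    have f2 : Real.exp (-(2 * κ) * a ^ 2) = E * E := by
      simp only [E]; rw [← Real.exp_add]; congr 1; ring
    have f3 : a ^ 2 * Real.exp (-(κ / 2) * a ^ 2) ≤ 1 / (κ / 2) := mul_exp_neg_le (half_pos hκ) _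
    have f4 : E = Real.exp (-(κ / 2) * a ^ 2) * Real.exp (-(κ / 2) * a ^ 2) := exp_split _ _
    have f5 : a ^ 4 * E ≤ (1 / (κ / 2)) ^ 2 := by
      rw [f4]
      calc _ = (a ^ 2 * Real.exp (-(κ / 2) * a ^ 2)) ^ 2 := by ring
        _ ≤ _ := by gcongr
    have f6 : E ≤ 1 := Real.exp_le_one_iff.2 (by nlinarith [sq_nonneg a])
    have f7 : a ^ 2 * (1 + a) ≤ 2 * (1 + a ^ 4) := by
      nlinarith [sq_nonneg (a ^ 2 - 1), sq_nonneg (a ^ 2 - a), sq_nonneg (a ^ 2)]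
    have f8 : (1 / (κ / 2)) ^ 2 = (1 / κ) ^ 2 * 4 := by field_simp; norm_num
    rw [f2]
    have : a ^ 2 * (1 + a) * E ≤ 2 * (1 + 2 * (1 / κ) ^ 2 * 4) := by
      have : 0 ≤ (1 / κ) ^ 2 := by positivity
      calc _ ≤ 2 * (1 + a ^ 4) * E := by gcongr
        _ = 2 * (E + a ^ 4 * E) := by ring
        _ ≤ _ := by rw [f8] at f5; linarith
    calc (1 + a) * (E * E) = (a ^ 2)⁻¹ * (a ^ 2 * (1 + a) * E) * E := by field_simp
      _ ≤ _ := by gcongr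
  have hfin : |(2 * t / a ^ 2 + 2 * a⁻¹ * (N * p / a ^ 2 - N ^ 2 * t / (2 * a ^ 3) + a * t / 2)) *
        Real.exp (-(1 / 4) * s ^ 2 - 1 / 4 * a ^ 2) +
      (t + a * p) * Real.exp (-(1 / 2) * (‖w‖ ^ 2 + ‖v‖ ^ 2))| ≤
      (a ^ 2)⁻¹ * m * ((3 + 2 / κ) * (1 + ‖v‖) * E) * X +
      m * (1 + ‖v‖) * ((a ^ 2)⁻¹ * (2 * (1 + 2 * (1 / κ) ^ 2 * 4)) * E) * X := by
    refine (abs_add_le _ _).trans (add_le_add ?_ ?_)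
    · rw [abs_mul, abs_of_pos (Real.exp_pos _)]
      calc _ ≤ ((a ^ 2)⁻¹ * m * (2 + 2 * s * ‖v‖ + s ^ 2 + a ^ 2)) *
            (Real.exp (-(2 * κ) * (s ^ 2 + a ^ 2)) * X) := by gcongr
        _ = (a ^ 2)⁻¹ * m * ((2 + 2 * s * ‖v‖ + s ^ 2 + a ^ 2) *
            Real.exp (-(2 * κ) * (s ^ 2 + a ^ 2))) * X := by ring
        _ ≤ _ := by gcongr
    · rw [abs_mul, abs_of_pos (Real.exp_pos _)]
      calc _ ≤ (m * (1 + a) * (1 + ‖v‖)) * (Real.exp (-(2 * κ) * a ^ 2) * X) := by gcongr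
        _ = m * (1 + ‖v‖) * ((1 + a) * Real.exp (-(2 * κ) * a ^ 2)) * X := by ring
        _ ≤ _ := by gcongr
  calc _ ≤ c₀ * _ := mul_le_mul_of_nonneg_left hfin hc₀'.le
    _ = _ := by ring

/-! ### The collision frequency -/

lemma rpow_neg_three_halves_pos : (0 : ℝ) < (2 : ℝ) ^ (-(3 / 2) : ℝ) := by positivity

lemma rpow_neg_three_halves_le : (2 : ℝ) ^ (-(3 / 2) : ℝ) ≤ 1 :=
  Real.rpow_le_one_of_one_le_of_nonpos (by norm_num) (by norm_num)

/-- The two powers of `2` that occur in the collision frequency. -/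
lemma rpow_neg_half_eq : (2 : ℝ) ^ (-(1 / 2) : ℝ) = 2 * (2 : ℝ) ^ (-(3 / 2) : ℝ) := by
  rw [show (-(1 / 2) : ℝ) = 1 + -(3 / 2) by norm_num, Real.rpow_add (by norm_num), Real.rpow_one]

/-- The radial profile of the collision frequency. -/
def nuProfile (ρ : ℝ) : ℝ := (2 : ℝ) ^ (-(3 / 2) : ℝ) *
  (Real.exp (-ρ ^ 2) + (2 * ρ + 1 / ρ) * ∫ η in (0 : ℝ)..ρ, Real.exp (-η ^ 2))

lemma hardSphereNu_of_ne {v : E3} (hv : v ≠ 0) : hardSphereNu v = nuProfile ‖v‖ := by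
  rw [hardSphereNu, if_neg hv, nuProfile]

lemma continuous_exp_neg_sq : Continuous fun η : ℝ => Real.exp (-η ^ 2) := by fun_prop

lemma mul_exp_le_integral_exp_neg_sq {ρ : ℝ} (hρ : 0 ≤ ρ) :
    ρ * Real.exp (-ρ ^ 2) ≤ ∫ η in (0 : ℝ)..ρ, Real.exp (-η ^ 2) := by
  have h := intervalIntegral.integral_mono_on (μ := volume) hρ
    (f := fun _ => Real.exp (-ρ ^ 2)) (g := fun η => Real.exp (-η ^ 2))
    (continuous_const.intervalIntegrable _ _) (continuous_exp_neg_sq.intervalIntegrable _ _)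
    (fun x hx => Real.exp_le_exp.2 (by nlinarith [hx.1, hx.2]))
  simpa using h

lemma integral_exp_neg_sq_le {ρ : ℝ} (hρ : 0 ≤ ρ) :
    ∫ η in (0 : ℝ)..ρ, Real.exp (-η ^ 2) ≤ ρ := by
  have h := intervalIntegral.integral_mono_on (μ := volume) hρ
    (f := fun η => Real.exp (-η ^ 2)) (g := fun _ => (1 : ℝ))
    (continuous_exp_neg_sq.intervalIntegrable _ _) (continuous_const.intervalIntegrable _ _)
    (fun x hx => Real.exp_le_one_iff.2 (by nlinarith))
  simpa using h

lemma integral_exp_neg_sq_nonneg {ρ : ℝ} (hρ : 0 ≤ ρ) :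
    0 ≤ ∫ η in (0 : ℝ)..ρ, Real.exp (-η ^ 2) :=
  intervalIntegral.integral_nonneg hρ fun _ _ => (Real.exp_pos _).le

/-- A lower bound that is sharp at `v = 0`. -/
lemma hardSphereNu_ge (v : E3) :
    (2 : ℝ) ^ (-(1 / 2) : ℝ) * Real.exp (-‖v‖ ^ 2) ≤ hardSphereNu v := by
  by_cases hv : v = 0
  · simp [hv, hardSphereNu]
  have hρ := norm_pos_iff.2 hv
  rw [hardSphereNu_of_ne hv, nuProfile, rpow_neg_half_eq]
  have h1 := mul_exp_le_integral_exp_neg_sq hρ.le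
  have h2 : Real.exp (-‖v‖ ^ 2) ≤ (2 * ‖v‖ + 1 / ‖v‖) * ∫ η in (0 : ℝ)..‖v‖, Real.exp (-η ^ 2) := by
    calc Real.exp (-‖v‖ ^ 2) = 1 / ‖v‖ * (‖v‖ * Real.exp (-‖v‖ ^ 2)) := by field_simp
      _ ≤ (2 * ‖v‖ + 1 / ‖v‖) * _ := by gcongr; linarith
  have := rpow_neg_three_halves_pos
  nlinarith

/-- A positive lower bound of the collision frequency. -/
def nuMin : ℝ := (2 : ℝ) ^ (-(3 / 2) : ℝ) * Real.exp (-1)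

lemma nuMin_pos : 0 < nuMin := mul_pos rpow_neg_three_halves_pos (Real.exp_pos _)

/-- For `|v| ≤ 1` the first summand of the frequency gives the bound, for `|v| ≥ 1` the second. -/
lemma nuMin_le (v : E3) : nuMin ≤ hardSphereNu v := by
  rcases le_total ‖v‖ 1 with h | h
  · refine le_trans ?_ (hardSphereNu_ge v)
    rw [rpow_neg_half_eq, nuMin]
    have := rpow_neg_three_halves_pos
    have h2 : Real.exp (-1) ≤ Real.exp (-‖v‖ ^ 2) :=
      Real.exp_le_exp.2 (by nlinarith [norm_nonneg v])
    nlinarith [Real.exp_pos (-1 : ℝ), mul_pos this (Real.exp_pos (-1 : ℝ)),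
      mul_le_mul_of_nonneg_left h2 this.le]
  · have hv : v ≠ 0 := norm_pos_iff.1 (by linarith)
    rw [hardSphereNu_of_ne hv, nuProfile, nuMin]
    gcongr
    have h1 : Real.exp (-1) ≤ ∫ η in (0 : ℝ)..1, Real.exp (-η ^ 2) := by
      simpa using mul_exp_le_integral_exp_neg_sq zero_le_one
    have h3 := intervalIntegral.integral_add_adjacent_intervals
      (continuous_exp_neg_sq.intervalIntegrable (μ := volume) 0 1)
      (continuous_exp_neg_sq.intervalIntegrable (μ := volume) 1 ‖v‖)
    have h4 : 0 ≤ ∫ η in (1 : ℝ)..‖v‖, Real.exp (-η ^ 2) :=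
      intervalIntegral.integral_nonneg h fun _ _ => (Real.exp_pos _).le
    have h5 : Real.exp (-1) ≤ ∫ η in (0 : ℝ)..‖v‖, Real.exp (-η ^ 2) := by linarith
    have h6 : 0 ≤ 1 / ‖v‖ := by positivity
    have h7 := Real.exp_pos (-1 : ℝ)
    have h8 := Real.exp_pos (-‖v‖ ^ 2)
    nlinarith

lemma hardSphereNu_pos (v : E3) : 0 < hardSphereNu v := nuMin_pos.trans_le (nuMin_le v)

lemma hardSphereNu_le (v : E3) : hardSphereNu v ≤ 2 * (1 + ‖v‖ ^ 2) := by
  by_cases hv : v = 0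
  · have : (2 : ℝ) ^ (-(1 / 2) : ℝ) ≤ 1 :=
      Real.rpow_le_one_of_one_le_of_nonpos (by norm_num) (by norm_num)
    simp only [hv, hardSphereNu, if_true, norm_zero]; linarith
  have hρ := norm_pos_iff.2 hv
  rw [hardSphereNu_of_ne hv, nuProfile]
  have h1 := integral_exp_neg_sq_le hρ.le
  have h2 : (2 * ‖v‖ + 1 / ‖v‖) * ∫ η in (0 : ℝ)..‖v‖, Real.exp (-η ^ 2) ≤
      2 * ‖v‖ ^ 2 + 1 := by
    calc _ ≤ (2 * ‖v‖ + 1 / ‖v‖) * ‖v‖ := by gcongr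
      _ = _ := by field_simp
  have h3 : Real.exp (-‖v‖ ^ 2) ≤ 1 := Real.exp_le_one_iff.2 (by nlinarith)
  calc _ ≤ 1 * (1 + (2 * ‖v‖ ^ 2 + 1)) := by
        have := integral_exp_neg_sq_nonneg hρ.le
        gcongr
        exact rpow_neg_three_halves_le
    _ = _ := by ring

lemma hasDerivAt_nuProfile {ρ : ℝ} (hρ : 0 < ρ) : HasDerivAt nuProfile
    ((2 : ℝ) ^ (-(3 / 2) : ℝ) * (1 / ρ * Real.exp (-ρ ^ 2) +
      (2 - 1 / ρ ^ 2) * ∫ η in (0 : ℝ)..ρ, Real.exp (-η ^ 2))) ρ := by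
  have h1 : HasDerivAt (fun ρ : ℝ => Real.exp (-ρ ^ 2)) (Real.exp (-ρ ^ 2) * (-(2 * ρ))) ρ := by
    simpa using ((hasDerivAt_id ρ).pow 2).neg.exp
  have h2 : HasDerivAt (fun ρ : ℝ => 2 * ρ + 1 / ρ) (2 - 1 / ρ ^ 2) ρ := by
    have := ((hasDerivAt_id ρ).const_mul 2).add ((hasDerivAt_inv hρ.ne'))
    exact (this.congr_deriv (by ring)).congr_of_eventuallyEq (.of_forall fun y => by simp)
  have h3 : HasDerivAt (fun ρ : ℝ => ∫ η in (0 : ℝ)..ρ, Real.exp (-η ^ 2)) (Real.exp (-ρ ^ 2)) ρ :=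
    intervalIntegral.integral_hasDerivAt_right (continuous_exp_neg_sq.intervalIntegrable _ _)
      (continuous_exp_neg_sq.stronglyMeasurableAtFilter _ _) continuous_exp_neg_sq.continuousAt
  have := (h1.add (h2.mul h3)).const_mul ((2 : ℝ) ^ (-(3 / 2) : ℝ))
  exact this.congr_deriv (by field_simp; ring)

lemma contDiffOn_nuProfile : ContDiffOn ℝ 1 nuProfile (Ioi 0) := by
  have h3 : ContDiff ℝ 1 (fun ρ : ℝ => ∫ η in (0 : ℝ)..ρ, Real.exp (-η ^ 2)) := by
    have hd : ∀ ρ : ℝ, HasDerivAt (fun ρ : ℝ => ∫ η in (0 : ℝ)..ρ, Real.exp (-η ^ 2))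
        (Real.exp (-ρ ^ 2)) ρ := fun ρ =>
      intervalIntegral.integral_hasDerivAt_right (continuous_exp_neg_sq.intervalIntegrable _ _)
        (continuous_exp_neg_sq.stronglyMeasurableAtFilter _ _) continuous_exp_neg_sq.continuousAt
    rw [contDiff_one_iff_deriv]
    refine ⟨fun ρ => (hd ρ).differentiableAt, ?_⟩
    rw [show deriv (fun ρ : ℝ => ∫ η in (0 : ℝ)..ρ, Real.exp (-η ^ 2)) =
      fun ρ => Real.exp (-ρ ^ 2) from funext fun ρ => (hd ρ).deriv]
    exact continuous_exp_neg_sq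
  unfold nuProfile
  refine contDiffOn_const.mul (ContDiffOn.add (by fun_prop) (ContDiffOn.mul ?_ h3.contDiffOn))
  refine ContDiffOn.add (by fun_prop) ?_
  exact contDiffOn_const.div contDiffOn_id fun x hx => ne_of_gt hx

lemma contDiffAt_hardSphereNu {v : E3} (hv : v ≠ 0) : ContDiffAt ℝ 1 hardSphereNu v := by
  have h1 : ContDiffAt ℝ 1 nuProfile ‖v‖ :=
    contDiffOn_nuProfile.contDiffAt (Ioi_mem_nhds (norm_pos_iff.2 hv))
  have h2 : ContDiffAt ℝ 1 (fun v : E3 => nuProfile ‖v‖) v :=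
    h1.comp v (contDiffAt_norm ℝ hv)
  refine h2.congr_of_eventuallyEq ?_
  filter_upwards [isOpen_compl_singleton.mem_nhds hv] with w hw using hardSphereNu_of_ne hw

/-- The frequency is not claimed to be differentiable at `v = 0`; the bound with `|v|⁻¹` suffices. -/
lemma norm_fderiv_hardSphereNu_le {v : E3} (hv : v ≠ 0) :
    ‖fderiv ℝ hardSphereNu v‖ ≤ 2 * (‖v‖ + ‖v‖⁻¹) := by
  have hρ := norm_pos_iff.2 hv
  have hn : DifferentiableAt ℝ (fun v : E3 => ‖v‖) v := (contDiffAt_norm ℝ hv).differentiableAt (n := 1) (by simp)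
  have h1 := (hasDerivAt_nuProfile hρ).comp_hasFDerivAt v hn.hasFDerivAt
  have h2 : HasFDerivAt hardSphereNu _ v := h1.congr_of_eventuallyEq (by
    filter_upwards [isOpen_compl_singleton.mem_nhds hv] with w hw using hardSphereNu_of_ne hw)
  rw [h2.fderiv, norm_smul]
  have h3 : ‖fderiv ℝ (fun v : E3 => ‖v‖) v‖ ≤ 1 := by
    simpa using norm_fderiv_le_of_lipschitz ℝ (x₀ := v) (lipschitzWith_one_norm (E := E3))
  have h4 := integral_exp_neg_sq_le hρ.le
  have h5 := integral_exp_neg_sq_nonneg hρ.le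
  set I := ∫ η in (0 : ℝ)..‖v‖, Real.exp (-η ^ 2)
  have h6 : Real.exp (-‖v‖ ^ 2) ≤ 1 := Real.exp_le_one_iff.2 (by nlinarith)
  have h7 : |1 / ‖v‖ * Real.exp (-‖v‖ ^ 2) + (2 - 1 / ‖v‖ ^ 2) * I| ≤ 2 * (‖v‖ + ‖v‖⁻¹) := by
    have e1 : 1 / ‖v‖ * Real.exp (-‖v‖ ^ 2) ≤ ‖v‖⁻¹ := by
      rw [one_div]; exact mul_le_of_le_one_right (by positivity) h6
    have e2 : 1 / ‖v‖ ^ 2 * I ≤ ‖v‖⁻¹ := by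
      calc _ ≤ 1 / ‖v‖ ^ 2 * ‖v‖ := by gcongr
        _ = _ := by field_simp
    have e3 : 0 ≤ 1 / ‖v‖ * Real.exp (-‖v‖ ^ 2) := by positivity
    have e4 : 0 ≤ 1 / ‖v‖ ^ 2 * I := by positivity
    rw [sub_mul, abs_le]; constructor <;> linarith
  rw [Real.norm_eq_abs, abs_mul, abs_of_pos rpow_neg_three_halves_pos]
  calc _ ≤ 1 * (2 * (‖v‖ + ‖v‖⁻¹)) * 1 := by
        gcongr
        exact rpow_neg_three_halves_le
    _ = _ := by ring

/-! ### Weighted classes of classical functions on phase space -/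

/-- The Gaussian weight `e^{-β|v|²}`. -/
def gaussWeight (β : ℝ) (v : E3) : ℝ := Real.exp (-β * ‖v‖ ^ 2)

lemma gaussWeight_pos (β : ℝ) (v : E3) : 0 < gaussWeight β v := Real.exp_pos _

lemma gaussWeight_le_one {β : ℝ} (hβ : 0 ≤ β) (v : E3) : gaussWeight β v ≤ 1 :=
  Real.exp_le_one_iff.2 (by nlinarith [sq_nonneg ‖v‖])

lemma exp_mul_gaussWeight (β : ℝ) (v w : E3) :
    Real.exp (β * (‖w‖ ^ 2 - ‖v‖ ^ 2)) * gaussWeight β w = gaussWeight β v := by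
  rw [gaussWeight, gaussWeight, ← Real.exp_add]; congr 1; ring

/-- Phase space over the ball of radius `r`. -/
def phaseSpace (r : ℝ) : Set (E3 × E3) := Metric.ball (0 : E3) r ×ˢ univ

lemma mem_phaseSpace {r : ℝ} {z : E3 × E3} : z ∈ phaseSpace r ↔ ‖z.1‖ < r := by
  simp [phaseSpace]

lemma isOpen_phaseSpace (r : ℝ) : IsOpen (phaseSpace r) := Metric.isOpen_ball.prod isOpen_univ

/-- The class of functions to which `K` is applied. They are `C¹` except at `v = 0`; the
`x`-gradient may have singularities of order `1` at `v = 0` and of order `1 / 2` at the boundary of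
the ball. -/
structure TransportBound (r β a a' b : ℝ) (f : E3 × E3 → ℝ) : Prop where
  contDiffOn : ContDiffOn ℝ 1 f (movingPhase r)
  bound_inv : ∀ z ∈ movingPhase r, |f z| ≤ a * ‖z.2‖⁻¹ * gaussWeight β z.2
  bound : ∀ z ∈ movingPhase r, |f z| ≤ a' * gaussWeight β z.2
  bound_fst : ∀ z ∈ movingPhase r, ∀ ξ, |fderiv ℝ f z (ξ, 0)| ≤
    b * ‖z.2‖⁻¹ * boundaryWeight r z.1 * gaussWeight β z.2 * ‖ξ‖

/-- The class of functions in the range of `K`. They are `C¹` on all of phase space; the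
`x`-gradient may have a singularity of order `1 / 2` at the boundary of the ball. -/
structure GainBound (r β a b c : ℝ) (h : E3 × E3 → ℝ) : Prop where
  contDiffOn : ContDiffOn ℝ 1 h (phaseSpace r)
  bound : ∀ z ∈ phaseSpace r, |h z| ≤ a * gaussWeight β z.2
  bound_fst : ∀ z ∈ phaseSpace r, ∀ ξ, |fderiv ℝ h z (ξ, 0)| ≤
    b * boundaryWeight r z.1 * gaussWeight β z.2 * ‖ξ‖
  bound_snd : ∀ z ∈ phaseSpace r, ∀ η, |fderiv ℝ h z (0, η)| ≤
    c * (1 + ‖z.2‖) * gaussWeight β z.2 * ‖η‖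

/-! ### The operator `K` -/

/-- The two singular points of the integrands of `K` form a null set. -/
lemma ae_restrict_off (v : E3) : (volume : Measure E3).restrict {w | w ≠ 0 ∧ w ≠ v} = volume := by
  refine Measure.restrict_eq_self_of_ae_mem ?_
  filter_upwards [ae_ne_point 0, ae_ne_point v] with w h0 h1 using ⟨h0, h1⟩

lemma isOpen_off (v : E3) : IsOpen {w : E3 | w ≠ 0 ∧ w ≠ v} :=
  isOpen_compl_singleton.inter isOpen_compl_singleton

lemma aestronglyMeasurable_of_continuousAt_off {F : Type*} [NormedAddCommGroup F] {v : E3}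
    {g : E3 → F} [SecondCountableTopologyEither E3 F] (h : ∀ w, w ≠ 0 → w ≠ v → ContinuousAt g w) :
    AEStronglyMeasurable g := by
  rw [← ae_restrict_off v]
  exact ContinuousOn.aestronglyMeasurable (fun w hw => (h w hw.1 hw.2).continuousWithinAt)
    (isOpen_off v).measurableSet

/-- A function with a continuous gradient candidate that satisfies the fundamental theorem of
calculus along segments is differentiable. -/
lemma hasFDerivAt_of_segment_integral {h : E3 → ℝ} {H : E3 → E3 →L[ℝ] ℝ} (hc : Continuous H)
    (hh : ∀ v e, h (v + e) - h v = ∫ s in (0 : ℝ)..1, H (v + s • e) e) (v : E3) :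
    HasFDerivAt h (H v) v := by
  rw [hasFDerivAt_iff_isLittleO_nhds_zero, Asymptotics.isLittleO_iff]
  intro ε hε
  obtain ⟨δ, hδ, hball⟩ := Metric.continuousAt_iff.1 (hc.continuousAt (x := v)) ε hε
  filter_upwards [Metric.ball_mem_nhds (0 : E3) hδ] with e he
  rw [mem_ball_zero_iff] at he
  have hcont : Continuous fun s : ℝ => H (v + s • e) e := by fun_prop
  have e1 : h (v + e) - h v - H v e = ∫ s in (0 : ℝ)..1, (H (v + s • e) e - H v e) := by
    rw [hh, intervalIntegral.integral_sub (hcont.intervalIntegrable _ _)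
      (continuous_const.intervalIntegrable _ _)]
    simp
  rw [e1]
  have := intervalIntegral.norm_integral_le_of_norm_le_const (a := (0 : ℝ)) (b := 1)
    (C := ε * ‖e‖) (f := fun s => H (v + s • e) e - H v e) (fun s hs => ?_)
  · simpa using this
  · rw [uIoc_of_le zero_le_one] at hs
    rw [← sub_apply]
    refine (ContinuousLinearMap.le_opNorm _ _).trans ?_
    gcongr
    rw [← dist_eq_norm]
    refine (hball ?_).le
    rw [dist_eq_norm, add_sub_cancel_left, norm_smul, Real.norm_of_nonneg hs.1.le]
    calc s * ‖e‖ ≤ 1 * ‖e‖ := by gcongr; exact hs.2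
      _ < δ := by simpa using he

/-- The points of a line form a null set. -/
lemma ae_notMem_line (v e : E3) : ∀ᵐ w : E3, ∀ s : ℝ, w ≠ v + s • e := by
  have h : volume ((AffineSubspace.mk' v (Submodule.span ℝ {e}) : AffineSubspace ℝ E3) : Set E3) = 0 := by
    refine Measure.addHaar_affineSubspace _ _ fun htop => ?_
    have h1 : (Submodule.span ℝ {e} : Submodule ℝ E3) = ⊤ := by
      have := congrArg AffineSubspace.direction htop
      simpa using this
    have h2 := finrank_span_le_card (R := ℝ) ({e} : Set E3)
    rw [h1, finrank_top] at h2
    simp at h2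
  rw [ae_iff]
  refine measure_mono_null (fun w hw => ?_) h
  simp only [ne_eq, not_forall, not_not, mem_ofPred_eq] at hw
  obtain ⟨s, rfl⟩ := hw
  simp only [SetLike.mem_coe, AffineSubspace.mem_mk', vsub_eq_sub, add_sub_cancel_left]
  exact Submodule.smul_mem _ _ (Submodule.mem_span_singleton_self e)

/-- The Gaussian weight passes through the kernel. A singularity of order `1` of the function at
`w = 0` is allowed for the kernel itself, but not for its derivative. -/
lemma exists_kernel_majorant {β : ℝ} (hβ0 : 0 ≤ β) (hβ1 : β < 1 / 2) : ∃ C : ℝ, 0 < C ∧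
    (∀ v w, w ≠ 0 → w ≠ v → ∀ m y, 0 ≤ m → y ≤ m * ‖w‖⁻¹ * gaussWeight β w →
      |hardSphereK v w| * y ≤ C * m * gaussWeight β v * singularMajorant (kernelRate β) v w) ∧
    (∀ v w, w ≠ 0 → w ≠ v → ∀ m y, 0 ≤ m → y ≤ m * gaussWeight β w →
      y * ‖kernelDeriv v w‖ ≤
        C * m * (1 + ‖v‖) * gaussWeight β v * singularMajorant (kernelRate β) v w) := by
  obtain ⟨C₁, hC₁, hk₁⟩ := exists_hardSphereK_bound hβ0 hβ1
  obtain ⟨C₂, hC₂, hk₂⟩ := exists_kernelDeriv_bound hβ0 hβ1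
  refine ⟨max C₁ C₂, lt_max_of_lt_left hC₁, fun v w h0 h1 m y hm hy => ?_,
    fun v w h0 h1 m y hm hy => ?_⟩
  · have n0 : 0 < ‖w‖ := norm_pos_iff.2 h0
    have n1 : 0 < ‖w - v‖ := norm_pos_iff.2 (sub_ne_zero.2 h1)
    have hgv := gaussWeight_pos β v
    have hgw := gaussWeight_pos β w
    calc |hardSphereK v w| * y ≤ (C₁ * ‖w - v‖⁻¹ * Real.exp (-kernelRate β * ‖w - v‖ ^ 2) *
          Real.exp (β * (‖w‖ ^ 2 - ‖v‖ ^ 2))) * (m * ‖w‖⁻¹ * gaussWeight β w) :=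
          (mul_le_mul_of_nonneg_left hy (abs_nonneg _)).trans
            (mul_le_mul_of_nonneg_right (hk₁ v w h1) (by positivity))
      _ = C₁ * m * gaussWeight β v * ((‖w - v‖⁻¹ * ‖w‖⁻¹) *
          Real.exp (-kernelRate β * ‖w - v‖ ^ 2)) := by rw [← exp_mul_gaussWeight β v w]; ring
      _ ≤ _ := by
          unfold singularMajorant
          have e1 : ‖w - v‖⁻¹ * ‖w‖⁻¹ ≤ (‖w - v‖ ^ 2)⁻¹ + (‖w‖ ^ 2)⁻¹ := by
            rw [← inv_pow, ← inv_pow]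
            nlinarith [sq_nonneg (‖w - v‖⁻¹ - ‖w‖⁻¹), sq_nonneg (‖w - v‖⁻¹), sq_nonneg (‖w‖⁻¹)]
          gcongr
          exact le_max_left _ _
  · have hgv := gaussWeight_pos β v
    have hgw := gaussWeight_pos β w
    calc y * ‖kernelDeriv v w‖ ≤ (m * gaussWeight β w) * (C₂ * (1 + ‖v‖) * (‖w - v‖ ^ 2)⁻¹ *
          Real.exp (-kernelRate β * ‖w - v‖ ^ 2) * Real.exp (β * (‖w‖ ^ 2 - ‖v‖ ^ 2))) :=
          (mul_le_mul_of_nonneg_right hy (norm_nonneg _)).trans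
            (mul_le_mul_of_nonneg_left (hk₂ v w h1) (by positivity))
      _ = C₂ * m * (1 + ‖v‖) * gaussWeight β v * ((‖w - v‖ ^ 2)⁻¹ *
          Real.exp (-kernelRate β * ‖w - v‖ ^ 2)) := by
          rw [← exp_mul_gaussWeight β v w]; ring
      _ ≤ _ := by
          unfold singularMajorant
          gcongr
          · exact le_max_right _ _
          · simp only [le_add_iff_nonneg_right]; positivity

/-- The integral of a bounded function against the kernel is differentiable in `v`, in spite of the
singularity of the kernel. The fundamental theorem of calculus holds along the segment from `v` to
`v + e` for every `w` off that segment. -/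
lemma hasFDerivAt_integral_kernel {g : E3 → ℝ} {β a' : ℝ} (hβ0 : 0 ≤ β) (hβ1 : β < 1 / 2)
    (hg : ∀ w, w ≠ 0 → ContinuousAt g w) (hb : ∀ w, w ≠ 0 → |g w| ≤ a' * gaussWeight β w)
    (hint : ∀ v, Integrable fun w => hardSphereK v w * g w) (v : E3) :
    HasFDerivAt (fun v => ∫ w, hardSphereK v w * g w) (∫ w, g w • kernelDeriv v w) v := by
  obtain ⟨C, hC, -, hk⟩ := exists_kernel_majorant hβ0 hβ1
  have hκ := kernelRate_pos hβ1
  obtain ⟨C', hC', hs⟩ := exists_singularMajorant_bound hκ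
  have ha' : 0 ≤ a' := by
    obtain ⟨w, hw⟩ := exists_ne (0 : E3)
    have := (abs_nonneg _).trans (hb w hw)
    exact nonneg_of_mul_nonneg_left this (gaussWeight_pos β w)
  have hbd : ∀ v w, w ≠ 0 → w ≠ v → ‖g w • kernelDeriv v w‖ ≤
      a' * C * (1 + ‖v‖) * singularMajorant (kernelRate β) v w := by
    intro v w h0 h1
    rw [norm_smul, Real.norm_eq_abs]
    refine (hk v w h0 h1 a' _ ha' (hb w h0)).trans ?_
    have h2 := gaussWeight_le_one hβ0 v
    have h3 := singularMajorant_nonneg (kernelRate β) v w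
    calc _ ≤ C * a' * (1 + ‖v‖) * 1 * singularMajorant (kernelRate β) v w := by gcongr
      _ = _ := by ring
  have hmeas : ∀ v, AEStronglyMeasurable (fun w => g w • kernelDeriv v w) := fun v => by
    refine aestronglyMeasurable_of_continuousAt_off (v := v) fun w h0 h1 => (hg w h0).smul ?_
    exact ContinuousAt.comp (g := fun z : E3 × E3 => kernelDeriv z.1 z.2) (f := fun w => (v, w))
      (continuousAt_kernelDeriv h1) (continuousAt_const.prodMk continuousAt_id)
  have hintd : ∀ v, Integrable (fun w => g w • kernelDeriv v w) := fun v => by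
    refine ((hs v).1.const_mul (a' * C * (1 + ‖v‖))).mono' (hmeas v) ?_
    filter_upwards [ae_ne_point 0, ae_ne_point v] with w h0 h1 using hbd v w h0 h1
  have hcont : Continuous fun v => ∫ w, g w • kernelDeriv v w := by
    rw [continuous_iff_continuousAt]
    intro v₀
    refine continuousAt_integral_of_singular (vel := fun v => v) continuousAt_id hκ
      (C := a' * C * (1 + (‖v₀‖ + 1))) (Eventually.of_forall hmeas) ?_ ?_
    · have : ∀ᶠ v in 𝓝 v₀, ‖v‖ < ‖v₀‖ + 1 :=
        continuousAt_id.norm.eventually_lt_const (by simp)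
      filter_upwards [this] with v hv w h0 h1
      refine (hbd v w h0 h1).trans ?_
      have := singularMajorant_nonneg (kernelRate β) v w
      gcongr
    · intro w h0 h1
      have c1 : ContinuousAt (fun z : E3 × E3 => g z.2) (v₀, w) :=
        ContinuousAt.comp (g := g) (f := fun z : E3 × E3 => z.2) (hg w h0) continuousAt_snd
      exact c1.smul (continuousAt_kernelDeriv h1)
  refine hasFDerivAt_of_segment_integral hcont (fun v e => ?_) v
  -- By the fundamental theorem of calculus for almost every `w`, the claim is an exchange of the
  -- integrals over `[0, 1]` and `ℝ³`.
  set μ := (volume : Measure ℝ).restrict (Ioc 0 1)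
  set Φ : ℝ → E3 → ℝ := fun s w => g w * kernelDeriv (v + s • e) w e with hΦ
  have hopen : IsOpen {y : ℝ × E3 | y.2 ≠ 0 ∧ y.2 ≠ v + y.1 • e} :=
    (isOpen_ne_fun continuous_snd continuous_const).inter
      (isOpen_ne_fun continuous_snd (by fun_prop))
  have hΦm : AEStronglyMeasurable (Function.uncurry Φ) (μ.prod volume) := by
    have hfull : (μ.prod volume).restrict {y : ℝ × E3 | y.2 ≠ 0 ∧ y.2 ≠ v + y.1 • e} =
        μ.prod volume := by
      refine Measure.restrict_eq_self_of_ae_mem ?_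
      refine (Measure.ae_prod_iff_ae_ae hopen.measurableSet).2 (Eventually.of_forall fun s => ?_)
      filter_upwards [ae_ne_point 0, ae_ne_point (v + s • e)] with w h0 h1 using ⟨h0, h1⟩
    rw [← hfull]
    refine ContinuousOn.aestronglyMeasurable (fun y hy => ?_) hopen.measurableSet
    refine ContinuousAt.continuousWithinAt ?_
    have c1 : ContinuousAt (fun y : ℝ × E3 => kernelDeriv (v + y.1 • e) y.2) y :=
      ContinuousAt.comp (g := fun z : E3 × E3 => kernelDeriv z.1 z.2)
        (f := fun y : ℝ × E3 => (v + y.1 • e, y.2)) (continuousAt_kernelDeriv hy.2)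
        (by fun_prop)
    have c2 : ContinuousAt (fun y : ℝ × E3 => g y.2) y :=
      ContinuousAt.comp (g := g) (f := fun z : ℝ × E3 => z.2) (hg _ hy.1) continuousAt_snd
    exact c2.mul (c1.clm_apply continuousAt_const)
  have hΦle : ∀ s ∈ Ioc (0 : ℝ) 1, ∀ w, w ≠ 0 → w ≠ v + s • e → ‖Φ s w‖ ≤
      (a' * C * (1 + (‖v‖ + ‖e‖)) * ‖e‖) * singularMajorant (kernelRate β) (v + s • e) w := by
    intro s hs' w h0 h1
    have e1 : Φ s w = (g w • kernelDeriv (v + s • e) w) e := by simp [hΦ]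
    rw [e1]
    refine (ContinuousLinearMap.le_opNorm _ _).trans ?_
    have h2 := hbd (v + s • e) w h0 h1
    have h3 : ‖v + s • e‖ ≤ ‖v‖ + ‖e‖ := by
      refine (norm_add_le _ _).trans ?_
      rw [norm_smul, Real.norm_of_nonneg hs'.1.le]
      gcongr
      exact mul_le_of_le_one_left (norm_nonneg _) hs'.2
    have := singularMajorant_nonneg (kernelRate β) (v + s • e) w
    calc _ ≤ (a' * C * (1 + ‖v + s • e‖) * singularMajorant (kernelRate β) (v + s • e) w) * ‖e‖ := by
          gcongr
      _ ≤ (a' * C * (1 + (‖v‖ + ‖e‖)) * singularMajorant (kernelRate β) (v + s • e) w) * ‖e‖ := by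
          gcongr
      _ = _ := by ring
  have hΦs : ∀ s, Integrable (Φ s) := fun s =>
    ((hintd (v + s • e)).apply_continuousLinearMap e).congr
      (Eventually.of_forall fun w => by simp [hΦ])
  have hΦi : Integrable (Function.uncurry Φ) (μ.prod volume) := by
    rw [integrable_prod_iff hΦm]
    refine ⟨Eventually.of_forall fun s => hΦs s, ?_⟩
    refine Integrable.mono' (g := fun _ => (a' * C * (1 + (‖v‖ + ‖e‖)) * ‖e‖) * C')
      (integrable_const _) hΦm.norm.integral_prod_right' ?_
    filter_upwards [ae_restrict_mem measurableSet_Ioc] with s hs'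
    rw [Real.norm_of_nonneg (integral_nonneg fun _ => norm_nonneg _)]
    calc _ ≤ ∫ w, (a' * C * (1 + (‖v‖ + ‖e‖)) * ‖e‖) * singularMajorant (kernelRate β) (v + s • e) w := by
          refine integral_mono_ae (hΦs s).norm ((hs _).1.const_mul _) ?_
          filter_upwards [ae_ne_point 0, ae_ne_point (v + s • e)] with w h0 h1 using
            hΦle s hs' w h0 h1
      _ ≤ _ := by
          rw [integral_const_mul]
          gcongr
          exact (hs _).2
  rw [← integral_sub (hint (v + e)) (hint v), intervalIntegral.integral_of_le zero_le_one]
  have hright : ∀ s : ℝ, (∫ w, g w • kernelDeriv (v + s • e) w) e = ∫ w, Φ s w := fun s => by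
    rw [ContinuousLinearMap.integral_apply (hintd _)]
    rfl
  simp_rw [hright]
  rw [integral_integral_swap hΦi]
  refine integral_congr_ae ?_
  filter_upwards [ae_notMem_line v e] with w hw
  have hw0 : ∀ s : ℝ, HasDerivAt (fun s : ℝ => hardSphereK (v + s • e) w)
      (kernelDeriv (v + s • e) w e) s := fun s => by
    have hline : HasDerivAt (fun s : ℝ => v + s • e) e s := by
      simpa using ((hasDerivAt_id s).smul_const e).const_add v
    exact (hasFDerivAt_hardSphereK (hw s)).comp_hasDerivAt s hline
  have hcd : Continuous fun s : ℝ => kernelDeriv (v + s • e) w e := by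
    rw [continuous_iff_continuousAt]
    intro s
    refine ContinuousAt.clm_apply ?_ continuousAt_const
    exact ContinuousAt.comp (g := fun z : E3 × E3 => kernelDeriv z.1 z.2)
      (f := fun s : ℝ => (v + s • e, w)) (continuousAt_kernelDeriv (hw s)) (by fun_prop)
  have hftc := intervalIntegral.integral_eq_sub_of_hasDerivAt (a := 0) (b := 1)
    (fun s _ => hw0 s) (hcd.intervalIntegrable _ _)
  simp only [one_smul, zero_smul, add_zero] at hftc
  simp only [hΦ, μ]
  rw [integral_const_mul, ← intervalIntegral.integral_of_le zero_le_one, hftc]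
  ring

lemma continuousAt_boundaryWeight {r : ℝ} {x : E3} (hx : ‖x‖ < r) :
    ContinuousAt (boundaryWeight r) x := by
  unfold boundaryWeight
  exact ContinuousAt.inv₀ (by fun_prop) (Real.sqrt_pos.2 (sq_sub_sq_pos hx)).ne'

lemma eventually_boundaryWeight_lt {r : ℝ} {x : E3} (hx : ‖x‖ < r) :
    ∀ᶠ y in 𝓝 x, ‖y‖ < r ∧ boundaryWeight r y < boundaryWeight r x + 1 :=
  (continuousAt_id.norm.eventually_lt_const hx).and
    ((continuousAt_boundaryWeight hx).eventually_lt_const (by simp))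

/-- `K` maps functions with weak singularities to `C¹` functions. In the `x`-direction the
derivative falls on `f`, in the `v`-direction on the kernel. -/
theorem exists_opK_gainBound {β : ℝ} (hβ0 : 0 ≤ β) (hβ1 : β < 1 / 2) : ∃ C : ℝ, 0 < C ∧
    ∀ (r : ℝ) (f : E3 × E3 → ℝ) (a a' b : ℝ), 0 ≤ a → 0 ≤ a' → 0 ≤ b →
      TransportBound r β a a' b f →
      GainBound r β (C * a) (C * b) (C * a') (opK hardSphereK f) ∧
        ∀ z ∈ phaseSpace r, Integrable fun w => hardSphereK z.2 w * f (z.1, w) := by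
  obtain ⟨C₀, hC₀, hk₁, hk₂⟩ := exists_kernel_majorant hβ0 hβ1
  have hκ := kernelRate_pos hβ1
  obtain ⟨C₁, hC₁, hs⟩ := exists_singularMajorant_bound hκ
  refine ⟨C₀ * C₁, by positivity, fun r f a a' b ha ha' hb hf => ?_⟩
  have hmem : ∀ {x w : E3}, ‖x‖ < r → w ≠ 0 → (x, w) ∈ movingPhase r := fun hx hw =>
    mem_movingPhase.2 ⟨hx, hw⟩
  have hfc : ∀ z ∈ movingPhase r, ContDiffAt ℝ 1 f z := fun z hz =>
    hf.contDiffOn.contDiffAt ((isOpen_movingPhase r).mem_nhds hz)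
  have hfd : ∀ z ∈ movingPhase r, HasFDerivAt f (fderiv ℝ f z) z := fun z hz =>
    ((hfc z hz).differentiableAt (by simp)).hasFDerivAt
  set D : E3 × E3 → E3 →L[ℝ] ℝ := fun z => (fderiv ℝ f z).comp (ContinuousLinearMap.inl ℝ E3 E3)
    with hD
  have hDc : ∀ z ∈ movingPhase r, ContinuousAt D z := fun z hz =>
    ((hfc z hz).continuousAt_fderiv (by simp)).clm_comp continuousAt_const
  have hDb : ∀ z ∈ movingPhase r, ‖D z‖ ≤
      (b * boundaryWeight r z.1) * ‖z.2‖⁻¹ * gaussWeight β z.2 := fun z hz => by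
    have := boundaryWeight_pos (mem_movingPhase.1 hz).1
    have := gaussWeight_pos β z.2
    refine ContinuousLinearMap.opNorm_le_bound _ (by positivity) fun ξ => ?_
    refine (hf.bound_fst z hz ξ).trans_eq ?_
    ring
  -- `m`, `c`, `s`, with index `0`, `1`, `2` for `K f`, its `x`- and its `v`-derivative: majorant,
  -- continuity and measurability of the integrand
  have m0 : ∀ z : E3 × E3, ‖z.1‖ < r → ∀ w, w ≠ 0 → w ≠ z.2 → ‖hardSphereK z.2 w * f (z.1, w)‖ ≤
      C₀ * a * gaussWeight β z.2 * singularMajorant (kernelRate β) z.2 w := by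
    intro z hz w h0 h1
    rw [norm_mul]
    exact hk₁ z.2 w h0 h1 a _ ha (hf.bound_inv _ (hmem hz h0))
  have m1 : ∀ z : E3 × E3, ‖z.1‖ < r → ∀ w, w ≠ 0 → w ≠ z.2 → ‖hardSphereK z.2 w • D (z.1, w)‖ ≤
      C₀ * (b * boundaryWeight r z.1) * gaussWeight β z.2 *
        singularMajorant (kernelRate β) z.2 w := by
    intro z hz w h0 h1
    rw [norm_smul]
    have := boundaryWeight_pos hz
    exact hk₁ z.2 w h0 h1 _ _ (by positivity) (hDb _ (hmem hz h0))
  have m2 : ∀ z : E3 × E3, ‖z.1‖ < r → ∀ w, w ≠ 0 → w ≠ z.2 → ‖f (z.1, w) • kernelDeriv z.2 w‖ ≤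
      C₀ * a' * (1 + ‖z.2‖) * gaussWeight β z.2 * singularMajorant (kernelRate β) z.2 w := by
    intro z hz w h0 h1
    rw [norm_smul]
    exact hk₂ z.2 w h0 h1 a' _ ha' (hf.bound _ (hmem hz h0))
  have hkc : ∀ v w : E3, w ≠ v → ContinuousAt (fun z : E3 × E3 => hardSphereK z.1 z.2) (v, w) :=
    fun v w h => (contDiffAt_hardSphereK h).continuousAt
  have c0 : ∀ (z : E3 × E3) (w : E3), ‖z.1‖ < r → w ≠ 0 → w ≠ z.2 → ContinuousAt
      (fun y : (E3 × E3) × E3 => hardSphereK y.1.2 y.2 * f (y.1.1, y.2)) (z, w) := by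
    intro z w hz h0 h1
    have e1 : ContinuousAt (fun y : (E3 × E3) × E3 => hardSphereK y.1.2 y.2) (z, w) :=
      ContinuousAt.comp (g := fun z : E3 × E3 => hardSphereK z.1 z.2)
        (f := fun y : (E3 × E3) × E3 => (y.1.2, y.2)) (hkc _ _ h1) (by fun_prop)
    have e2 : ContinuousAt (fun y : (E3 × E3) × E3 => f (y.1.1, y.2)) (z, w) :=
      ContinuousAt.comp (g := f) (f := fun y : (E3 × E3) × E3 => (y.1.1, y.2))
        (hfc _ (hmem hz h0)).continuousAt (by fun_prop)
    exact e1.mul e2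
  have c1 : ∀ (z : E3 × E3) (w : E3), ‖z.1‖ < r → w ≠ 0 → w ≠ z.2 → ContinuousAt
      (fun y : (E3 × E3) × E3 => hardSphereK y.1.2 y.2 • D (y.1.1, y.2)) (z, w) := by
    intro z w hz h0 h1
    have e1 : ContinuousAt (fun y : (E3 × E3) × E3 => hardSphereK y.1.2 y.2) (z, w) :=
      ContinuousAt.comp (g := fun z : E3 × E3 => hardSphereK z.1 z.2)
        (f := fun y : (E3 × E3) × E3 => (y.1.2, y.2)) (hkc _ _ h1) (by fun_prop)
    have e2 : ContinuousAt (fun y : (E3 × E3) × E3 => D (y.1.1, y.2)) (z, w) :=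
      ContinuousAt.comp (g := D) (f := fun y : (E3 × E3) × E3 => (y.1.1, y.2))
        (hDc _ (hmem hz h0)) (by fun_prop)
    exact e1.smul e2
  have c2 : ∀ (z : E3 × E3) (w : E3), ‖z.1‖ < r → w ≠ 0 → w ≠ z.2 → ContinuousAt
      (fun y : (E3 × E3) × E3 => f (y.1.1, y.2) • kernelDeriv y.1.2 y.2) (z, w) := by
    intro z w hz h0 h1
    have e1 : ContinuousAt (fun y : (E3 × E3) × E3 => kernelDeriv y.1.2 y.2) (z, w) :=
      ContinuousAt.comp (g := fun z : E3 × E3 => kernelDeriv z.1 z.2)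
        (f := fun y : (E3 × E3) × E3 => (y.1.2, y.2)) (continuousAt_kernelDeriv h1) (by fun_prop)
    have e2 : ContinuousAt (fun y : (E3 × E3) × E3 => f (y.1.1, y.2)) (z, w) :=
      ContinuousAt.comp (g := f) (f := fun y : (E3 × E3) × E3 => (y.1.1, y.2))
        (hfc _ (hmem hz h0)).continuousAt (by fun_prop)
    exact e2.smul e1
  have hsec : ∀ (z : E3 × E3) (w : E3), ContinuousAt (fun w : E3 => (z, w)) w := fun z w => by
    fun_prop
  have s0 : ∀ z : E3 × E3, ‖z.1‖ < r →
      AEStronglyMeasurable fun w => hardSphereK z.2 w * f (z.1, w) := fun z hz =>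
    aestronglyMeasurable_of_continuousAt_off (v := z.2) fun w h0 h1 =>
      ContinuousAt.comp (f := fun w : E3 => (z, w)) (c0 z w hz h0 h1) (hsec z w)
  have s1 : ∀ z : E3 × E3, ‖z.1‖ < r →
      AEStronglyMeasurable fun w => hardSphereK z.2 w • D (z.1, w) := fun z hz =>
    aestronglyMeasurable_of_continuousAt_off (v := z.2) fun w h0 h1 =>
      ContinuousAt.comp (f := fun w : E3 => (z, w)) (c1 z w hz h0 h1) (hsec z w)
  have s2 : ∀ z : E3 × E3, ‖z.1‖ < r →
      AEStronglyMeasurable fun w => f (z.1, w) • kernelDeriv z.2 w := fun z hz =>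
    aestronglyMeasurable_of_continuousAt_off (v := z.2) fun w h0 h1 =>
      ContinuousAt.comp (f := fun w : E3 => (z, w)) (c2 z w hz h0 h1) (hsec z w)
  have i0 : ∀ z : E3 × E3, ‖z.1‖ < r → Integrable fun w => hardSphereK z.2 w * f (z.1, w) := by
    intro z hz
    refine ((hs z.2).1.const_mul (C₀ * a * gaussWeight β z.2)).mono' (s0 z hz) ?_
    filter_upwards [ae_ne_point 0, ae_ne_point z.2] with w h0 h1 using m0 z hz w h0 h1
  have bd : ∀ {F : Type} [NormedAddCommGroup F] [NormedSpace ℝ F] (z : E3 × E3) (A : E3 → F) (M : ℝ),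
      0 ≤ M → (∀ w, w ≠ 0 → w ≠ z.2 → ‖A w‖ ≤ M * singularMajorant (kernelRate β) z.2 w) →
      ‖∫ w, A w‖ ≤ M * C₁ := by
    intro F _ _ z A M hM hA
    refine (norm_integral_le_of_norm_le ((hs z.2).1.const_mul M) ?_).trans ?_
    · filter_upwards [ae_ne_point 0, ae_ne_point z.2] with w h0 h1 using hA w h0 h1
    · rw [integral_const_mul]
      exact mul_le_mul_of_nonneg_left (hs z.2).2 hM
  -- The partial derivatives exist and are jointly continuous, so `K f` is continuously differentiable.
  set G₁ : E3 → E3 → E3 →L[ℝ] ℝ := fun x v => ∫ w, hardSphereK v w • D (x, w) with hG₁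
  set G₂ : E3 → E3 → E3 →L[ℝ] ℝ := fun x v => ∫ w, f (x, w) • kernelDeriv v w with hG₂
  have d1 : ∀ z : E3 × E3, ‖z.1‖ < r →
      HasFDerivAt (fun x => opK hardSphereK f (x, z.2)) (G₁ z.1 z.2) z.1 := by
    intro z hz
    simp only [opK]
    refine hasFDerivAt_integral_of_dominated_of_fderiv_le
      (F' := fun x w => hardSphereK z.2 w • D (x, w))
      (bound := fun w => C₀ * (b * (boundaryWeight r z.1 + 1)) * gaussWeight β z.2 *
        singularMajorant (kernelRate β) z.2 w) (eventually_boundaryWeight_lt hz) ?_ (i0 z hz)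
      (s1 z hz) ?_ ((hs z.2).1.const_mul _) ?_
    · filter_upwards [eventually_boundaryWeight_lt hz] with x hx using s0 (x, z.2) hx.1
    · filter_upwards [ae_ne_point 0, ae_ne_point z.2] with w h0 h1 x hx
      refine (m1 (x, z.2) hx.1 w h0 h1).trans ?_
      have h3 := singularMajorant_nonneg (kernelRate β) z.2 w
      have h4 := gaussWeight_pos β z.2
      gcongr
      exact hx.2.le
    · filter_upwards [ae_ne_point 0] with w h0 x hx
      have e1 : HasFDerivAt (fun x => f (x, w)) (D (x, w)) x :=
        HasFDerivAt.comp x (hfd _ (hmem hx.1 h0)) (hasFDerivAt_prodMk_left x w)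
      exact e1.const_mul _
  have d2 : ∀ z : E3 × E3, ‖z.1‖ < r →
      HasFDerivAt (fun v => opK hardSphereK f (z.1, v)) (G₂ z.1 z.2) z.2 := by
    intro z hz
    simp only [opK]
    refine hasFDerivAt_integral_kernel hβ0 hβ1 (g := fun w => f (z.1, w)) (a' := a')
      (fun w h0 => ?_) (fun w h0 => hf.bound _ (hmem hz h0)) (fun v => i0 (z.1, v) hz) z.2
    exact ContinuousAt.comp (g := f) (f := fun w : E3 => (z.1, w))
      (hfc _ (hmem hz h0)).continuousAt (by fun_prop)
  have g1 : ∀ z : E3 × E3, ‖z.1‖ < r → ContinuousAt (fun z : E3 × E3 => G₁ z.1 z.2) z := by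
    intro z hz
    have hev := (continuousAt_fst (p := z)).eventually (eventually_boundaryWeight_lt hz)
    refine continuousAt_integral_of_singular (vel := fun z : E3 × E3 => z.2) continuousAt_snd hκ
      (C := C₀ * (b * (boundaryWeight r z.1 + 1)) * 1) ?_ ?_ (fun w h0 h1 => c1 z w hz h0 h1)
    · filter_upwards [hev] with y hy using s1 y hy.1
    · filter_upwards [hev] with y hy w h0 h1
      refine (m1 y hy.1 w h0 h1).trans ?_
      have h3 := singularMajorant_nonneg (kernelRate β) y.2 w
      have h5 := boundaryWeight_pos hy.1
      have h6 := boundaryWeight_pos hz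
      have h7 := hy.2.le
      have h8 := gaussWeight_le_one hβ0 y.2
      have h9 := gaussWeight_pos β y.2
      gcongr
  have g2 : ∀ z : E3 × E3, ‖z.1‖ < r → ContinuousAt (fun z : E3 × E3 => G₂ z.1 z.2) z := by
    intro z hz
    have hev := (continuousAt_fst (p := z)).eventually (eventually_boundaryWeight_lt hz)
    have hev2 : ∀ᶠ y : E3 × E3 in 𝓝 z, ‖y.2‖ < ‖z.2‖ + 1 :=
      continuousAt_snd.norm.eventually_lt_const (by simp)
    refine continuousAt_integral_of_singular (vel := fun z : E3 × E3 => z.2) continuousAt_snd hκ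
      (C := C₀ * a' * (1 + (‖z.2‖ + 1)) * 1) ?_ ?_ (fun w h0 h1 => c2 z w hz h0 h1)
    · filter_upwards [hev] with y hy using s2 y hy.1
    · filter_upwards [hev, hev2] with y hy hy2 w h0 h1
      refine (m2 y hy.1 w h0 h1).trans ?_
      have h3 := singularMajorant_nonneg (kernelRate β) y.2 w
      have h8 := gaussWeight_le_one hβ0 y.2
      have h9 := gaussWeight_pos β y.2
      gcongr
  have hev : ∀ z : E3 × E3, ‖z.1‖ < r → ∀ᶠ y : E3 × E3 in 𝓝 z, ‖y.1‖ < r := fun z hz =>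
    continuousAt_fst.norm.eventually_lt_const hz
  have hder : ∀ z : E3 × E3, ‖z.1‖ < r → HasFDerivAt (opK hardSphereK f)
      ((G₁ z.1 z.2).coprod (G₂ z.1 z.2)) z := fun z hz =>
    (hasStrictFDerivAt_uncurry_coprod (f := fun x v => opK hardSphereK f (x, v)) (f₁ := G₁)
      (f₂ := G₂) (u := z) ((hev z hz).mono fun y hy => d1 y hy)
      ((hev z hz).mono fun y hy => d2 y hy) (g1 z hz) (g2 z hz)).hasFDerivAt
  refine ⟨⟨?_, ?_, ?_, ?_⟩, fun z hz => i0 z (mem_phaseSpace.1 hz)⟩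
  · rw [show (1 : WithTop ℕ∞) = 0 + 1 by simp, contDiffOn_succ_iff_fderiv_of_isOpen
      (isOpen_phaseSpace r)]
    refine ⟨fun z hz => (hder z (mem_phaseSpace.1 hz)).differentiableAt.differentiableWithinAt,
      by simp, contDiffOn_zero.2 fun z hz => ContinuousAt.continuousWithinAt ?_⟩
    have hz := mem_phaseSpace.1 hz
    have e : ContinuousAt (fun z : E3 × E3 => (G₁ z.1 z.2).coprod (G₂ z.1 z.2)) z := by
      have h1 := (g1 z hz).clm_comp (continuousAt_const (y := ContinuousLinearMap.fst ℝ E3 E3))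
      have h2 := (g2 z hz).clm_comp (continuousAt_const (y := ContinuousLinearMap.snd ℝ E3 E3))
      refine (h1.add h2).congr (Eventually.of_forall fun y => ?_)
      ext <;> simp
    refine e.congr ?_
    filter_upwards [hev z hz] with y hy using (hder y hy).fderiv.symm
  · intro z hz
    have := bd z _ _ (by have := gaussWeight_pos β z.2; positivity) (m0 z (mem_phaseSpace.1 hz))
    rw [Real.norm_eq_abs] at this
    exact this.trans_eq (by ring)
  · intro z hz ξ
    have hz := mem_phaseSpace.1 hz
    have h1 := bd z _ _ (by
      have := gaussWeight_pos β z.2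
      have := boundaryWeight_pos hz
      positivity) (m1 z hz)
    rw [(hder z hz).fderiv, ContinuousLinearMap.coprod_apply, map_zero, add_zero,
      ← Real.norm_eq_abs]
    refine ((G₁ z.1 z.2).le_of_opNorm_le h1 ξ).trans_eq (by ring)
  · intro z hz ξ
    have hz := mem_phaseSpace.1 hz
    have h1 := bd z _ _ (by have := gaussWeight_pos β z.2; positivity) (m2 z hz)
    rw [(hder z hz).fderiv, ContinuousLinearMap.coprod_apply, map_zero, zero_add,
      ← Real.norm_eq_abs]
    refine ((G₂ z.1 z.2).le_of_opNorm_le h1 ξ).trans_eq (by ring)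

/-! ### Integrals over chords -/

/-- Differentiation of an integral over `(0, 1)` depending on a parameter in a `C¹` way, with
a majorant that is locally uniform in the parameter. -/
theorem contDiffOn_integral_Ioo {E : Type*} [NormedAddCommGroup E] [NormedSpace ℝ E]
    [FiniteDimensional ℝ E] {U : Set E} (hU : IsOpen U) {F : E × ℝ → ℝ}
    (hF : ContDiffOn ℝ 1 F (U ×ˢ Ioo 0 1)) {m : ℝ → ℝ} (hm : IntegrableOn m (Ioo 0 1))
    (hm0 : ∀ θ ∈ Ioo (0 : ℝ) 1, 0 ≤ m θ) {c : E → ℝ} (hc : ContinuousOn c U)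
    (hb : ∀ z ∈ U, ∀ θ ∈ Ioo (0 : ℝ) 1, |F (z, θ)| ≤ c z * m θ)
    (hb' : ∀ z ∈ U, ∀ θ ∈ Ioo (0 : ℝ) 1, ‖fderiv ℝ (fun y => F (y, θ)) z‖ ≤ c z * m θ) :
    ContDiffOn ℝ 1 (fun z => ∫ θ in Ioo (0 : ℝ) 1, F (z, θ)) U ∧ ∀ z ∈ U,
      IntegrableOn (fun θ => fderiv ℝ (fun y => F (y, θ)) z) (Ioo 0 1) ∧ ∀ ζ,
      fderiv ℝ (fun z => ∫ θ in Ioo (0 : ℝ) 1, F (z, θ)) z ζ =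
        ∫ θ in Ioo (0 : ℝ) 1, fderiv ℝ (fun y => F (y, θ)) z ζ := by
  have hO : IsOpen (U ×ˢ Ioo (0 : ℝ) 1) := hU.prod isOpen_Ioo
  have hFc : ∀ z ∈ U, ∀ θ ∈ Ioo (0 : ℝ) 1, ContDiffAt ℝ 1 F (z, θ) := fun z hz θ hθ =>
    hF.contDiffAt (hO.mem_nhds ⟨hz, hθ⟩)
  have hd : ∀ z ∈ U, ∀ θ ∈ Ioo (0 : ℝ) 1, HasFDerivAt (fun y => F (y, θ))
      ((fderiv ℝ F (z, θ)).comp (ContinuousLinearMap.inl ℝ E ℝ)) z := fun z hz θ hθ =>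
    (((hFc z hz θ hθ).differentiableAt (by simp)).hasFDerivAt).comp z (hasFDerivAt_prodMk_left z θ)
  have hP : ∀ z ∈ U, ∀ θ ∈ Ioo (0 : ℝ) 1,
      ContinuousAt (fun y : E × ℝ => (fderiv ℝ F y).comp (ContinuousLinearMap.inl ℝ E ℝ)) (z, θ) :=
    fun z hz θ hθ => ((hFc z hz θ hθ).continuousAt_fderiv (by simp)).clm_comp continuousAt_const
  have hD : ∀ z ∈ U, ∀ θ ∈ Ioo (0 : ℝ) 1,
      ContinuousAt (fun y : E × ℝ => fderiv ℝ (fun x => F (x, y.2)) y.1) (z, θ) := by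
    intro z hz θ hθ
    refine (hP z hz θ hθ).congr ?_
    filter_upwards [hO.mem_nhds (show (z, θ) ∈ U ×ˢ Ioo (0 : ℝ) 1 from ⟨hz, hθ⟩)] with y hy
    exact (hd y.1 hy.1 y.2 hy.2).fderiv.symm
  have hFm : ∀ z ∈ U, AEStronglyMeasurable (fun θ => F (z, θ)) (volume.restrict (Ioo 0 1)) :=
    fun z hz => ContinuousOn.aestronglyMeasurable (fun θ hθ => ContinuousAt.continuousWithinAt
      (ContinuousAt.comp (g := F) (f := fun θ : ℝ => (z, θ)) (hFc z hz θ hθ).continuousAt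
        (by fun_prop))) measurableSet_Ioo
  have hDm : ∀ z ∈ U, AEStronglyMeasurable (fun θ => fderiv ℝ (fun x => F (x, θ)) z)
      (volume.restrict (Ioo 0 1)) :=
    fun z hz => ContinuousOn.aestronglyMeasurable (fun θ hθ => ContinuousAt.continuousWithinAt
      (ContinuousAt.comp (g := fun y : E × ℝ => fderiv ℝ (fun x => F (x, y.2)) y.1)
        (f := fun θ : ℝ => (z, θ)) (hD z hz θ hθ) (by fun_prop))) measurableSet_Ioo
  have hFi : ∀ z ∈ U, IntegrableOn (fun θ => F (z, θ)) (Ioo 0 1) := fun z hz => by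
    refine Integrable.mono' (hm.const_mul (c z)) (hFm z hz) ?_
    filter_upwards [ae_restrict_mem measurableSet_Ioo] with θ hθ using hb z hz θ hθ
  have hDi : ∀ z ∈ U, IntegrableOn (fun θ => fderiv ℝ (fun x => F (x, θ)) z) (Ioo 0 1) :=
    fun z hz => by
    refine Integrable.mono' (hm.const_mul (c z)) (hDm z hz) ?_
    filter_upwards [ae_restrict_mem measurableSet_Ioo] with θ hθ using hb' z hz θ hθ
  have hev : ∀ z ∈ U, ∀ᶠ y in 𝓝 z, y ∈ U ∧ c y < c z + 1 := fun z hz =>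
    (hU.eventually_mem hz).and
      ((hc.continuousAt (hU.mem_nhds hz)).eventually_lt_const (by simp))
  have hmain : ∀ z ∈ U, HasFDerivAt (fun z => ∫ θ in Ioo (0 : ℝ) 1, F (z, θ))
      (∫ θ in Ioo (0 : ℝ) 1, fderiv ℝ (fun x => F (x, θ)) z) z := by
    intro z hz
    refine hasFDerivAt_integral_of_dominated_of_fderiv_le (bound := fun θ => (c z + 1) * m θ)
      (F' := fun z θ => fderiv ℝ (fun x => F (x, θ)) z)
      (hev z hz) ?_ (hFi z hz) (hDm z hz) ?_ (hm.const_mul _) ?_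
    · filter_upwards [hev z hz] with y hy using hFm y hy.1
    · filter_upwards [ae_restrict_mem measurableSet_Ioo] with θ hθ y hy
      exact (hb' y hy.1 θ hθ).trans (mul_le_mul_of_nonneg_right hy.2.le (hm0 θ hθ))
    · filter_upwards [ae_restrict_mem measurableSet_Ioo] with θ hθ y hy
      exact (hd y hy.1 θ hθ).differentiableAt.hasFDerivAt
  refine ⟨?_, fun z hz => ⟨hDi z hz, fun ζ => ?_⟩⟩
  · rw [show (1 : WithTop ℕ∞) = 0 + 1 by simp, contDiffOn_succ_iff_fderiv_of_isOpen hU]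
    refine ⟨fun z hz => (hmain z hz).differentiableAt.differentiableWithinAt,
      by simp, contDiffOn_zero.2 fun z hz => ContinuousAt.continuousWithinAt ?_⟩
    have : ContinuousAt (fun z => ∫ θ in Ioo (0 : ℝ) 1, fderiv ℝ (fun x => F (x, θ)) z) z := by
      refine continuousAt_of_dominated (bound := fun θ => (c z + 1) * m θ) ?_ ?_ (hm.const_mul _) ?_
      · filter_upwards [hev z hz] with y hy using hDm y hy.1
      · filter_upwards [hev z hz] with y hy
        filter_upwards [ae_restrict_mem measurableSet_Ioo] with θ hθ
        exact (hb' y hy.1 θ hθ).trans (mul_le_mul_of_nonneg_right hy.2.le (hm0 θ hθ))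
      · filter_upwards [ae_restrict_mem measurableSet_Ioo] with θ hθ
        exact ContinuousAt.comp (g := fun y : E × ℝ => fderiv ℝ (fun x => F (x, y.2)) y.1)
          (f := fun z : E => (z, θ)) (hD z hz θ hθ) (by fun_prop)
    refine this.congr ?_
    filter_upwards [hU.mem_nhds hz] with y hy using (hmain y hy).fderiv.symm
  · rw [(hmain z hz).fderiv, ContinuousLinearMap.integral_apply (hDi z hz)]

/-- The density of the arcsine law on `(0, 1)`, which governs the boundary weight along a chord. -/
def arcsineDensity (θ : ℝ) : ℝ := (√(θ * (1 - θ)))⁻¹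

lemma one_le_arcsineDensity {θ : ℝ} (h : θ ∈ Ioo (0 : ℝ) 1) : 1 ≤ arcsineDensity θ := by
  have h1 : 0 < θ * (1 - θ) := mul_pos h.1 (by linarith [h.2])
  rw [arcsineDensity]
  refine (one_le_inv₀ (Real.sqrt_pos.2 h1)).2 ?_
  rw [Real.sqrt_le_one]
  nlinarith [h.1, h.2]

lemma arcsineDensity_nonneg (θ : ℝ) : 0 ≤ arcsineDensity θ := inv_nonneg.2 (Real.sqrt_nonneg _)

lemma integrableOn_arcsineDensity : IntegrableOn arcsineDensity (Ioo 0 1) := by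
  have h1 : IntegrableOn (fun θ : ℝ => θ ^ (-(1 / 2) : ℝ)) (Ioo 0 1) :=
    (intervalIntegral.integrableOn_Ioo_rpow_iff one_pos).2 (by norm_num)
  have h2 : IntegrableOn (fun θ : ℝ => (1 - θ) ^ (-(1 / 2) : ℝ)) (Ioo 0 1) := by
    have e : IntervalIntegrable (fun θ : ℝ => θ ^ (-(1 / 2) : ℝ)) volume 0 1 :=
      intervalIntegral.intervalIntegrable_rpow' (by norm_num)
    have e2 := (e.comp_sub_left 1).symm
    simp only [sub_zero, sub_self] at e2
    exact ((intervalIntegrable_iff_integrableOn_Ioo_of_le zero_le_one).1 e2)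
  refine Integrable.mono' (h1.add h2) ?_ ?_
  · unfold arcsineDensity
    exact Measurable.aestronglyMeasurable (by fun_prop)
  · filter_upwards [ae_restrict_mem measurableSet_Ioo] with θ hθ
    have p0 := hθ.1
    have p1 : 0 < 1 - θ := by linarith [hθ.2]
    rw [Real.norm_of_nonneg (arcsineDensity_nonneg θ), arcsineDensity, Pi.add_apply,
      Real.rpow_neg p0.le, Real.rpow_neg p1.le, ← Real.sqrt_eq_rpow, ← Real.sqrt_eq_rpow,
      Real.sqrt_mul p0.le, mul_inv]
    have q0 := Real.sqrt_pos.2 p0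
    have q1 := Real.sqrt_pos.2 p1
    have s0 := Real.sq_sqrt p0.le
    have s1 := Real.sq_sqrt p1.le
    rw [← mul_inv, inv_add_inv q0.ne' q1.ne', inv_eq_one_div]
    gcongr
    nlinarith [mul_pos q0 q1]

/-! ### The operator `S` -/

/-- The point `x - θ τ v` at relative position `θ` on the backward chord, together with `v`. -/
def chordPoint (r : ℝ) (z : E3 × E3) (θ : ℝ) : E3 × E3 := (z.1 - (θ * ballTime r z) • z.2, z.2)

/-- The integrand of `S h`, parametrized over `(0, 1)` instead of `(0, τ)`. The points of
evaluation then stay in the open phase space, so that no boundary values of `h` are needed. -/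
def chordIntegrand (r : ℝ) (h : E3 × E3 → ℝ) (y : (E3 × E3) × ℝ) : ℝ :=
  ballTime r y.1 * Real.exp (-(hardSphereNu y.1.2 * (y.2 * ballTime r y.1))) *
    h (chordPoint r y.1 y.2)

lemma chordPoint_mem {r : ℝ} (hr : 0 < r) {z : E3 × E3} (hz : z ∈ movingPhase r) {θ : ℝ}
    (hθ : θ ∈ Ioo (0 : ℝ) 1) : chordPoint r z θ ∈ phaseSpace r :=
  ⟨chord_mem_ball hr hz hθ.1.le hθ.2, mem_univ _⟩

lemma opS_ball {r : ℝ} (hr : 0 < r) {z : E3 × E3} (hz : z ∈ movingPhase r) (h : E3 × E3 → ℝ) :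
    opS hardSphereNu (Metric.ball 0 r) h z = ∫ θ in Ioo (0 : ℝ) 1, chordIntegrand r h (z, θ) := by
  have := intervalIntegral.mul_integral_comp_mul_right (a := (0 : ℝ)) (b := 1)
    (f := fun s => Real.exp (-(hardSphereNu z.2 * s)) * h (z.1 - s • z.2, z.2)) (ballTime r z)
  rw [zero_mul, one_mul] at this
  rw [opS, exitTime_ball hr hz, ← this, intervalIntegral.integral_of_le zero_le_one,
    integral_Ioc_eq_integral_Ioo, ← integral_const_mul]
  simp only [chordIntegrand, chordPoint, mul_assoc]

lemma contDiffOn_chordIntegrand {r : ℝ} (hr : 0 < r) {h : E3 × E3 → ℝ}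
    (hh : ContDiffOn ℝ 1 h (phaseSpace r)) :
    ContDiffOn ℝ 1 (chordIntegrand r h) (movingPhase r ×ˢ Ioo 0 1) := by
  have hτ : ContDiffOn ℝ 1 (fun y : (E3 × E3) × ℝ => ballTime r y.1) (movingPhase r ×ˢ Ioo 0 1) :=
    ((contDiffOn_ballTime r).of_le (by simp)).comp contDiffOn_fst fun y hy => hy.1
  have hν : ContDiffOn ℝ 1 (fun y : (E3 × E3) × ℝ => hardSphereNu y.1.2)
      (movingPhase r ×ˢ Ioo 0 1) := fun y hy =>
    (ContDiffAt.comp (g := hardSphereNu) (f := fun y : (E3 × E3) × ℝ => y.1.2) y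
      (contDiffAt_hardSphereNu (mem_movingPhase.1 hy.1).2) (by fun_prop)).contDiffWithinAt
  have hθ : ContDiffOn ℝ 1 (fun y : (E3 × E3) × ℝ => y.2) (movingPhase r ×ˢ Ioo 0 1) :=
    contDiffOn_snd
  have hx : ContDiffOn ℝ 1 (fun y : (E3 × E3) × ℝ => y.1.1) (movingPhase r ×ˢ Ioo 0 1) := by
    fun_prop
  have hv : ContDiffOn ℝ 1 (fun y : (E3 × E3) × ℝ => y.1.2) (movingPhase r ×ˢ Ioo 0 1) := by
    fun_prop
  have hp : ContDiffOn ℝ 1 (fun y : (E3 × E3) × ℝ => chordPoint r y.1 y.2)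
      (movingPhase r ×ˢ Ioo 0 1) := (hx.sub ((hθ.mul hτ).smul hv)).prodMk hv
  unfold chordIntegrand
  exact (hτ.mul (hν.mul (hθ.mul hτ)).neg.exp).mul
    (hh.comp hp fun y hy => chordPoint_mem hr hy.1 hy.2)

lemma differentiableAt_hardSphereNu {v : E3} (hv : v ≠ 0) : DifferentiableAt ℝ hardSphereNu v :=
  (contDiffAt_hardSphereNu hv).differentiableAt (by simp)

lemma fderiv_chordIntegrand {r : ℝ} (hr : 0 < r) {h : E3 × E3 → ℝ}
    (hh : ContDiffOn ℝ 1 h (phaseSpace r)) {z : E3 × E3} (hz : z ∈ movingPhase r) {θ : ℝ}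
    (hθ : θ ∈ Ioo (0 : ℝ) 1) (ζ : E3 × E3) :
    fderiv ℝ (fun y => chordIntegrand r h (y, θ)) z ζ =
      Real.exp (-(hardSphereNu z.2 * (θ * ballTime r z))) *
        (fderiv ℝ (ballTime r) z ζ * (1 - hardSphereNu z.2 * (θ * ballTime r z)) *
            h (chordPoint r z θ) -
          ballTime r z * (θ * ballTime r z) * fderiv ℝ hardSphereNu z.2 ζ.2 *
            h (chordPoint r z θ) +
          ballTime r z * (fderiv ℝ h (chordPoint r z θ)
            (ζ.1 - (θ * fderiv ℝ (ballTime r) z ζ) • z.2 - (θ * ballTime r z) • ζ.2, 0) +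
            fderiv ℝ h (chordPoint r z θ) (0, ζ.2))) := by
  have hτ := (differentiableAt_ballTime hz).hasFDerivAt
  have hν : HasFDerivAt (fun y : E3 × E3 => hardSphereNu y.2)
      ((fderiv ℝ hardSphereNu z.2).comp (ContinuousLinearMap.snd ℝ E3 E3)) z :=
    (differentiableAt_hardSphereNu (mem_movingPhase.1 hz).2).hasFDerivAt.comp z hasFDerivAt_snd
  have hcp := chordPoint_mem hr hz hθ
  have hh' : HasFDerivAt h (fderiv ℝ h (chordPoint r z θ)) (chordPoint r z θ) :=
    ((hh.contDiffAt ((isOpen_phaseSpace r).mem_nhds hcp)).differentiableAt (by simp)).hasFDerivAt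
  have hp : HasFDerivAt (fun y : E3 × E3 => chordPoint r y θ)
      ((ContinuousLinearMap.fst ℝ E3 E3 - ((θ * ballTime r z) • ContinuousLinearMap.snd ℝ E3 E3 +
        (θ • fderiv ℝ (ballTime r) z).smulRight z.2)).prod (ContinuousLinearMap.snd ℝ E3 E3)) z :=
    (hasFDerivAt_fst.sub ((hτ.const_mul θ).smul hasFDerivAt_snd)).prodMk hasFDerivAt_snd
  have hall := (hτ.mul (hν.mul (hτ.const_mul θ)).neg.exp).mul (hh'.comp z hp)
  have e1 : HasFDerivAt (fun y => chordIntegrand r h (y, θ)) _ z := hall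
  rw [e1.fderiv]
  have hlin : fderiv ℝ h (chordPoint r z θ)
        (ζ.1 - (θ * fderiv ℝ (ballTime r) z ζ) • z.2 - (θ * ballTime r z) • ζ.2, 0) +
      fderiv ℝ h (chordPoint r z θ) (0, ζ.2) = fderiv ℝ h (chordPoint r z θ)
        (ζ.1 - ((θ * ballTime r z) • ζ.2 + (θ * fderiv ℝ (ballTime r) z ζ) • z.2), ζ.2) := by
    rw [← map_add]
    congr 1
    ext1
    · simp only [Prod.mk_add_mk, add_zero]; abel
    · simp
  rw [hlin]
  simp
  ring

/-- The constants are determined as upper bounds at the center of the ball. -/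
lemma gainBound_nonneg {r β a b c : ℝ} {h : E3 × E3 → ℝ} (hr : 0 < r) (H : GainBound r β a b c h) :
    0 ≤ a ∧ 0 ≤ b ∧ 0 ≤ c := by
  have h0 : ((0 : E3), (0 : E3)) ∈ phaseSpace r := mem_phaseSpace.2 (by simpa using hr)
  have hg := gaussWeight_pos β (0 : E3)
  have hw := boundaryWeight_pos (r := r) (x := 0) (by simpa using hr)
  have he : ‖basisVec 0‖ = 1 := by simp [basisVec]
  have e1 := (abs_nonneg _).trans (H.bound _ h0)
  have e2 := (abs_nonneg _).trans (H.bound_fst _ h0 (basisVec 0))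
  have e3 := (abs_nonneg _).trans (H.bound_snd _ h0 (basisVec 0))
  simp only [he, mul_one, norm_zero, add_zero] at e2 e3
  refine ⟨nonneg_of_mul_nonneg_left e1 hg, ?_, nonneg_of_mul_nonneg_left e3 hg⟩
  exact nonneg_of_mul_nonneg_left (nonneg_of_mul_nonneg_left e2 hg) hw

lemma exp_neg_mul_abs_one_sub_le {y : ℝ} (hy : 0 ≤ y) : Real.exp (-y) * |1 - y| ≤ 1 := by
  have h1 := Real.add_one_le_exp y
  rw [Real.exp_neg, inv_mul_le_one₀ (Real.exp_pos _), abs_le]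
  constructor <;> linarith

section ChordBounds

variable {r β a b c : ℝ} {h : E3 × E3 → ℝ} {z : E3 × E3} {θ : ℝ}

lemma abs_chordIntegrand_le (hr : 0 < r) (H : GainBound r β a b c h) (hz : z ∈ movingPhase r)
    (hθ : θ ∈ Ioo (0 : ℝ) 1) : |chordIntegrand r h (z, θ)| ≤
      ballTime r z * Real.exp (-(hardSphereNu z.2 * (θ * ballTime r z))) * (a * gaussWeight β z.2) := by
  have hT := ballTime_pos hz
  rw [chordIntegrand, abs_mul, abs_of_pos (mul_pos hT (Real.exp_pos _))]
  gcongr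
  exact H.bound _ (chordPoint_mem hr hz hθ)

lemma abs_fderiv_chordPoint_fst_le (hr : 0 < r) (H : GainBound r β a b c h) (hz : z ∈ movingPhase r)
    (hθ : θ ∈ Ioo (0 : ℝ) 1) (ξ : E3) : |fderiv ℝ h (chordPoint r z θ) (ξ, 0)| ≤
      b * ((ballTime r z * ‖z.2‖)⁻¹ * arcsineDensity θ) * gaussWeight β z.2 * ‖ξ‖ := by
  obtain ⟨-, hb, -⟩ := gainBound_nonneg hr H
  refine (H.bound_fst _ (chordPoint_mem hr hz hθ) ξ).trans ?_
  have := gaussWeight_pos β z.2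
  change b * boundaryWeight r (z.1 - (θ * ballTime r z) • z.2) * gaussWeight β z.2 * ‖ξ‖ ≤ _
  gcongr
  exact boundaryWeight_chord_le hr hz hθ.1 hθ.2

lemma abs_fderiv_chordIntegrand_le (hr : 0 < r) (H : GainBound r β a b c h)
    (hz : z ∈ movingPhase r) (hθ : θ ∈ Ioo (0 : ℝ) 1) (ζ : E3 × E3) :
    |fderiv ℝ (fun y => chordIntegrand r h (y, θ)) z ζ| ≤
      Real.exp (-(hardSphereNu z.2 * (θ * ballTime r z))) *
        (|fderiv ℝ (ballTime r) z ζ| * |1 - hardSphereNu z.2 * (θ * ballTime r z)| *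
            (a * gaussWeight β z.2) +
          ballTime r z * (θ * ballTime r z) * (‖fderiv ℝ hardSphereNu z.2‖ * ‖ζ.2‖) *
            (a * gaussWeight β z.2) +
          (b * ‖z.2‖⁻¹ * arcsineDensity θ * gaussWeight β z.2 *
            (‖ζ.1‖ + θ * |fderiv ℝ (ballTime r) z ζ| * ‖z.2‖ + θ * ballTime r z * ‖ζ.2‖) +
          ballTime r z * (c * (1 + ‖z.2‖) * gaussWeight β z.2 * ‖ζ.2‖))) := by
  have hT := ballTime_pos hz
  have hv := norm_pos_iff.2 (mem_movingPhase.1 hz).2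
  have hg := gaussWeight_pos β z.2
  have hcp := chordPoint_mem hr hz hθ
  obtain ⟨ha, hb, hc⟩ := gainBound_nonneg hr H
  have hH := H.bound _ hcp
  have hs := arcsineDensity_nonneg θ
  rw [fderiv_chordIntegrand hr H.contDiffOn hz hθ, abs_mul, abs_of_pos (Real.exp_pos _)]
  refine mul_le_mul_of_nonneg_left ?_ (Real.exp_pos _).le
  refine (abs_add_le _ _).trans (add_le_add ((abs_sub _ _).trans (add_le_add ?_ ?_)) ?_)
  · rw [abs_mul, abs_mul]
    gcongr
    exact hH
  · rw [abs_mul, abs_mul, abs_mul, abs_of_pos hT, abs_of_pos (mul_pos hθ.1 hT)]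
    have hθ0 := hθ.1
    gcongr
    · exact (fderiv ℝ hardSphereNu z.2).le_opNorm ζ.2
    · exact hH
  · rw [abs_mul, abs_of_pos hT]
    have e1 := abs_fderiv_chordPoint_fst_le hr H hz hθ
      (ζ.1 - (θ * fderiv ℝ (ballTime r) z ζ) • z.2 - (θ * ballTime r z) • ζ.2)
    have e2 := H.bound_snd _ hcp ζ.2
    have e3 : ‖ζ.1 - (θ * fderiv ℝ (ballTime r) z ζ) • z.2 - (θ * ballTime r z) • ζ.2‖ ≤
        ‖ζ.1‖ + θ * |fderiv ℝ (ballTime r) z ζ| * ‖z.2‖ + θ * ballTime r z * ‖ζ.2‖ := by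
      refine (norm_sub_le _ _).trans (add_le_add ((norm_sub_le _ _).trans (add_le_add le_rfl ?_)) ?_)
      · rw [norm_smul, Real.norm_eq_abs, abs_mul, abs_of_pos hθ.1]
      · rw [norm_smul, Real.norm_of_nonneg (mul_pos hθ.1 hT).le]
    calc _ ≤ ballTime r z * (b * ((ballTime r z * ‖z.2‖)⁻¹ * arcsineDensity θ) * gaussWeight β z.2 *
          (‖ζ.1‖ + θ * |fderiv ℝ (ballTime r) z ζ| * ‖z.2‖ + θ * ballTime r z * ‖ζ.2‖) +
          c * (1 + ‖z.2‖) * gaussWeight β z.2 * ‖ζ.2‖) := by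
          gcongr
          exact (abs_add_le _ _).trans (add_le_add (e1.trans (by gcongr)) e2)
      _ = _ := by field_simp

lemma inv_norm_le_div_sqrt (hr : 0 < r) (hz : z ∈ movingPhase r) :
    ‖z.2‖⁻¹ ≤ r / √(chordDiscr r z) := by
  have hv := norm_pos_iff.2 (mem_movingPhase.1 hz).2
  have hD := Real.sqrt_pos.2 (chordDiscr_pos hz)
  rw [inv_eq_one_div, div_le_div_iff₀ hv hD, one_mul]
  exact sqrt_chordDiscr_le hr z

/-- In the `x`-direction the derivative of the integrand is bounded by the arcsine density. -/
lemma abs_fderiv_chordIntegrand_fst_le (hr : 0 < r) (H : GainBound r β a b c h)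
    (hz : z ∈ movingPhase r) (hθ : θ ∈ Ioo (0 : ℝ) 1) (ξ : E3) :
    |fderiv ℝ (fun y => chordIntegrand r h (y, θ)) z (ξ, 0)| ≤
      r / √(chordDiscr r z) * gaussWeight β z.2 * ‖ξ‖ * (a + 2 * b * arcsineDensity θ) := by
  have hT := ballTime_pos hz
  have hv := norm_pos_iff.2 (mem_movingPhase.1 hz).2
  have hg := gaussWeight_pos β z.2
  have hD := Real.sqrt_pos.2 (chordDiscr_pos hz)
  obtain ⟨ha, hb, hc⟩ := gainBound_nonneg hr H
  have hs := arcsineDensity_nonneg θ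
  have hν := hardSphereNu_pos z.2
  have ht : |fderiv ℝ (ballTime r) z (ξ, 0)| ≤ r / √(chordDiscr r z) * ‖ξ‖ := by
    refine (abs_fderiv_ballTime_le hr hz _).trans_eq ?_
    simp only [norm_zero, mul_zero, add_zero]; ring
  have h0 := abs_fderiv_chordIntegrand_le hr H hz hθ (ξ, 0)
  simp only [norm_zero, mul_zero, zero_mul, add_zero] at h0
  set t := |fderiv ℝ (ballTime r) z (ξ, 0)|
  have ht0 : 0 ≤ t := abs_nonneg _
  set y := hardSphereNu z.2 * (θ * ballTime r z)
  have hy : 0 ≤ y := by have := hθ.1; positivity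
  have h1 := exp_neg_mul_abs_one_sub_le hy
  have h2 : Real.exp (-y) ≤ 1 := Real.exp_le_one_iff.2 (by linarith)
  set R := r / √(chordDiscr r z)
  have hR : ‖z.2‖⁻¹ ≤ R := inv_norm_le_div_sqrt hr hz
  have hR0 : 0 < R := by positivity
  calc _ ≤ _ := h0
    _ = (Real.exp (-y) * |1 - y|) * t * (a * gaussWeight β z.2) + Real.exp (-y) *
        (b * arcsineDensity θ * gaussWeight β z.2 * (‖z.2‖⁻¹ * ‖ξ‖ + θ * t)) := by
        field_simp
    _ ≤ 1 * (R * ‖ξ‖) * (a * gaussWeight β z.2) + 1 *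
        (b * arcsineDensity θ * gaussWeight β z.2 * (R * ‖ξ‖ + 1 * (R * ‖ξ‖))) := by
        have := hθ.1
        have := hθ.2.le
        gcongr
    _ = _ := by ring

/-- In the `v`-direction the factor `T² θ` that comes from differentiating `e^{-νθT}` is compensated
by half of that exponential. -/
lemma abs_fderiv_chordIntegrand_snd_le (hr : 0 < r) (H : GainBound r β a b c h)
    (hz : z ∈ movingPhase r) (hθ : θ ∈ Ioo (0 : ℝ) 1) (η : E3) :
    |fderiv ℝ (fun y => chordIntegrand r h (y, θ)) z (0, η)| ≤
      gaussWeight β z.2 * ‖η‖ * ((r / √(chordDiscr r z) * (2 * a) +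
          2 / nuMin * ‖fderiv ℝ hardSphereNu z.2‖ * a + c * (1 + ‖z.2‖)) *
        (ballTime r z * Real.exp (-(nuMin / 2 * ballTime r z * θ))) +
      2 * b / nuMin * (r / √(chordDiscr r z)) * arcsineDensity θ) := by
  have hT := ballTime_pos hz
  have hv := norm_pos_iff.2 (mem_movingPhase.1 hz).2
  have hg := gaussWeight_pos β z.2
  have hD := Real.sqrt_pos.2 (chordDiscr_pos hz)
  obtain ⟨ha, hb, hc⟩ := gainBound_nonneg hr H
  have hs := arcsineDensity_nonneg θ
  have hν0 := nuMin_pos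
  have hθ0 := hθ.1
  have ht : |fderiv ℝ (ballTime r) z (0, η)| ≤ r / √(chordDiscr r z) * ballTime r z * ‖η‖ := by
    refine (abs_fderiv_ballTime_le hr hz _).trans_eq ?_
    simp only [norm_zero, zero_add]; ring
  have h0 := abs_fderiv_chordIntegrand_le hr H hz hθ (0, η)
  simp only [norm_zero, zero_add] at h0
  set t := |fderiv ℝ (ballTime r) z (0, η)|
  have ht0 : 0 ≤ t := abs_nonneg _
  set T := ballTime r z
  set y := hardSphereNu z.2 * (θ * T)
  set n := ‖fderiv ℝ hardSphereNu z.2‖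
  have hn : 0 ≤ n := norm_nonneg _
  have hy : nuMin * (θ * T) ≤ y := mul_le_mul_of_nonneg_right (nuMin_le z.2) (by positivity)
  set E := Real.exp (-(nuMin / 2 * T * θ)) with hE
  have hE0 : 0 < E := Real.exp_pos _
  have hy0 : 0 ≤ y := le_trans (by positivity) hy
  have q1 : Real.exp (-y) ≤ E := Real.exp_le_exp.2 (by nlinarith [mul_pos hν0 (mul_pos hθ0 hT)])
  have q2 : Real.exp (-y) * |1 - y| ≤ 2 * E := by
    have e1 : Real.exp (-y) = Real.exp (-(y / 2)) * Real.exp (-(y / 2)) := by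
      rw [← Real.exp_add]; congr 1; ring
    have e2 : Real.exp (-(y / 2)) ≤ E := Real.exp_le_exp.2 (by linarith)
    have e3 : Real.exp (-(y / 2)) * |1 - y| ≤ 2 := by
      have := Real.add_one_le_exp (y / 2)
      rw [Real.exp_neg, inv_mul_le_iff₀ (Real.exp_pos _), abs_le]
      constructor <;> linarith
    rw [e1, mul_assoc]
    calc _ ≤ E * 2 := by gcongr
      _ = _ := by ring
  have q3 : Real.exp (-y) * (θ * T) ≤ 2 / nuMin * E := by
    have e1 : Real.exp (-y) ≤ Real.exp (-(nuMin / 2) * (θ * T)) * E := by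
      rw [hE, ← Real.exp_add]; exact Real.exp_le_exp.2 (by linarith)
    have e2 := mul_exp_neg_le (half_pos hν0) (θ * T)
    calc _ ≤ (Real.exp (-(nuMin / 2) * (θ * T)) * E) * (θ * T) := by gcongr
      _ = (θ * T * Real.exp (-(nuMin / 2) * (θ * T))) * E := by ring
      _ ≤ (1 / (nuMin / 2)) * E := by gcongr
      _ = _ := by field_simp
  have q4 : Real.exp (-y) * (θ * T) ≤ 1 / nuMin := by
    have e1 : Real.exp (-y) ≤ Real.exp (-nuMin * (θ * T)) :=
      Real.exp_le_exp.2 (by linarith)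
    have e2 := mul_exp_neg_le hν0 (θ * T)
    calc _ ≤ Real.exp (-nuMin * (θ * T)) * (θ * T) := by gcongr
      _ ≤ _ := by linarith
  set R := r / √(chordDiscr r z)
  have hR : ‖z.2‖⁻¹ ≤ R := inv_norm_le_div_sqrt hr hz
  have hR0 : 0 < R := by positivity
  set g := gaussWeight β z.2
  calc _ ≤ _ := h0
    _ = (Real.exp (-y) * |1 - y|) * t * (a * g) + (Real.exp (-y) * (θ * T)) * T * (n * ‖η‖) * (a * g) +
        (b * arcsineDensity θ * g * (Real.exp (-y) * θ * (t + ‖z.2‖⁻¹ * T * ‖η‖)) +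
          Real.exp (-y) * T * (c * (1 + ‖z.2‖) * g * ‖η‖)) := by
        field_simp
    _ ≤ (2 * E) * (R * T * ‖η‖) * (a * g) + (2 / nuMin * E) * T * (n * ‖η‖) * (a * g) +
        (b * arcsineDensity θ * g * (Real.exp (-y) * θ * (R * T * ‖η‖ + R * T * ‖η‖)) +
          E * T * (c * (1 + ‖z.2‖) * g * ‖η‖)) := by
        gcongr
    _ = (2 * E) * (R * T * ‖η‖) * (a * g) + (2 / nuMin * E) * T * (n * ‖η‖) * (a * g) +
        (b * arcsineDensity θ * g * ((Real.exp (-y) * (θ * T)) * (2 * R * ‖η‖)) +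
          E * T * (c * (1 + ‖z.2‖) * g * ‖η‖)) := by ring
    _ ≤ (2 * E) * (R * T * ‖η‖) * (a * g) + (2 / nuMin * E) * T * (n * ‖η‖) * (a * g) +
        (b * arcsineDensity θ * g * ((1 / nuMin) * (2 * R * ‖η‖)) +
          E * T * (c * (1 + ‖z.2‖) * g * ‖η‖)) := by gcongr
    _ = _ := by ring

end ChordBounds

/-- The exponential damping makes `∫₀^T e^{-νs} ds` bounded uniformly in `T`. -/
lemma integral_mul_exp_le {T c : ℝ} (hT : 0 < T) (hc : 0 < c) :
    IntegrableOn (fun θ => T * Real.exp (-(c * T * θ))) (Ioo 0 1) ∧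
      ∫ θ in Ioo (0 : ℝ) 1, T * Real.exp (-(c * T * θ)) ≤ 1 / c := by
  have hd : ∀ θ : ℝ, HasDerivAt (fun θ => -(1 / c) * Real.exp (-(c * T * θ)))
      (T * Real.exp (-(c * T * θ))) θ := fun θ => by
    have := ((((hasDerivAt_id θ).const_mul (c * T)).neg).exp).const_mul (-(1 / c))
    refine this.congr_deriv ?_
    simp only [id]
    field_simp
    rfl
  have hcont : Continuous fun θ => T * Real.exp (-(c * T * θ)) := by fun_prop
  refine ⟨(hcont.integrableOn_Icc).mono_set Ioo_subset_Icc_self, ?_⟩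
  rw [← integral_Ioc_eq_integral_Ioo, ← intervalIntegral.integral_of_le zero_le_one,
    intervalIntegral.integral_eq_sub_of_hasDerivAt (fun θ _ => hd θ) (hcont.intervalIntegrable _ _)]
  have : 0 < 1 / c * Real.exp (-(c * T * 1)) := by positivity
  simp only [mul_zero, neg_zero, Real.exp_zero]
  linarith

/-- The total mass of the (unnormalized) arcsine density. -/
def arcsineMass : ℝ := ∫ θ in Ioo (0 : ℝ) 1, arcsineDensity θ

lemma arcsineMass_nonneg : 0 ≤ arcsineMass := integral_nonneg fun θ => arcsineDensity_nonneg θ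

section OperatorS

variable {r β a b c : ℝ} {h : E3 × E3 → ℝ}

/-- A bound with a constant depending continuously on `z`, for differentiation under the integral. -/
lemma abs_fderiv_chordIntegrand_crude_le (hr : 0 < r) (hβ : 0 ≤ β) (H : GainBound r β a b c h)
    {z : E3 × E3} (hz : z ∈ movingPhase r) {θ : ℝ} (hθ : θ ∈ Ioo (0 : ℝ) 1) (ζ : E3 × E3) :
    |fderiv ℝ (fun y => chordIntegrand r h (y, θ)) z ζ| ≤
      (‖fderiv ℝ (ballTime r) z‖ * a + ballTime r z * ballTime r z * ‖fderiv ℝ hardSphereNu z.2‖ * a +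
        (b * ‖z.2‖⁻¹ * (1 + ‖fderiv ℝ (ballTime r) z‖ * ‖z.2‖ + ballTime r z) +
          ballTime r z * (c * (1 + ‖z.2‖)))) * arcsineDensity θ * ‖ζ‖ := by
  have hT := ballTime_pos hz
  have hv := norm_pos_iff.2 (mem_movingPhase.1 hz).2
  have hg := gaussWeight_pos β z.2
  have hg1 := gaussWeight_le_one hβ z.2
  obtain ⟨ha, hb, hc⟩ := gainBound_nonneg hr H
  have hs := one_le_arcsineDensity hθ
  have hν := hardSphereNu_pos z.2
  have hθ0 := hθ.1
  have hθ1 := hθ.2.le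
  have ht : |fderiv ℝ (ballTime r) z ζ| ≤ ‖fderiv ℝ (ballTime r) z‖ * ‖ζ‖ :=
    (fderiv ℝ (ballTime r) z).le_opNorm ζ
  have h0 := abs_fderiv_chordIntegrand_le hr H hz hθ ζ
  set t := |fderiv ℝ (ballTime r) z ζ|
  have ht0 : 0 ≤ t := abs_nonneg _
  set y := hardSphereNu z.2 * (θ * ballTime r z)
  have hy : 0 ≤ y := by positivity
  have h1 := exp_neg_mul_abs_one_sub_le hy
  have h2 : Real.exp (-y) ≤ 1 := Real.exp_le_one_iff.2 (by linarith)
  have z1 := norm_fst_le ζ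
  have z2 := norm_snd_le ζ
  set T := ballTime r z
  set n := ‖fderiv ℝ hardSphereNu z.2‖
  set N := ‖fderiv ℝ (ballTime r) z‖
  set s := arcsineDensity θ
  set g := gaussWeight β z.2
  have hE := Real.exp_pos (-y)
  have hn : 0 ≤ n := norm_nonneg _
  have hN : 0 ≤ N := norm_nonneg _
  have hs0 : 0 ≤ s := arcsineDensity_nonneg θ
  calc _ ≤ _ := h0
    _ = (Real.exp (-y) * |1 - y|) * t * (a * g) + Real.exp (-y) * (T * (θ * T) * (n * ‖ζ.2‖) * (a * g)) +
        (b * ‖z.2‖⁻¹ * s * (Real.exp (-y) * g) * (‖ζ.1‖ + θ * t * ‖z.2‖ + θ * T * ‖ζ.2‖) +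
          Real.exp (-y) * (T * (c * (1 + ‖z.2‖) * g * ‖ζ.2‖))) := by ring
    _ ≤ 1 * (N * ‖ζ‖) * (a * 1) + 1 * (T * (1 * T) * (n * ‖ζ‖) * (a * 1)) +
        (b * ‖z.2‖⁻¹ * s * (1 * 1) * (‖ζ‖ + 1 * (N * ‖ζ‖) * ‖z.2‖ + 1 * T * ‖ζ‖) +
          1 * (T * (c * (1 + ‖z.2‖) * 1 * ‖ζ‖))) := by
        gcongr
    _ = (N * a + T * T * n * a + T * (c * (1 + ‖z.2‖))) * ‖ζ‖ * 1 +
        b * ‖z.2‖⁻¹ * (1 + N * ‖z.2‖ + T) * s * ‖ζ‖ := by ring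
    _ ≤ (N * a + T * T * n * a + T * (c * (1 + ‖z.2‖))) * ‖ζ‖ * s +
        b * ‖z.2‖⁻¹ * (1 + N * ‖z.2‖ + T) * s * ‖ζ‖ := by gcongr
    _ = _ := by ring

/-- The arcsine density is the integrable majorant. -/
lemma contDiffOn_integral_chordIntegrand (hr : 0 < r) (hβ : 0 ≤ β) (H : GainBound r β a b c h) :
    ContDiffOn ℝ 1 (fun z => ∫ θ in Ioo (0 : ℝ) 1, chordIntegrand r h (z, θ)) (movingPhase r) ∧
      ∀ z ∈ movingPhase r,
      IntegrableOn (fun θ => fderiv ℝ (fun y => chordIntegrand r h (y, θ)) z) (Ioo 0 1) ∧ ∀ ζ,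
      fderiv ℝ (fun z => ∫ θ in Ioo (0 : ℝ) 1, chordIntegrand r h (z, θ)) z ζ =
        ∫ θ in Ioo (0 : ℝ) 1, fderiv ℝ (fun y => chordIntegrand r h (y, θ)) z ζ := by
  obtain ⟨ha, hb, hc⟩ := gainBound_nonneg hr H
  have cT : ContinuousOn (ballTime r) (movingPhase r) := (contDiffOn_ballTime r).continuousOn
  have cN : ContinuousOn (fun z => ‖fderiv ℝ (ballTime r) z‖) (movingPhase r) :=
    ((contDiffOn_ballTime r).continuousOn_fderiv_of_isOpen (isOpen_movingPhase r) (by simp)).norm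
  have cn : ContinuousOn (fun z : E3 × E3 => ‖fderiv ℝ hardSphereNu z.2‖) (movingPhase r) :=
    fun z hz => (ContinuousAt.comp (g := fun v => fderiv ℝ hardSphereNu v)
      (f := fun z : E3 × E3 => z.2) ((contDiffAt_hardSphereNu
        (mem_movingPhase.1 hz).2).continuousAt_fderiv (by simp)) continuousAt_snd).norm.continuousWithinAt
  have cv : ContinuousOn (fun z : E3 × E3 => ‖z.2‖⁻¹) (movingPhase r) := fun z hz =>
    (continuousAt_snd.norm.inv₀ (norm_ne_zero_iff.2 (mem_movingPhase.1 hz).2)).continuousWithinAt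
  have c2 : ContinuousOn (fun z : E3 × E3 => ‖z.2‖) (movingPhase r) := by fun_prop
  refine contDiffOn_integral_Ioo (isOpen_movingPhase r) (contDiffOn_chordIntegrand hr H.contDiffOn)
    integrableOn_arcsineDensity (fun θ _ => arcsineDensity_nonneg θ) (c := fun z =>
      (‖fderiv ℝ (ballTime r) z‖ * a + ballTime r z * ballTime r z * ‖fderiv ℝ hardSphereNu z.2‖ * a +
        (b * ‖z.2‖⁻¹ * (1 + ‖fderiv ℝ (ballTime r) z‖ * ‖z.2‖ + ballTime r z) +
          ballTime r z * (c * (1 + ‖z.2‖)))) + ballTime r z * a) ?_ ?_ ?_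
  · fun_prop
  · intro z hz θ hθ
    have hT := ballTime_pos hz
    have hs := one_le_arcsineDensity hθ
    have hs0 := arcsineDensity_nonneg θ
    have hv := norm_pos_iff.2 (mem_movingPhase.1 hz).2
    refine (abs_chordIntegrand_le hr H hz hθ).trans ?_
    have h2 : Real.exp (-(hardSphereNu z.2 * (θ * ballTime r z))) ≤ 1 :=
      Real.exp_le_one_iff.2 (by
        have := mul_pos (hardSphereNu_pos z.2) (mul_pos hθ.1 hT)
        linarith)
    have hg := gaussWeight_pos β z.2
    calc _ ≤ ballTime r z * 1 * (a * 1) := by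
          gcongr
          exact gaussWeight_le_one hβ z.2
      _ = ballTime r z * a * 1 := by ring
      _ ≤ ballTime r z * a * arcsineDensity θ := by gcongr
      _ ≤ _ := by
          gcongr
          simp only [le_add_iff_nonneg_left]
          positivity
  · intro z hz θ hθ
    have hT := ballTime_pos hz
    have hs0 := arcsineDensity_nonneg θ
    have hv := norm_pos_iff.2 (mem_movingPhase.1 hz).2
    refine ContinuousLinearMap.opNorm_le_bound _ (by positivity) fun ζ => ?_
    refine (abs_fderiv_chordIntegrand_crude_le hr hβ H hz hθ ζ).trans ?_
    refine mul_le_mul_of_nonneg_right (mul_le_mul_of_nonneg_right ?_ hs0) (norm_nonneg _)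
    linarith [mul_nonneg hT.le ha]

lemma opS_eventuallyEq (hr : 0 < r) (h : E3 × E3 → ℝ) {z : E3 × E3} (hz : z ∈ movingPhase r) :
    opS hardSphereNu (Metric.ball 0 r) h =ᶠ[𝓝 z]
      fun z => ∫ θ in Ioo (0 : ℝ) 1, chordIntegrand r h (z, θ) := by
  filter_upwards [(isOpen_movingPhase r).mem_nhds hz] with y hy using opS_ball hr hy h

lemma fderiv_opS (hr : 0 < r) (hβ : 0 ≤ β) (H : GainBound r β a b c h) {z : E3 × E3}
    (hz : z ∈ movingPhase r) (ζ : E3 × E3) :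
    fderiv ℝ (opS hardSphereNu (Metric.ball 0 r) h) z ζ =
      ∫ θ in Ioo (0 : ℝ) 1, fderiv ℝ (fun y => chordIntegrand r h (y, θ)) z ζ := by
  rw [(opS_eventuallyEq hr h hz).fderiv_eq]
  exact ((contDiffOn_integral_chordIntegrand hr hβ H).2 z hz).2 ζ

lemma abs_fderiv_opS_fst_le (hr : 0 < r) (hβ : 0 ≤ β) (H : GainBound r β a b c h) {z : E3 × E3}
    (hz : z ∈ movingPhase r) (ξ : E3) :
    |fderiv ℝ (opS hardSphereNu (Metric.ball 0 r) h) z (ξ, 0)| ≤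
      r / √(chordDiscr r z) * gaussWeight β z.2 * ‖ξ‖ * (a + 2 * b * arcsineMass) := by
  rw [fderiv_opS hr hβ H hz]
  have hi : IntegrableOn (fun θ => a + 2 * b * arcsineDensity θ) (Ioo 0 1) :=
    (integrableOn_const (by simp)).add (integrableOn_arcsineDensity.const_mul _)
  have h1 := norm_integral_le_of_norm_le (μ := volume.restrict (Ioo (0 : ℝ) 1))
    (f := fun θ => fderiv ℝ (fun y => chordIntegrand r h (y, θ)) z (ξ, 0))
    (hi.const_mul (r / √(chordDiscr r z) * gaussWeight β z.2 * ‖ξ‖)) (by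
      filter_upwards [ae_restrict_mem measurableSet_Ioo] with θ hθ
      exact abs_fderiv_chordIntegrand_fst_le hr H hz hθ ξ)
  rw [integral_const_mul, integral_add (integrable_const a)
    (integrableOn_arcsineDensity.const_mul _), integral_const_mul] at h1
  simpa [arcsineMass] using h1

lemma abs_fderiv_opS_snd_le (hr : 0 < r) (hβ : 0 ≤ β) (H : GainBound r β a b c h) {z : E3 × E3}
    (hz : z ∈ movingPhase r) (η : E3) :
    |fderiv ℝ (opS hardSphereNu (Metric.ball 0 r) h) z (0, η)| ≤
      gaussWeight β z.2 * ‖η‖ * ((r / √(chordDiscr r z) * (2 * a) +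
          2 / nuMin * ‖fderiv ℝ hardSphereNu z.2‖ * a + c * (1 + ‖z.2‖)) * (2 / nuMin) +
      2 * b / nuMin * (r / √(chordDiscr r z)) * arcsineMass) := by
  rw [fderiv_opS hr hβ H hz]
  obtain ⟨ha, hb, hc⟩ := gainBound_nonneg hr H
  have hν := nuMin_pos
  obtain ⟨i1, i2⟩ := integral_mul_exp_le (ballTime_pos hz) (half_pos hν)
  set M := r / √(chordDiscr r z) * (2 * a) +
          2 / nuMin * ‖fderiv ℝ hardSphereNu z.2‖ * a + c * (1 + ‖z.2‖)
  have hM : 0 ≤ M := by positivity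
  have h1 := norm_integral_le_of_norm_le (μ := volume.restrict (Ioo (0 : ℝ) 1))
    (f := fun θ => fderiv ℝ (fun y => chordIntegrand r h (y, θ)) z (0, η))
    (((i1.const_mul M).add (integrableOn_arcsineDensity.const_mul
      (2 * b / nuMin * (r / √(chordDiscr r z))))).const_mul (gaussWeight β z.2 * ‖η‖)) (by
      filter_upwards [ae_restrict_mem measurableSet_Ioo] with θ hθ
      exact abs_fderiv_chordIntegrand_snd_le hr H hz hθ η)
  rw [Real.norm_eq_abs] at h1
  refine h1.trans ?_
  have hg := gaussWeight_pos β z.2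
  simp only [Pi.add_apply]
  rw [integral_const_mul, integral_add (i1.const_mul M) (integrableOn_arcsineDensity.const_mul _),
    integral_const_mul M, integral_const_mul (2 * b / nuMin * (r / √(chordDiscr r z)))]
  rw [one_div_div] at i2
  unfold arcsineMass
  gcongr

/-- `S` maps the range class of `K` to its domain class. The first and the last constant are small
when the ball is small. -/
theorem opS_transportBound (hr : 0 < r) (hβ : 0 ≤ β) (H : GainBound r β a b c h) :
    TransportBound r β (2 * r * a) (a / nuMin) (r * (a + 2 * b * arcsineMass))
      (opS hardSphereNu (Metric.ball 0 r) h) := by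
  obtain ⟨ha, hb, hc⟩ := gainBound_nonneg hr H
  have hν := nuMin_pos
  have hM := arcsineMass_nonneg
  have key : ∀ z ∈ movingPhase r, |opS hardSphereNu (Metric.ball 0 r) h z| ≤ (a * gaussWeight β z.2) *
      ∫ θ in Ioo (0 : ℝ) 1, ballTime r z * Real.exp (-(nuMin * ballTime r z * θ)) := by
    intro z hz
    have hT := ballTime_pos hz
    have hg := gaussWeight_pos β z.2
    obtain ⟨i1, i2⟩ := integral_mul_exp_le hT hν
    rw [opS_ball hr hz, ← integral_const_mul, ← Real.norm_eq_abs]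
    refine norm_integral_le_of_norm_le (i1.const_mul _) ?_
    filter_upwards [ae_restrict_mem measurableSet_Ioo] with θ hθ
    refine (abs_chordIntegrand_le hr H hz hθ).trans ?_
    rw [mul_comm]
    have : nuMin * ballTime r z * θ ≤ hardSphereNu z.2 * (θ * ballTime r z) := by
      have := mul_le_mul_of_nonneg_right (nuMin_le z.2) (mul_pos hθ.1 hT).le
      linarith
    gcongr
  refine ⟨?_, fun z hz => ?_, fun z hz => ?_, fun z hz ξ => ?_⟩
  · exact (contDiffOn_integral_chordIntegrand hr hβ H).1.congr fun z hz => opS_ball hr hz h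
  · refine (key z hz).trans ?_
    have hT := ballTime_pos hz
    have hv := norm_pos_iff.2 (mem_movingPhase.1 hz).2
    have hg := gaussWeight_pos β z.2
    have e1 : ∫ θ in Ioo (0 : ℝ) 1, ballTime r z * Real.exp (-(nuMin * ballTime r z * θ)) ≤
        ballTime r z := by
      have := setIntegral_mono_on (integral_mul_exp_le hT hν).1
        (integrableOn_const (C := ballTime r z) (by simp)) measurableSet_Ioo (fun θ hθ => by
          refine mul_le_of_le_one_right hT.le (Real.exp_le_one_iff.2 ?_)
          have := mul_pos (mul_pos hν hT) hθ.1
          linarith)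
      simpa using this
    have e2 : ballTime r z ≤ 2 * r * ‖z.2‖⁻¹ := by
      rw [← div_eq_mul_inv, le_div_iff₀ hv]
      exact ballTime_mul_norm_le hr hz
    calc _ ≤ (a * gaussWeight β z.2) * (2 * r * ‖z.2‖⁻¹) := by gcongr; exact e1.trans e2
      _ = _ := by ring
  · refine (key z hz).trans ?_
    have hg := gaussWeight_pos β z.2
    calc _ ≤ (a * gaussWeight β z.2) * (1 / nuMin) := by
          gcongr; exact (integral_mul_exp_le (ballTime_pos hz) hν).2
      _ = _ := by ring
  · refine (abs_fderiv_opS_fst_le hr hβ H hz ξ).trans ?_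
    have hg := gaussWeight_pos β z.2
    have e := inv_sqrt_chordDiscr_le hz
    calc _ = r * (√(chordDiscr r z))⁻¹ * gaussWeight β z.2 * ‖ξ‖ * (a + 2 * b * arcsineMass) := by
          rw [div_eq_mul_inv]
      _ ≤ r * (‖z.2‖⁻¹ * boundaryWeight r z.1) * gaussWeight β z.2 * ‖ξ‖ *
          (a + 2 * b * arcsineMass) := by gcongr
      _ = _ := by ring

end OperatorS

/-! ### The transported boundary data -/

/-- Polynomial factors are absorbed by a Gaussian of larger rate. -/
lemma exists_poly_mul_gaussWeight_le {n : ℕ} (hn : n ≠ 0) {β γ : ℝ} (h : β < γ) :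
    ∃ C : ℝ, 0 < C ∧ ∀ v : E3, (1 + ‖v‖) ^ n * gaussWeight γ v ≤ C * gaussWeight β v := by
  have hκ : 0 < γ - β := sub_pos.2 h
  have hn0 : (0 : ℝ) < n := by positivity
  have hc : 0 < (γ - β) / n := by positivity
  refine ⟨(2 + 1 / ((γ - β) / n)) ^ n, by positivity, fun v => ?_⟩
  have e1 : (1 + ‖v‖) * Real.exp (-((γ - β) / n) * ‖v‖ ^ 2) ≤ 2 + 1 / ((γ - β) / n) := by
    have h1 := mul_exp_neg_le hc (‖v‖ ^ 2)
    have h2 : Real.exp (-((γ - β) / n) * ‖v‖ ^ 2) ≤ 1 :=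
      Real.exp_le_one_iff.2 (by nlinarith [sq_nonneg ‖v‖])
    have h3 : 1 + ‖v‖ ≤ 2 + ‖v‖ ^ 2 := by nlinarith [sq_nonneg (‖v‖ - 1)]
    have h4 := Real.exp_pos (-((γ - β) / n) * ‖v‖ ^ 2)
    calc _ ≤ (2 + ‖v‖ ^ 2) * Real.exp (-((γ - β) / n) * ‖v‖ ^ 2) := by gcongr
      _ ≤ _ := by linarith
  have e2 : gaussWeight γ v = Real.exp (-((γ - β) / n) * ‖v‖ ^ 2) ^ n * gaussWeight β v := by
    rw [gaussWeight, gaussWeight, ← Real.exp_nat_mul, ← Real.exp_add]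
    congr 1
    field_simp
    ring
  rw [e2, ← mul_assoc, ← mul_pow]
  have := gaussWeight_pos β v
  gcongr

section BoundaryData

variable {r : ℝ} {φ : E3 → ℝ}

lemma opJ_capData (hr : 0 < r) (φ : E3 → ℝ) {z : E3 × E3} (hz : z ∈ movingPhase r) :
    opJ hardSphereNu (Metric.ball 0 r) (capData φ) z =
      Real.exp (-(hardSphereNu z.2 * ballTime r z)) *
        (φ (ballExit r z) * gaussWeight (1 / 2) z.2) := by
  rw [opJ, exitTime_ball hr hz, exitPoint_ball hr hz, capData, gaussWeight]

lemma opJ_capData_eventuallyEq (hr : 0 < r) (φ : E3 → ℝ) {z : E3 × E3} (hz : z ∈ movingPhase r) :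
    opJ hardSphereNu (Metric.ball 0 r) (capData φ) =ᶠ[𝓝 z] fun z =>
      Real.exp (-(hardSphereNu z.2 * ballTime r z)) *
        (φ (ballExit r z) * gaussWeight (1 / 2) z.2) := by
  filter_upwards [(isOpen_movingPhase r).mem_nhds hz] with y hy using opJ_capData hr φ hy

lemma contDiffOn_opJ (hr : 0 < r) (hφ : ContDiff ℝ ∞ φ) :
    ContDiffOn ℝ 1 (opJ hardSphereNu (Metric.ball 0 r) (capData φ)) (movingPhase r) := by
  have hτ : ContDiffOn ℝ 1 (ballTime r) (movingPhase r) := (contDiffOn_ballTime r).of_le (by simp)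
  have hν : ContDiffOn ℝ 1 (fun y : E3 × E3 => hardSphereNu y.2) (movingPhase r) := fun y hy =>
    (ContDiffAt.comp (g := hardSphereNu) (f := fun y : E3 × E3 => y.2) y
      (contDiffAt_hardSphereNu (mem_movingPhase.1 hy).2) (by fun_prop)).contDiffWithinAt
  have hE : ContDiffOn ℝ 1 (ballExit r) (movingPhase r) :=
    contDiffOn_fst.sub (hτ.smul contDiffOn_snd)
  have hM : ContDiffOn ℝ 1 (fun y : E3 × E3 => gaussWeight (1 / 2) y.2) (movingPhase r) := by
    unfold gaussWeight
    exact (contDiffOn_const.mul (contDiff_snd.norm_sq ℝ).contDiffOn).exp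
  refine ContDiffOn.congr (ContDiffOn.mul (hν.mul hτ).neg.exp (ContDiffOn.mul
    ((hφ.of_le (by simp)).comp_contDiffOn hE) hM)) fun z hz => opJ_capData hr φ hz

lemma hasFDerivAt_ballExit {z : E3 × E3} (hz : z ∈ movingPhase r) : HasFDerivAt (ballExit r)
    (ContinuousLinearMap.fst ℝ E3 E3 - (ballTime r z • ContinuousLinearMap.snd ℝ E3 E3 +
      (fderiv ℝ (ballTime r) z).smulRight z.2)) z :=
  hasFDerivAt_fst.sub ((differentiableAt_ballTime hz).hasFDerivAt.smul hasFDerivAt_snd)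

/-- The derivatives of the attenuation, of `φ` at the exit point, and of the Maxwellian. -/
lemma fderiv_opJ (hr : 0 < r) (hφ : ContDiff ℝ ∞ φ) {z : E3 × E3} (hz : z ∈ movingPhase r)
    (ζ : E3 × E3) : fderiv ℝ (opJ hardSphereNu (Metric.ball 0 r) (capData φ)) z ζ =
      Real.exp (-(hardSphereNu z.2 * ballTime r z)) * gaussWeight (1 / 2) z.2 *
        (-(hardSphereNu z.2 * fderiv ℝ (ballTime r) z ζ +
            ballTime r z * fderiv ℝ hardSphereNu z.2 ζ.2) * φ (ballExit r z) +
          fderiv ℝ φ (ballExit r z)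
            (ζ.1 - (ballTime r z • ζ.2 + fderiv ℝ (ballTime r) z ζ • z.2)) -
          φ (ballExit r z) * ⟪z.2, ζ.2⟫) := by
  rw [(opJ_capData_eventuallyEq hr φ hz).fderiv_eq]
  have hτ := (differentiableAt_ballTime hz).hasFDerivAt
  have hν : HasFDerivAt (fun y : E3 × E3 => hardSphereNu y.2)
      ((fderiv ℝ hardSphereNu z.2).comp (ContinuousLinearMap.snd ℝ E3 E3)) z :=
    (differentiableAt_hardSphereNu (mem_movingPhase.1 hz).2).hasFDerivAt.comp z hasFDerivAt_snd
  have hφ' : HasFDerivAt (fun z => φ (ballExit r z)) _ z :=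
    ((hφ.differentiable (by simp)) (ballExit r z)).hasFDerivAt.comp z (hasFDerivAt_ballExit hz)
  have hM : HasFDerivAt (fun y : E3 × E3 => gaussWeight (1 / 2) y.2) _ z :=
    ((hasFDerivAt_snd (𝕜 := ℝ) (p := z)).norm_sq.const_mul (-(1 / 2))).exp
  have e1 : HasFDerivAt (fun z => Real.exp (-(hardSphereNu z.2 * ballTime r z)) *
        (φ (ballExit r z) * gaussWeight (1 / 2) z.2)) _ z :=
    ((hν.mul hτ).neg.exp).mul (hφ'.mul hM)
  rw [e1.fderiv]
  simp [gaussWeight]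
  ring

lemma one_le_mul_div_sqrt (hr : 0 < r) {z : E3 × E3} (hz : z ∈ movingPhase r) :
    1 ≤ r / √(chordDiscr r z) * ‖z.2‖ := by
  have hv := norm_pos_iff.2 (mem_movingPhase.1 hz).2
  have := inv_norm_le_div_sqrt hr hz
  calc 1 = ‖z.2‖⁻¹ * ‖z.2‖ := by field_simp
    _ ≤ _ := by gcongr

/-- The singularity of `∇ν` at `v = 0` is weaker than that at the grazing set, as `√D ≤ r |v|`. -/
lemma norm_fderiv_nu_le_div_sqrt (hr : 0 < r) {z : E3 × E3} (hz : z ∈ movingPhase r) :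
    ‖fderiv ℝ hardSphereNu z.2‖ ≤ 2 * (r / √(chordDiscr r z)) * (1 + ‖z.2‖) ^ 2 := by
  have hv := norm_pos_iff.2 (mem_movingPhase.1 hz).2
  have h1 := inv_norm_le_div_sqrt hr hz
  have h2 := one_le_mul_div_sqrt hr hz
  refine (norm_fderiv_hardSphereNu_le (mem_movingPhase.1 hz).2).trans ?_
  have h3 : 0 < r / √(chordDiscr r z) := div_pos hr (Real.sqrt_pos.2 (chordDiscr_pos hz))
  set R := r / √(chordDiscr r z)
  have h4 : ‖z.2‖ ≤ R * ‖z.2‖ * ‖z.2‖ := by nlinarith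
  nlinarith [mul_pos h3 hv]

/-- The collection of the terms in the gradient of the transported data: `E`, `T`, `t` stand for
the attenuation, the exit time and its derivative, `n` for the gradient of the frequency. -/
lemma transport_gradient_arith {E M ν t T n L V m R i C₁ g : ℝ} (hE : 0 < E) (hM : 0 < M)
    (hV : 0 < V) (hm : 0 ≤ m) (hR : 0 < R) (hi : 0 < i) (hL : 0 ≤ L)
    (hn0 : 0 ≤ n) (hE1 : E ≤ 1) (hET : E * T ≤ i) (hν : ν ≤ 2 * (1 + V ^ 2))
    (ht : E * |t| ≤ R * (1 + i) * m) (hn : n ≤ 2 * R * (1 + V) ^ 2) (hR1 : 1 ≤ R * V)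
    (hp : (1 + V) ^ 3 * M ≤ C₁ * g) :
    E * M * (ν * |t| + T * (n * m) + L * (m + (T * m + |t| * V)) + V * m) ≤
      (2 * (1 + 2 * i) + (2 + 2 * i) * L + 1) * C₁ * R * g * m := by
  set P := (1 + V) ^ 3 with hP
  have hP0 : 0 < P := by positivity
  have hP2 : 1 + V ^ 2 ≤ P := by rw [hP]; nlinarith [pow_pos hV 2, pow_pos hV 3]
  have hP3 : (1 + V) ^ 2 ≤ P := pow_le_pow_right₀ (by linarith) (by norm_num)
  have hP4 : V ≤ P := by rw [hP]; nlinarith [pow_pos hV 2, pow_pos hV 3]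
  have hP5 : V * V ≤ P := by rw [hP]; nlinarith [pow_pos hV 2, pow_pos hV 3]
  have hR1P : 1 ≤ R * P := hR1.trans (by gcongr)
  have hVP : V ≤ R * P := by
    calc V ≤ (R * V) * V := by nlinarith
      _ = R * (V * V) := by ring
      _ ≤ _ := by gcongr
  have hmP : m ≤ R * P * m := by nlinarith
  have e1 : ν * (E * |t|) ≤ (2 * P) * (R * (1 + i) * m) :=
    mul_le_mul (hν.trans (by linarith)) ht (by positivity) (by positivity)
  have e2 : (E * T) * (n * m) ≤ i * ((2 * R * P) * m) := by
    have : n ≤ 2 * R * P := hn.trans (by gcongr)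
    gcongr
  have e3 : E * m ≤ R * P * m := (mul_le_of_le_one_left hm hE1).trans hmP
  have e4 : (E * T) * m ≤ i * (R * P * m) := mul_le_mul hET hmP hm hi.le
  have e5 : (E * |t|) * V ≤ (R * (1 + i) * m) * P := mul_le_mul ht hP4 hV.le (by positivity)
  have e6 : E * (V * m) ≤ R * P * m :=
    (mul_le_of_le_one_left (by positivity) hE1).trans (by gcongr)
  have e7 : L * (E * m + ((E * T) * m + (E * |t|) * V)) ≤
      L * (R * P * m + (i * (R * P * m) + (R * (1 + i) * m) * P)) := by gcongr
  calc _ = M * (ν * (E * |t|) + (E * T) * (n * m) +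
          L * (E * m + ((E * T) * m + (E * |t|) * V)) + E * (V * m)) := by ring
    _ ≤ M * ((2 * P) * (R * (1 + i) * m) + i * ((2 * R * P) * m) +
          L * (R * P * m + (i * (R * P * m) + (R * (1 + i) * m) * P)) + R * P * m) := by gcongr
    _ = (2 * (1 + 2 * i) + (2 + 2 * i) * L + 1) * R * m * (P * M) := by ring
    _ ≤ (2 * (1 + 2 * i) + (2 + 2 * i) * L + 1) * R * m * (C₁ * g) := by gcongr
    _ = _ := by ring

/-- Both partial derivatives of the transported data are of the order of the reciprocal of the
chord length. -/
lemma exists_fderiv_opJ_bound (hr : 0 < r) (hφ : ContDiff ℝ ∞ φ)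
    (hφ1 : ∀ x ∈ Metric.sphere (0 : E3) r, |φ x| ≤ 1) {β : ℝ} (hβ : β < 1 / 2) :
    ∃ C : ℝ, 0 < C ∧ ∀ z ∈ movingPhase r,
      (∀ ξ, |fderiv ℝ (opJ hardSphereNu (Metric.ball 0 r) (capData φ)) z (ξ, 0)| ≤
        C * (r / √(chordDiscr r z)) * gaussWeight β z.2 * ‖ξ‖) ∧
      (∀ η, |fderiv ℝ (opJ hardSphereNu (Metric.ball 0 r) (capData φ)) z (0, η)| ≤
        C * (r / √(chordDiscr r z)) * gaussWeight β z.2 * ‖η‖) := by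
  obtain ⟨L, hL⟩ : ∃ L, ∀ x ∈ Metric.sphere (0 : E3) r, ‖fderiv ℝ φ x‖ ≤ L :=
    (isCompact_sphere (0 : E3) r).exists_bound_of_continuousOn
      (hφ.continuous_fderiv (by simp)).continuousOn
  obtain ⟨C₁, hC₁, hpoly⟩ := exists_poly_mul_gaussWeight_le (n := 3) (by norm_num) hβ
  have hν0 := nuMin_pos
  refine ⟨(2 * (1 + 2 * (1 / nuMin)) + (2 + 2 * (1 / nuMin)) * |L| + 1) * C₁,
    by positivity, fun z hz => ?_⟩
  have hq : ballExit r z ∈ Metric.sphere (0 : E3) r := mem_sphere_zero_iff_norm.2 (norm_ballExit hr hz)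
  have hφq := hφ1 _ hq
  have hLq : ‖fderiv ℝ φ (ballExit r z)‖ ≤ |L| := (hL _ hq).trans (le_abs_self L)
  have hT := ballTime_pos hz
  have hv := norm_pos_iff.2 (mem_movingPhase.1 hz).2
  have hR0 : 0 < r / √(chordDiscr r z) := div_pos hr (Real.sqrt_pos.2 (chordDiscr_pos hz))
  have hR1 := one_le_mul_div_sqrt hr hz
  have hn := norm_fderiv_nu_le_div_sqrt hr hz
  have hνu := hardSphereNu_le z.2
  have hνp := hardSphereNu_pos z.2
  have hνm := nuMin_le z.2
  have htau := abs_fderiv_ballTime_le hr hz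
  have hp := hpoly z.2
  have hM := gaussWeight_pos (1 / 2) z.2
  have hg := gaussWeight_pos β z.2
  have habs := fun ζ => fderiv_opJ hr hφ hz ζ
  set T := ballTime r z
  set R := r / √(chordDiscr r z) with hR
  set V := ‖z.2‖
  set ν := hardSphereNu z.2
  set n := ‖fderiv ℝ hardSphereNu z.2‖
  set E := Real.exp (-(ν * T))
  have hE : 0 < E := Real.exp_pos _
  have hE1 : E ≤ 1 := Real.exp_le_one_iff.2 (by have := mul_pos hνp hT; linarith)
  have hET : E * T ≤ 1 / nuMin := by
    have h1 := mul_exp_neg_le hν0 T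
    have h2 : E ≤ Real.exp (-nuMin * T) := Real.exp_le_exp.2 (by
      have := mul_le_mul_of_nonneg_right hνm hT.le; linarith)
    calc _ ≤ Real.exp (-nuMin * T) * T := by gcongr
      _ ≤ _ := by linarith
  have hL0 := abs_nonneg L
  have hnn : 0 ≤ n := norm_nonneg _
  -- the common estimate in terms of a bound of the derivative of the exit time
  have hgen : ∀ (ζ : E3 × E3) (m : ℝ), 0 ≤ m → ‖ζ.1‖ ≤ m → ‖ζ.2‖ ≤ m →
      E * |fderiv ℝ (ballTime r) z ζ| ≤ R * (1 + 1 / nuMin) * m →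
      |fderiv ℝ (opJ hardSphereNu (Metric.ball 0 r) (capData φ)) z ζ| ≤
      (2 * (1 + 2 * (1 / nuMin)) + (2 + 2 * (1 / nuMin)) * |L| + 1) * C₁ * R * gaussWeight β z.2 * m := by
    intro ζ m hm h1 h2 ht
    rw [habs ζ, abs_mul, abs_of_pos (mul_pos hE hM)]
    set t := fderiv ℝ (ballTime r) z ζ
    have b1 : |(-(ν * t + T * fderiv ℝ hardSphereNu z.2 ζ.2) * φ (ballExit r z))| ≤
        ν * |t| + T * (n * m) := by
      rw [abs_mul, abs_neg]
      refine (mul_le_of_le_one_right (abs_nonneg _) hφq).trans ((abs_add_le _ _).trans ?_)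
      rw [abs_mul, abs_mul, abs_of_pos hνp, abs_of_pos hT]
      gcongr
      exact ((fderiv ℝ hardSphereNu z.2).le_opNorm ζ.2).trans (by gcongr)
    have b2 : |fderiv ℝ φ (ballExit r z) (ζ.1 - (T • ζ.2 + t • z.2))| ≤
        |L| * (m + (T * m + |t| * V)) := by
      refine ((fderiv ℝ φ (ballExit r z)).le_opNorm _).trans ?_
      gcongr
      refine (norm_sub_le _ _).trans (add_le_add h1 ((norm_add_le _ _).trans ?_))
      rw [norm_smul, norm_smul, Real.norm_of_nonneg hT.le, Real.norm_eq_abs]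
      gcongr
    have b3 : |φ (ballExit r z) * ⟪z.2, ζ.2⟫| ≤ V * m := by
      rw [abs_mul]
      refine (mul_le_of_le_one_left (abs_nonneg _) hφq).trans ?_
      refine (abs_real_inner_le_norm _ _).trans ?_
      gcongr
    have b4 := (abs_sub _ _).trans (add_le_add ((abs_add_le _ _).trans (add_le_add b1 b2)) b3)
    have hi : 0 < 1 / nuMin := by positivity
    refine (mul_le_mul_of_nonneg_left b4 (mul_pos hE hM).le).trans ?_
    exact transport_gradient_arith hE hM hv hm hR0 hi hL0 hnn hE1 hET hνu ht hn hR1 hp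
  constructor
  · intro ξ
    refine hgen (ξ, 0) ‖ξ‖ (norm_nonneg _) le_rfl (by simp) ?_
    have h1 := htau (ξ, 0)
    simp only [norm_zero, mul_zero, add_zero] at h1
    have h2 : |fderiv ℝ (ballTime r) z (ξ, 0)| ≤ R * ‖ξ‖ := h1.trans_eq (by rw [hR]; ring)
    have hi : 0 < 1 / nuMin := by positivity
    calc _ ≤ 1 * (R * ‖ξ‖) := by gcongr
      _ = R * 1 * ‖ξ‖ := by ring
      _ ≤ _ := by gcongr; linarith
  · intro η
    refine hgen (0, η) ‖η‖ (norm_nonneg _) (by simp) le_rfl ?_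
    have h1 := htau (0, η)
    simp only [norm_zero, zero_add] at h1
    have h2 : |fderiv ℝ (ballTime r) z (0, η)| ≤ R * (T * ‖η‖) := h1.trans_eq (by rw [hR]; ring)
    calc _ ≤ E * (R * (T * ‖η‖)) := by gcongr
      _ = R * (E * T) * ‖η‖ := by ring
      _ ≤ _ := by gcongr; linarith

/-- The transported data belong to the domain class of `K`. Only the constant of the gradient bound
depends on the boundary data. -/
theorem exists_opJ_transportBound {β : ℝ} (hβ : β < 1 / 2) :
    ∃ C : ℝ, 0 < C ∧ ∀ (r : ℝ) (φ : E3 → ℝ), 0 < r → ContDiff ℝ ∞ φ →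
      (∀ x ∈ Metric.sphere (0 : E3) r, |φ x| ≤ 1) → ∃ b : ℝ, 0 ≤ b ∧
        TransportBound r β C 1 b (opJ hardSphereNu (Metric.ball 0 r) (capData φ)) := by
  obtain ⟨C₁, hC₁, hpoly⟩ := exists_poly_mul_gaussWeight_le (n := 1) (by norm_num) hβ
  refine ⟨C₁, hC₁, fun r φ hr hφ hφ1 => ?_⟩
  obtain ⟨C, hC, hd⟩ := exists_fderiv_opJ_bound hr hφ hφ1 hβ
  have hval : ∀ z ∈ movingPhase r, |opJ hardSphereNu (Metric.ball 0 r) (capData φ) z| ≤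
      gaussWeight (1 / 2) z.2 := by
    intro z hz
    have hM := gaussWeight_pos (1 / 2) z.2
    rw [opJ_capData hr φ hz, abs_mul, abs_mul, abs_of_pos (Real.exp_pos _), abs_of_pos hM]
    have h1 : Real.exp (-(hardSphereNu z.2 * ballTime r z)) ≤ 1 := Real.exp_le_one_iff.2 (by
      have := mul_pos (hardSphereNu_pos z.2) (ballTime_pos hz); linarith)
    calc _ ≤ 1 * (1 * gaussWeight (1 / 2) z.2) := by
          gcongr
          exact hφ1 _ (mem_sphere_zero_iff_norm.2 (norm_ballExit hr hz))
      _ = _ := by ring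
  refine ⟨C * r, by positivity, contDiffOn_opJ hr hφ, fun z hz => ?_, fun z hz => ?_,
    fun z hz ξ => ?_⟩
  · refine (hval z hz).trans ?_
    have hv := norm_pos_iff.2 (mem_movingPhase.1 hz).2
    have h := hpoly z.2
    have hM := gaussWeight_pos (1 / 2) z.2
    rw [mul_right_comm, ← div_eq_mul_inv, le_div_iff₀ hv]
    nlinarith
  · refine (hval z hz).trans ?_
    rw [one_mul]
    exact Real.exp_le_exp.2 (by nlinarith [sq_nonneg ‖z.2‖])
  · refine ((hd z hz).1 ξ).trans ?_
    have hg := gaussWeight_pos β z.2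
    have e := inv_sqrt_chordDiscr_le hz
    calc _ = C * (r * (√(chordDiscr r z))⁻¹) * gaussWeight β z.2 * ‖ξ‖ := by rw [div_eq_mul_inv]
      _ ≤ C * (r * (‖z.2‖⁻¹ * boundaryWeight r z.1)) * gaussWeight β z.2 * ‖ξ‖ := by gcongr
      _ = _ := by ring

end BoundaryData

/-! ### The fixed point equation -/

section FixedPoint

variable {r β a b c : ℝ}

lemma GainBound.mono {a' b' c' : ℝ} {h : E3 × E3 → ℝ} (H : GainBound r β a b c h)
    (ha : a ≤ a') (hb : b ≤ b') (hc : c ≤ c') : GainBound r β a' b' c' h := by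
  refine ⟨H.contDiffOn, fun z hz => (H.bound z hz).trans ?_,
    fun z hz ξ => (H.bound_fst z hz ξ).trans ?_, fun z hz η => (H.bound_snd z hz η).trans ?_⟩
  · have := gaussWeight_pos β z.2
    gcongr
  · have := gaussWeight_pos β z.2
    have := boundaryWeight_pos (mem_phaseSpace.1 hz)
    gcongr
  · have := gaussWeight_pos β z.2
    gcongr

lemma GainBound.norm_fderiv_le {h : E3 × E3 → ℝ} (H : GainBound r β a b c h) {z : E3 × E3}
    (hz : z ∈ phaseSpace r) : ‖fderiv ℝ h z‖ ≤
      b * boundaryWeight r z.1 * gaussWeight β z.2 + c * (1 + ‖z.2‖) * gaussWeight β z.2 := by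
  have h1 : ∀ ξ : E3, 0 ≤ b * boundaryWeight r z.1 * gaussWeight β z.2 * ‖ξ‖ := fun ξ =>
    (abs_nonneg _).trans (H.bound_fst z hz ξ)
  have h2 : ∀ ξ : E3, 0 ≤ c * (1 + ‖z.2‖) * gaussWeight β z.2 * ‖ξ‖ := fun ξ =>
    (abs_nonneg _).trans (H.bound_snd z hz ξ)
  have hb : ‖(basisVec 0 : E3)‖ = 1 := by simp [basisVec]
  have h1' := h1 (basisVec 0)
  have h2' := h2 (basisVec 0)
  rw [hb, mul_one] at h1' h2'
  refine ContinuousLinearMap.opNorm_le_bound _ (add_nonneg h1' h2') fun ζ => ?_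
  have e : ζ = (ζ.1, 0) + (0, ζ.2) := by simp
  rw [e, map_add, ← e, add_mul]
  refine (norm_add_le _ _).trans (add_le_add ((H.bound_fst z hz _).trans ?_)
    ((H.bound_snd z hz _).trans ?_))
  · exact mul_le_mul_of_nonneg_left (norm_fst_le ζ) h1'
  · exact mul_le_mul_of_nonneg_left (norm_snd_le ζ) h2'

lemma hasSum_half (a : ℝ) : HasSum (fun n : ℕ => a * (1 / 2) ^ n) (2 * a) := by
  rw [mul_comm 2 a]
  exact (hasSum_geometric_two).mul_left a

variable {H : ℕ → E3 × E3 → ℝ}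

lemma summable_of_gainBound
    (hH : ∀ n, GainBound r β (a * (1 / 2) ^ n) (b * (1 / 2) ^ n) (c * (1 / 2) ^ n) (H n))
    {z : E3 × E3} (hz : z ∈ phaseSpace r) : Summable fun n => H n z := by
  refine Summable.of_norm_bounded ((hasSum_half a).summable.mul_right (gaussWeight β z.2))
    fun n => ?_
  exact (hH n).bound z hz

/-- Geometric series in the range class of `K` converge in this class. -/
theorem gainBound_tsum (hβ : 0 ≤ β)
    (hH : ∀ n, GainBound r β (a * (1 / 2) ^ n) (b * (1 / 2) ^ n) (c * (1 / 2) ^ n) (H n)) :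
    GainBound r β (2 * a) (2 * b) (2 * c) fun z => ∑' n, H n z := by
  have hnn : ∀ z ∈ phaseSpace r, 0 ≤ b ∧ 0 ≤ c := by
    intro z hz
    have hb : ‖(basisVec 0 : E3)‖ = 1 := by simp [basisVec]
    have h1 := (abs_nonneg _).trans ((hH 0).bound_fst z hz (basisVec 0))
    have h2 := (abs_nonneg _).trans ((hH 0).bound_snd z hz (basisVec 0))
    have hg := gaussWeight_pos β z.2
    have hw := boundaryWeight_pos (mem_phaseSpace.1 hz)
    have hv : 0 < 1 + ‖z.2‖ := by positivity
    simp only [pow_zero, mul_one, hb] at h1 h2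
    exact ⟨nonneg_of_mul_nonneg_left (nonneg_of_mul_nonneg_left h1 hg) hw,
      nonneg_of_mul_nonneg_left (nonneg_of_mul_nonneg_left h2 hg) hv⟩
  -- On small balls the derivatives are dominated by a geometric series.
  have hloc : ∀ z₀ ∈ phaseSpace r, ∃ ε > 0, ∃ m : ℝ, ∀ z ∈ Metric.ball z₀ ε, z ∈ phaseSpace r ∧
      ∀ n, ‖fderiv ℝ (H n) z‖ ≤ m * (1 / 2) ^ n := by
    intro z₀ hz₀
    obtain ⟨hb, hc⟩ := hnn z₀ hz₀
    have e1 := (continuousAt_fst (p := z₀)).eventually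
      (eventually_boundaryWeight_lt (mem_phaseSpace.1 hz₀))
    have e2 : ∀ᶠ y : E3 × E3 in 𝓝 z₀, ‖y.2‖ < ‖z₀.2‖ + 1 :=
      continuousAt_snd.norm.eventually_lt_const (by simp)
    obtain ⟨ε, hε, hs⟩ := Metric.eventually_nhds_iff_ball.1 (e1.and e2)
    refine ⟨ε, hε, b * (boundaryWeight r z₀.1 + 1) * 1 + c * (1 + (‖z₀.2‖ + 1)) * 1,
      fun z hz => ?_⟩
    obtain ⟨⟨h1, h2⟩, h3⟩ := hs z hz
    have hz' : z ∈ phaseSpace r := mem_phaseSpace.2 h1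
    refine ⟨hz', fun n => ((hH n).norm_fderiv_le hz').trans ?_⟩
    have hg := gaussWeight_pos β z.2
    have hg1 := gaussWeight_le_one hβ z.2
    have hw := boundaryWeight_pos h1
    have hw₀ := boundaryWeight_pos (mem_phaseSpace.1 hz₀)
    rw [add_mul]
    refine add_le_add ?_ ?_
    · calc _ = b * boundaryWeight r z.1 * gaussWeight β z.2 * (1 / 2) ^ n := by ring
        _ ≤ _ := by gcongr
    · calc _ = c * (1 + ‖z.2‖) * gaussWeight β z.2 * (1 / 2) ^ n := by ring
        _ ≤ _ := by gcongr
  have hder : ∀ z ∈ phaseSpace r,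
      HasFDerivAt (fun z => ∑' n, H n z) (∑' n, fderiv ℝ (H n) z) z ∧
      Summable (fun n => fderiv ℝ (H n) z) ∧
      ContinuousAt (fun z => ∑' n, fderiv ℝ (H n) z) z := by
    intro z₀ hz₀
    obtain ⟨ε, hε, m, hs⟩ := hloc z₀ hz₀
    have hm := (hasSum_half m).summable
    refine ⟨?_, Summable.of_norm_bounded hm fun n => (hs z₀ (Metric.mem_ball_self hε)).2 n, ?_⟩
    · refine hasFDerivAt_tsum_of_isPreconnected hm Metric.isOpen_ball
        (convex_ball z₀ ε).isPreconnected (fun n z hz => ?_) (fun n z hz => (hs z hz).2 n)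
        (Metric.mem_ball_self hε) (summable_of_gainBound hH hz₀) (Metric.mem_ball_self hε)
      exact (((hH n).contDiffOn.differentiableOn (by simp)).differentiableAt
        ((isOpen_phaseSpace r).mem_nhds (hs z hz).1)).hasFDerivAt
    · refine (continuousOn_tsum (s := Metric.ball z₀ ε) (fun n => ?_) hm
        (fun n z hz => (hs z hz).2 n)).continuousAt (Metric.ball_mem_nhds z₀ hε)
      exact ((hH n).contDiffOn.continuousOn_fderiv_of_isOpen (isOpen_phaseSpace r)
        le_rfl).mono fun z hz => (hs z hz).1
  have hfd : ∀ z ∈ phaseSpace r, fderiv ℝ (fun z => ∑' n, H n z) z = ∑' n, fderiv ℝ (H n) z :=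
    fun z hz => (hder z hz).1.fderiv
  have hap : ∀ z ∈ phaseSpace r, ∀ ζ, HasSum (fun n => fderiv ℝ (H n) z ζ)
      (fderiv ℝ (fun z => ∑' n, H n z) z ζ) := by
    intro z hz ζ
    rw [hfd z hz]
    exact (hder z hz).2.1.hasSum.mapL (ContinuousLinearMap.apply ℝ ℝ ζ)
  refine ⟨?_, fun z hz => ?_, fun z hz ξ => ?_, fun z hz η => ?_⟩
  · rw [show (1 : WithTop ℕ∞) = 0 + 1 by simp,
      contDiffOn_succ_iff_fderiv_of_isOpen (isOpen_phaseSpace r)]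
    refine ⟨fun z hz => (hder z hz).1.differentiableAt.differentiableWithinAt, by simp, ?_⟩
    rw [contDiffOn_zero]
    intro z hz
    refine ((hder z hz).2.2.congr ?_).continuousWithinAt
    filter_upwards [(isOpen_phaseSpace r).mem_nhds hz] with y hy using (hfd y hy).symm
  · exact tsum_of_norm_bounded (f := fun n => H n z)
      ((hasSum_half a).mul_right (gaussWeight β z.2)) fun n => (hH n).bound z hz
  · rw [← (hap z hz (ξ, 0)).tsum_eq]
    have := tsum_of_norm_bounded (f := fun n => fderiv ℝ (H n) z (ξ, 0))
      ((hasSum_half b).mul_right (boundaryWeight r z.1 * gaussWeight β z.2 * ‖ξ‖))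
      (fun n => ((hH n).bound_fst z hz ξ).trans_eq (by ring))
    exact this.trans_eq (by ring)
  · rw [← (hap z hz (0, η)).tsum_eq]
    have := tsum_of_norm_bounded (f := fun n => fderiv ℝ (H n) z (0, η))
      ((hasSum_half c).mul_right ((1 + ‖z.2‖) * gaussWeight β z.2 * ‖η‖))
      (fun n => ((hH n).bound_snd z hz η).trans_eq (by ring))
    exact this.trans_eq (by ring)

lemma aestronglyMeasurable_chordIntegrand (hr : 0 < r) {h : E3 × E3 → ℝ}
    (hh : ContDiffOn ℝ 1 h (phaseSpace r)) {z : E3 × E3} (hz : z ∈ movingPhase r) :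
    AEStronglyMeasurable (fun θ => chordIntegrand r h (z, θ)) (volume.restrict (Ioo (0 : ℝ) 1)) := by
  refine ContinuousOn.aestronglyMeasurable ?_ measurableSet_Ioo
  exact (contDiffOn_chordIntegrand hr hh).continuousOn.comp (by fun_prop)
    (fun θ hθ => ⟨hz, hθ⟩)

/-- `S` commutes with geometric series in the range class of `K`. -/
lemma hasSum_opS (hr : 0 < r)
    (hH : ∀ n, GainBound r β (a * (1 / 2) ^ n) (b * (1 / 2) ^ n) (c * (1 / 2) ^ n) (H n))
    {z : E3 × E3} (hz : z ∈ movingPhase r) :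
    HasSum (fun n => opS hardSphereNu (Metric.ball 0 r) (H n) z)
      (opS hardSphereNu (Metric.ball 0 r) (fun z => ∑' n, H n z) z) := by
  simp only [opS_ball hr hz]
  have hT := ballTime_pos hz
  have hg := gaussWeight_pos β z.2
  have hsum := (((hasSum_half a).mul_right (gaussWeight β z.2)).mul_left (ballTime r z))
  refine hasSum_integral_of_dominated_convergence
    (fun n _ => ballTime r z * (a * (1 / 2) ^ n * gaussWeight β z.2))
    (fun n => aestronglyMeasurable_chordIntegrand hr (hH n).contDiffOn hz) (fun n => ?_)
    (Eventually.of_forall fun θ => hsum.summable) (integrable_const _) ?_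
  · filter_upwards [ae_restrict_mem measurableSet_Ioo] with θ hθ
    refine (abs_chordIntegrand_le hr (hH n) hz hθ).trans ?_
    have h1 : Real.exp (-(hardSphereNu z.2 * (θ * ballTime r z))) ≤ 1 := Real.exp_le_one_iff.2 (by
      have := mul_pos (hardSphereNu_pos z.2) (mul_pos hθ.1 hT); linarith)
    have h2 := (abs_nonneg _).trans ((hH n).bound (chordPoint r z θ) (chordPoint_mem hr hz hθ))
    exact mul_le_mul_of_nonneg_right (mul_le_of_le_one_right hT.le h1) h2
  · filter_upwards [ae_restrict_mem measurableSet_Ioo] with θ hθ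
    exact (summable_of_gainBound hH (chordPoint_mem hr hz hθ)).hasSum.mul_left _

/-- `K` does not see velocities zero. -/
lemma opK_congr {f g : E3 × E3 → ℝ} (h : ∀ z ∈ movingPhase r, f z = g z) {z : E3 × E3}
    (hz : z ∈ phaseSpace r) : opK hardSphereK f z = opK hardSphereK g z := by
  refine integral_congr_ae ?_
  filter_upwards [ae_ne_point 0] with w hw
  rw [h (z.1, w) (mem_movingPhase.2 ⟨mem_phaseSpace.1 hz, hw⟩)]

/-- `K` commutes with geometric series that converge with the weight `|v|⁻¹`. -/
lemma hasSum_opK (hβ0 : 0 ≤ β) (hβ1 : β < 1 / 2) (ha : 0 ≤ a) {a' b' : ℕ → ℝ}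
    {F : ℕ → E3 × E3 → ℝ} (hF : ∀ n, TransportBound r β (a * (1 / 2) ^ n) (a' n) (b' n) (F n))
    {z : E3 × E3} (hz : z ∈ phaseSpace r) :
    HasSum (fun n => opK hardSphereK (F n) z) (opK hardSphereK (fun z => ∑' n, F n z) z) := by
  obtain ⟨C, hC, hk, -⟩ := exists_kernel_majorant hβ0 hβ1
  obtain ⟨C', hC', hs⟩ := exists_singularMajorant_bound (kernelRate_pos hβ1)
  have hmem : ∀ w : E3, w ≠ 0 → (z.1, w) ∈ movingPhase r := fun w hw =>
    mem_movingPhase.2 ⟨mem_phaseSpace.1 hz, hw⟩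
  have hsum : ∀ w, HasSum (fun n : ℕ => C * (a * (1 / 2) ^ n) * gaussWeight β z.2 *
      singularMajorant (kernelRate β) z.2 w)
      (C * (2 * a) * gaussWeight β z.2 * singularMajorant (kernelRate β) z.2 w) := fun w =>
    (((hasSum_half a).mul_left C).mul_right _).mul_right _
  refine hasSum_integral_of_dominated_convergence
    (fun n w => C * (a * (1 / 2) ^ n) * gaussWeight β z.2 *
      singularMajorant (kernelRate β) z.2 w) (fun n => ?_) (fun n => ?_)
    (Eventually.of_forall fun w => (hsum w).summable) ?_ ?_
  · refine aestronglyMeasurable_of_continuousAt_off (v := z.2) fun w h0 h1 => ?_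
    have e1 : ContinuousAt (fun w => hardSphereK z.2 w) w :=
      ContinuousAt.comp (g := fun y : E3 × E3 => hardSphereK y.1 y.2) (f := fun w => (z.2, w))
        (contDiffAt_hardSphereK h1).continuousAt (by fun_prop)
    have e2 : ContinuousAt (fun w => F n (z.1, w)) w :=
      ContinuousAt.comp (g := F n) (f := fun w => (z.1, w))
        ((hF n).contDiffOn.continuousOn.continuousAt ((isOpen_movingPhase r).mem_nhds (hmem w h0)))
        (by fun_prop)
    exact e1.mul e2
  · filter_upwards [ae_ne_point 0, ae_ne_point z.2] with w h0 h1
    rw [norm_mul, Real.norm_eq_abs]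
    exact hk z.2 w h0 h1 _ _ (by positivity) ((hF n).bound_inv _ (hmem w h0))
  · simp only [(hsum _).tsum_eq]
    exact (hs z.2).1.const_mul _
  · filter_upwards [ae_ne_point 0] with w h0
    refine Summable.hasSum ?_ |>.mul_left _
    refine Summable.of_norm_bounded
      (((hasSum_half a).mul_right ‖w‖⁻¹).mul_right (gaussWeight β w)).summable fun n => ?_
    exact (hF n).bound_inv _ (hmem w h0)

/-- Existence of a solution in small balls. The constants `C` and `r₁` do not depend on the boundary
data, and `K f` differs from its contribution by the data only by a multiple of the radius. -/
theorem exists_gain_fixedPoint (hβ0 : 0 ≤ β) (hβ1 : β < 1 / 2) : ∃ C > 0, ∃ r₁ > 0,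
    ∀ (r : ℝ) (φ : E3 → ℝ), 0 < r → r < r₁ → ContDiff ℝ ∞ φ →
      (∀ x ∈ Metric.sphere (0 : E3) r, |φ x| ≤ 1) → ∃ (h : E3 × E3 → ℝ) (b c : ℝ),
        GainBound r β C b c h ∧
        (∀ z ∈ phaseSpace r,
          (Integrable fun w => hardSphereK z.2 w *
            (opJ hardSphereNu (Metric.ball 0 r) (capData φ) (z.1, w) +
              opS hardSphereNu (Metric.ball 0 r) h (z.1, w))) ∧
          h z = opK hardSphereK (fun z => opJ hardSphereNu (Metric.ball 0 r) (capData φ) z +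
            opS hardSphereNu (Metric.ball 0 r) h z) z ∧
          |h z - opK hardSphereK (opJ hardSphereNu (Metric.ball 0 r) (capData φ)) z| ≤ C * r) := by
  obtain ⟨CK, hCK, hK⟩ := exists_opK_gainBound hβ0 hβ1
  obtain ⟨CJ, hCJ, hJ⟩ := exists_opJ_transportBound hβ1
  have hA := arcsineMass_nonneg
  have hν := nuMin_pos
  set A := arcsineMass
  refine ⟨max (2 * (CK * CJ)) (CK * (2 * (2 * (CK * CJ)))), by positivity,
    (2 * (CK * (2 + 2 * A)))⁻¹, by positivity, fun r φ hr hr1 hφ hφ1 => ?_⟩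
  have hsmall : CK * r * (2 + 2 * A) ≤ 1 / 2 := by
    rw [lt_inv_comm₀ hr (by positivity), ← one_div, lt_div_iff₀ hr] at hr1
    nlinarith
  obtain ⟨b₀, hb₀, hJg⟩ := hJ r φ hr hφ hφ1
  set Jg := opJ hardSphereNu (Metric.ball 0 r) (capData φ)
  obtain ⟨hG0, hI0⟩ := hK r Jg CJ 1 b₀ hCJ.le zero_le_one hb₀ hJg
  -- `K S` halves all three constants. The third one is not small with `r`, but it is controlled by
  -- the first one of the previous term, whence the choice of `c`.
  set a := CK * CJ with ha
  set b := max (CK * b₀) a with hb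
  set c := max (CK * 1) (2 * (CK * (a / nuMin))) with hc
  have ha0 : 0 < a := by positivity
  have hb0 : 0 < b := lt_max_of_lt_right ha0
  have hab : a ≤ b := le_max_right _ _
  set H : ℕ → E3 × E3 → ℝ := fun n =>
    (fun h => opK hardSphereK (opS hardSphereNu (Metric.ball 0 r) h))^[n] (opK hardSphereK Jg)
    with hHdef
  have hsucc : ∀ n, H (n + 1) = opK hardSphereK (opS hardSphereNu (Metric.ball 0 r) (H n)) :=
    fun n => by simp only [hHdef, Function.iterate_succ_apply']
  have hH : ∀ n, GainBound r β (a * (1 / 2) ^ n) (b * (1 / 2) ^ n) (c * (1 / 2) ^ n) (H n) := by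
    intro n
    induction n with
    | zero =>
      simp only [pow_zero, mul_one]
      exact hG0.mono le_rfl (le_max_left _ _) (le_max_left _ _)
    | succ n ih =>
      rw [hsucc]
      have hp : (0 : ℝ) < (1 / 2) ^ n := by positivity
      refine (hK r _ _ _ _ (by positivity) (by positivity) (by positivity)
        (opS_transportBound hr hβ0 ih)).1.mono ?_ ?_ ?_
      · calc _ = (CK * r * (2 + 0)) * (a * (1 / 2) ^ n) := by ring
          _ ≤ (CK * r * (2 + 2 * A)) * (a * (1 / 2) ^ n) := by gcongr; positivity
          _ ≤ 1 / 2 * (a * (1 / 2) ^ n) := by gcongr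
          _ = _ := by ring
      · calc _ = CK * r * (a + 2 * b * A) * (1 / 2) ^ n := by ring
          _ ≤ CK * r * (2 * b + 2 * b * A) * (1 / 2) ^ n := by gcongr; linarith
          _ = (CK * r * (2 + 2 * A)) * (b * (1 / 2) ^ n) := by ring
          _ ≤ 1 / 2 * (b * (1 / 2) ^ n) := by gcongr
          _ = _ := by ring
      · calc _ = 1 / 2 * (1 / 2) ^ n * (2 * (CK * (a / nuMin))) := by ring
          _ ≤ 1 / 2 * (1 / 2) ^ n * c := by gcongr; exact le_max_right _ _
          _ = _ := by ring
  have hGh := gainBound_tsum hβ0 hH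
  obtain ⟨h, hh⟩ : ∃ h : E3 × E3 → ℝ, h = fun z => ∑' n, H n z := ⟨_, rfl⟩
  rw [← hh] at hGh
  have hc0 : 0 ≤ c := (by positivity : (0 : ℝ) ≤ CK * 1).trans (le_max_left _ _)
  have hSh := opS_transportBound hr hβ0 hGh
  obtain ⟨hG1, hI1⟩ := hK r _ _ _ _ (by positivity) (by positivity) (by positivity) hSh
  have hrec : ∀ z ∈ phaseSpace r, h z = opK hardSphereK Jg z +
      opK hardSphereK (opS hardSphereNu (Metric.ball 0 r) h) z := by
    intro z hz
    have h1 := (summable_of_gainBound hH hz).hasSum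
    have h2 : HasSum (fun n => H (n + 1) z)
        (opK hardSphereK (opS hardSphereNu (Metric.ball 0 r) h) z) := by
      simp only [hsucc]
      have hF : ∀ n, TransportBound r β ((2 * r * a) * (1 / 2) ^ n) _ _
          (opS hardSphereNu (Metric.ball 0 r) (H n)) := fun n => by
        have := opS_transportBound hr hβ0 (hH n)
        rw [← mul_assoc] at this
        exact this
      have := hasSum_opK hβ0 hβ1 (by positivity) hF hz
      rwa [opK_congr (r := r) (g := opS hardSphereNu (Metric.ball 0 r) h) _ hz] at this
      intro y hy
      rw [hh]
      exact (hasSum_opS hr hH hy).tsum_eq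
    have h3 := (hasSum_nat_add_iff' 1).2 h1
    have h4 := h2.unique h3
    simp only [Finset.range_one, Finset.sum_singleton] at h4
    rw [h4, hh]
    simp [hHdef]
  refine ⟨h, 2 * b, 2 * c, hGh.mono (le_max_left _ _) le_rfl le_rfl, fun z hz => ⟨?_, ?_, ?_⟩⟩
  · simp only [mul_add]
    exact (hI0 z hz).add (hI1 z hz)
  · rw [hrec z hz, opK, opK, opK, ← integral_add (hI0 z hz) (hI1 z hz)]
    simp only [mul_add]
  · rw [hrec z hz, add_sub_cancel_left]
    refine (hG1.bound z hz).trans ?_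
    have hg := gaussWeight_le_one hβ0 z.2
    have hg0 := gaussWeight_pos β z.2
    calc _ ≤ CK * (2 * r * (2 * a)) * 1 := by gcongr
      _ = CK * (2 * (2 * a)) * r := by ring
      _ ≤ _ := by gcongr; exact le_max_right _ _

end FixedPoint

/-! ### The solution and its singularity at the grazing set -/

/-- Continuously differentiable functions whose gradient is of the order of the reciprocal of
`√(chordDiscr r z)`, that is, singular at the grazing set. -/
structure GrazingBound (r β C : ℝ) (f : E3 × E3 → ℝ) : Prop where
  contDiffOn : ContDiffOn ℝ 1 f (movingPhase r)
  bound : ∀ z ∈ movingPhase r, |f z| ≤ C * gaussWeight β z.2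
  bound_fderiv : ∀ z ∈ movingPhase r,
    ‖fderiv ℝ f z‖ ≤ C * (√(chordDiscr r z))⁻¹ * gaussWeight β z.2

section Solution

variable {r β a b c : ℝ} {h : E3 × E3 → ℝ} {φ : E3 → ℝ}

/-- The solution attached to boundary data and to a candidate `h` for `K f`. -/
def transportSolution (r : ℝ) (φ : E3 → ℝ) (h : E3 × E3 → ℝ) (z : E3 × E3) : ℝ :=
  opJ hardSphereNu (Metric.ball 0 r) (capData φ) z + opS hardSphereNu (Metric.ball 0 r) h z

lemma ae_mem_movingPhase (r : ℝ) : ∀ᵐ z : E3 × E3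
    ∂(volume.restrict (Metric.ball (0 : E3) r ×ˢ (univ : Set E3))), z ∈ movingPhase r := by
  have h0 : ∀ᵐ z : E3 × E3, z.2 ≠ 0 := by
    have := (Measure.quasiMeasurePreserving_snd (μ := (volume : Measure E3))
      (ν := (volume : Measure E3))).ae (ae_ne_point 0)
    exact this
  filter_upwards [ae_restrict_of_ae h0,
    ae_restrict_mem (Metric.isOpen_ball.prod isOpen_univ).measurableSet] with z hz hm
  exact mem_movingPhase.2 ⟨by simpa using hm.1, hz⟩

/-- A fixed point `h = K f` gives a solution. The equation holds wherever `v ≠ 0`. -/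
lemma isSolution_transportSolution (hr : 0 < r) (H : GainBound r β a b c h) (hβ : 0 ≤ β)
    (hfix : ∀ z ∈ phaseSpace r,
      (Integrable fun w => hardSphereK z.2 w * transportSolution r φ h (z.1, w)) ∧
      h z = opK hardSphereK (transportSolution r φ h) z) :
    IsSolution hardSphereNu hardSphereK (Metric.ball (0 : E3) r) (capData φ)
      (transportSolution r φ h) := by
  filter_upwards [ae_mem_movingPhase r] with z hz
  have hT := ballTime_pos hz
  have hmem : ∀ s ∈ Ioo 0 (ballTime r z), (z.1 - s • z.2, z.2) ∈ phaseSpace r := by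
    intro s hs
    have := chord_mem_ball hr hz (θ := s / ballTime r z) (div_nonneg hs.1.le hT.le)
      ((div_lt_one hT).2 hs.2)
    rw [div_mul_cancel₀ _ hT.ne'] at this
    exact mem_phaseSpace.2 (by simpa using this)
  rw [exitTime_ball hr hz]
  refine ⟨?_, ?_, ?_⟩
  · filter_upwards [ae_restrict_mem (μ := volume) (measurableSet_Ioo (a := (0 : ℝ)) (b := ballTime r z))] with s hs
    exact (hfix _ (hmem s hs)).1
  · refine (intervalIntegrable_iff_integrableOn_Ioo_of_le (μ := volume) hT.le).2 ?_
    have hcongr : EqOn (fun s => Real.exp (-(hardSphereNu z.2 * s)) * h (z.1 - s • z.2, z.2))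
        (fun s => Real.exp (-(hardSphereNu z.2 * s)) *
          opK hardSphereK (transportSolution r φ h) (z.1 - s • z.2, z.2))
        (Ioo 0 (ballTime r z)) := fun s hs => by simp only [(hfix _ (hmem s hs)).2]
    refine IntegrableOn.congr_fun ?_ hcongr measurableSet_Ioo
    refine ⟨?_, .restrict_of_bounded (C := a) (by simp) ?_⟩
    · refine ContinuousOn.aestronglyMeasurable (s := Ioo 0 (ballTime r z)) ?_ measurableSet_Ioo
      refine ContinuousOn.mul (by fun_prop) ?_
      exact H.contDiffOn.continuousOn.comp (by fun_prop) hmem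
    · filter_upwards [ae_restrict_mem measurableSet_Ioo] with s hs
      have h1 : Real.exp (-(hardSphereNu z.2 * s)) ≤ 1 := Real.exp_le_one_iff.2 (by
        have := mul_pos (hardSphereNu_pos z.2) hs.1; linarith)
      have h2 := H.bound _ (hmem s hs)
      have h3 := (gainBound_nonneg hr H).1
      rw [norm_mul, Real.norm_of_nonneg (Real.exp_pos _).le, Real.norm_eq_abs]
      calc _ ≤ 1 * (a * 1) := by
            gcongr
            exact h2.trans (by gcongr; exact gaussWeight_le_one hβ _)
        _ = a := by ring
  · rw [transportSolution, opS_ball hr hz, opS_ball hr hz]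
    congr 1
    refine setIntegral_congr_fun measurableSet_Ioo fun θ hθ => ?_
    simp only [chordIntegrand]
    rw [(hfix _ (chordPoint_mem hr hz hθ)).2]

/-- The powers of `|v|` in the bounds are absorbed by passing to a smaller rate `β'`. -/
lemma exists_grazingBound_opS (hr : 0 < r) (H : GainBound r β a b c h) {β' : ℝ} (hβ0 : 0 ≤ β)
    (hβ : β' < β) : ∃ C > 0, GrazingBound r β' C (opS hardSphereNu (Metric.ball 0 r) h) := by
  obtain ⟨ha, hb, hc⟩ := gainBound_nonneg hr H
  obtain ⟨C₂, hC₂, hpoly⟩ := exists_poly_mul_gaussWeight_le (n := 2) (by norm_num) hβ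
  have hν := nuMin_pos
  have hA := arcsineMass_nonneg
  have hS := opS_transportBound hr hβ0 H
  set K := (2 * a + 2 / nuMin * 2 * a + c) * (2 / nuMin) + 2 * b / nuMin * arcsineMass with hK
  have hK0 : 0 ≤ K := by positivity
  have hC0 : 0 < a / nuMin + r * ((a + 2 * b * arcsineMass) + K) * C₂ + 1 := by positivity
  refine ⟨_, hC0, hS.contDiffOn, fun z hz => (hS.bound z hz).trans ?_, fun z hz => ?_⟩
  · have hmono : gaussWeight β z.2 ≤ gaussWeight β' z.2 :=
      Real.exp_le_exp.2 (by nlinarith [sq_nonneg ‖z.2‖])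
    have hg := gaussWeight_pos β' z.2
    calc _ ≤ a / nuMin * gaussWeight β' z.2 := by gcongr
      _ ≤ _ := by
        gcongr
        have : 0 ≤ r * ((a + 2 * b * arcsineMass) + K) * C₂ := by positivity
        linarith
  · have hp := hpoly z.2
    have hD := Real.sqrt_pos.2 (chordDiscr_pos hz)
    have hg := gaussWeight_pos β z.2
    have hg' := gaussWeight_pos β' z.2
    have h1 := abs_fderiv_opS_fst_le hr hβ0 H hz
    have h2 := abs_fderiv_opS_snd_le hr hβ0 H hz
    have hn := norm_fderiv_nu_le_div_sqrt hr hz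
    have hR1 := one_le_mul_div_sqrt hr hz
    have hR0 : 0 < r / √(chordDiscr r z) := div_pos hr hD
    have hv := norm_pos_iff.2 (mem_movingPhase.1 hz).2
    have e1 : gaussWeight β z.2 ≤ C₂ * gaussWeight β' z.2 := by
      refine le_trans ?_ hp
      exact le_mul_of_one_le_left hg.le (one_le_pow₀ (by linarith))
    have hR : r / √(chordDiscr r z) = r * (√(chordDiscr r z))⁻¹ := div_eq_mul_inv _ _
    set R := r / √(chordDiscr r z)
    have h2' : ∀ η, |fderiv ℝ (opS hardSphereNu (Metric.ball 0 r) h) z (0, η)| ≤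
        (R * K * (C₂ * gaussWeight β' z.2)) * ‖η‖ := by
      intro η
      refine (h2 η).trans ?_
      have hV : 1 + ‖z.2‖ ≤ R * (1 + ‖z.2‖) ^ 2 := by nlinarith
      have hV1 : (1 : ℝ) ≤ (1 + ‖z.2‖) ^ 2 := one_le_pow₀ (by linarith)
      calc _ ≤ gaussWeight β z.2 * ‖η‖ * ((R * (2 * a) * (1 + ‖z.2‖) ^ 2 +
            2 / nuMin * (2 * R * (1 + ‖z.2‖) ^ 2) * a +
            c * (R * (1 + ‖z.2‖) ^ 2)) * (2 / nuMin) +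
            2 * b / nuMin * R * arcsineMass * (1 + ‖z.2‖) ^ 2) := by
            have q1 : R * (2 * a) ≤ R * (2 * a) * (1 + ‖z.2‖) ^ 2 :=
              le_mul_of_one_le_right (by positivity) hV1
            have q2 : 2 * b / nuMin * R * arcsineMass ≤
                2 * b / nuMin * R * arcsineMass * (1 + ‖z.2‖) ^ 2 :=
              le_mul_of_one_le_right (by positivity) hV1
            refine mul_le_mul_of_nonneg_left (add_le_add (mul_le_mul_of_nonneg_right
              (add_le_add (add_le_add q1 ?_) ?_) (by positivity)) q2) (by positivity)
            · gcongr
            · gcongr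
        _ = R * K * ((1 + ‖z.2‖) ^ 2 * gaussWeight β z.2) * ‖η‖ := by rw [hK]; ring
        _ ≤ _ := by gcongr
    have h1' : ∀ ξ, |fderiv ℝ (opS hardSphereNu (Metric.ball 0 r) h) z (ξ, 0)| ≤
        (R * (a + 2 * b * arcsineMass) * (C₂ * gaussWeight β' z.2)) * ‖ξ‖ := by
      intro ξ
      refine (h1 ξ).trans ?_
      calc _ ≤ R * (C₂ * gaussWeight β' z.2) * ‖ξ‖ * (a + 2 * b * arcsineMass) := by gcongr
        _ = _ := by ring
    refine ContinuousLinearMap.opNorm_le_bound _ (by positivity) fun ζ => ?_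
    have e : ζ = (ζ.1, 0) + (0, ζ.2) := by simp
    rw [e, map_add, ← e]
    refine (norm_add_le _ _).trans ((add_le_add (h1' _) (h2' _)).trans ?_)
    calc _ ≤ (R * (a + 2 * b * arcsineMass) * (C₂ * gaussWeight β' z.2)) * ‖ζ‖ +
          (R * K * (C₂ * gaussWeight β' z.2)) * ‖ζ‖ := by
          gcongr
          · exact norm_fst_le ζ
          · exact norm_snd_le ζ
      _ = (r * ((a + 2 * b * arcsineMass) + K) * C₂) * (√(chordDiscr r z))⁻¹ *
          gaussWeight β' z.2 * ‖ζ‖ := by rw [hR]; ring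
      _ ≤ _ := by
          gcongr
          have : 0 ≤ a / nuMin := by positivity
          linarith

lemma exists_grazingBound_opJ (hr : 0 < r) (hφ : ContDiff ℝ ∞ φ)
    (hφ1 : ∀ x ∈ Metric.sphere (0 : E3) r, |φ x| ≤ 1) (hβ : β < 1 / 2) :
    ∃ C > 0, GrazingBound r β C (opJ hardSphereNu (Metric.ball 0 r) (capData φ)) := by
  obtain ⟨C, hC, hd⟩ := exists_fderiv_opJ_bound hr hφ hφ1 hβ
  obtain ⟨CJ, -, hJ⟩ := exists_opJ_transportBound hβ
  obtain ⟨b, -, hb⟩ := hJ r φ hr hφ hφ1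
  refine ⟨1 + 2 * C * r, by positivity, hb.contDiffOn, fun z hz => (hb.bound z hz).trans ?_,
    fun z hz => ?_⟩
  · have hg := gaussWeight_pos β z.2
    gcongr
    have : 0 ≤ 2 * C * r := by positivity
    linarith
  · have hD := Real.sqrt_pos.2 (chordDiscr_pos hz)
    have hg := gaussWeight_pos β z.2
    refine ContinuousLinearMap.opNorm_le_bound _ (by positivity) fun ζ => ?_
    have e : ζ = (ζ.1, 0) + (0, ζ.2) := by simp
    rw [e, map_add, ← e]
    refine (norm_add_le _ _).trans ((add_le_add ((hd z hz).1 _) ((hd z hz).2 _)).trans ?_)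
    calc _ ≤ C * (r / √(chordDiscr r z)) * gaussWeight β z.2 * ‖ζ‖ +
          C * (r / √(chordDiscr r z)) * gaussWeight β z.2 * ‖ζ‖ := by
          gcongr
          · exact norm_fst_le ζ
          · exact norm_snd_le ζ
      _ = (2 * C * r) * (√(chordDiscr r z))⁻¹ * gaussWeight β z.2 * ‖ζ‖ := by
          rw [div_eq_mul_inv]; ring
      _ ≤ _ := by gcongr; linarith

lemma GrazingBound.add {C C' : ℝ} {f g : E3 × E3 → ℝ} (hf : GrazingBound r β C f)
    (hg : GrazingBound r β C' g) : GrazingBound r β (C + C') fun z => f z + g z := by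
  refine ⟨hf.contDiffOn.add hg.contDiffOn, fun z hz => ?_, fun z hz => ?_⟩
  · refine (abs_add_le _ _).trans ((add_le_add (hf.bound z hz) (hg.bound z hz)).trans_eq (by ring))
  · have d1 := (hf.contDiffOn.differentiableOn (by simp)).differentiableAt
      ((isOpen_movingPhase r).mem_nhds hz)
    have d2 := (hg.contDiffOn.differentiableOn (by simp)).differentiableAt
      ((isOpen_movingPhase r).mem_nhds hz)
    rw [fderiv_fun_add d1 d2]
    exact (norm_add_le _ _).trans
      ((add_le_add (hf.bound_fderiv z hz) (hg.bound_fderiv z hz)).trans_eq (by ring))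

theorem exists_grazingBound_transportSolution (hr : 0 < r) (hφ : ContDiff ℝ ∞ φ)
    (hφ1 : ∀ x ∈ Metric.sphere (0 : E3) r, |φ x| ≤ 1) (H : GainBound r β a b c h) {β' : ℝ}
    (hβ0 : 0 ≤ β) (hβ : β' < β) (hβ1 : β < 1 / 2) :
    ∃ C > 0, GrazingBound r β' C (transportSolution r φ h) := by
  obtain ⟨C₁, h1, h2⟩ := exists_grazingBound_opJ hr hφ hφ1 (hβ.trans hβ1)
  obtain ⟨C₂, h3, h4⟩ := exists_grazingBound_opS hr H hβ0 hβ
  exact ⟨_, add_pos h1 h3, h2.add h4⟩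

end Solution

/-! ### Integrability of powers of the grazing singularity -/

section GrazingIntegrability

lemma integrable_abs_rpow_mul_exp {s κ : ℝ} (hs : -1 < s) (hκ : 0 < κ) :
    Integrable fun t : ℝ => |t| ^ s * Real.exp (-κ * t ^ 2) := by
  have h := integrableOn_rpow_mul_exp_neg_mul_sq hκ hs
  have h1 : IntegrableOn (fun t : ℝ => |t| ^ s * Real.exp (-κ * t ^ 2)) (Ioi 0) := by
    refine h.congr_fun (fun t ht => ?_) measurableSet_Ioi
    simp only [abs_of_pos (mem_Ioi.1 ht)]
  rw [← integrableOn_univ, ← @Iio_union_Ici _ _ (0 : ℝ), integrableOn_union,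
    integrableOn_Ici_iff_integrableOn_Ioi]
  refine ⟨?_, h1⟩
  rw [← (Measure.measurePreserving_neg (volume : Measure ℝ)).integrableOn_comp_preimage
      (Homeomorph.neg ℝ).measurableEmbedding]
  simpa only [Function.comp_def, neg_sq, neg_preimage, neg_Iio, neg_zero, abs_neg] using h1

lemma ae_coord_ne_zero : ∀ᵐ v : E3, ∀ i, v i ≠ 0 := by
  rw [ae_all_iff]
  intro i
  exact (PiLp.volume_preserving_ofLp (Fin 3)).quasiMeasurePreserving.ae
    (Measure.ae_eval_ne (μ := fun _ : Fin 3 => (volume : Measure ℝ)) i 0)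

lemma abs_coord_le_norm (v : E3) (i : Fin 3) : |v i| ≤ ‖v‖ := by
  simpa using PiLp.norm_apply_le v i

/-- The velocity integral: three one-dimensional singularities of order less than `1`. -/
lemma integrable_coord_rpow_mul_norm_rpow {γ q κ : ℝ} (hγ : γ < 1) (hq0 : 0 ≤ q) (hq : q < 2)
    (hκ : 0 < κ) :
    Integrable fun v : E3 => |v 0| ^ (-γ) * ‖v‖ ^ (-q) * Real.exp (-κ * ‖v‖ ^ 2) := by
  set e : Fin 3 → ℝ := ![-γ, -(q / 2), -(q / 2)] with he
  have hprod : Integrable fun v : Fin 3 → ℝ => ∏ i, |v i| ^ (e i) * Real.exp (-κ * v i ^ 2) := by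
    refine Integrable.fintype_prod (f := fun i t => |t| ^ (e i) * Real.exp (-κ * t ^ 2)) fun i => ?_
    refine integrable_abs_rpow_mul_exp ?_ hκ
    fin_cases i <;> simp [he] <;> linarith
  have h3 := ((PiLp.volume_preserving_ofLp (Fin 3)).integrable_comp_of_integrable hprod)
  refine h3.mono' ?_ ?_
  · refine Measurable.aestronglyMeasurable ?_
    fun_prop
  · filter_upwards [ae_coord_ne_zero] with v hv
    have hv1 := abs_pos.2 (hv 1)
    have hv2 := abs_pos.2 (hv 2)
    have hn : 0 < ‖v‖ := hv1.trans_le (abs_coord_le_norm v 1)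
    rw [Real.norm_of_nonneg (by positivity)]
    have e1 : ‖v‖ ^ (-q) ≤ |v 1| ^ (-(q / 2)) * |v 2| ^ (-(q / 2)) := by
      rw [show -q = -(q / 2) + -(q / 2) by ring, Real.rpow_add hn]
      exact mul_le_mul
        (Real.rpow_le_rpow_of_nonpos hv1 (abs_coord_le_norm v 1) (by linarith))
        (Real.rpow_le_rpow_of_nonpos hv2 (abs_coord_le_norm v 2) (by linarith))
        (by positivity) (by positivity)
    have e2 : Real.exp (-κ * ‖v‖ ^ 2) =
        Real.exp (-κ * v 0 ^ 2) * Real.exp (-κ * v 1 ^ 2) * Real.exp (-κ * v 2 ^ 2) := by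
      rw [← Real.exp_add, ← Real.exp_add, EuclideanSpace.norm_sq_eq, Fin.sum_univ_three]
      simp only [Real.norm_eq_abs, sq_abs]
      congr 1; ring
    simp only [Function.comp_apply, Fin.prod_univ_three, he]
    simp only [Matrix.cons_val]
    rw [e2]
    calc _ ≤ |v 0| ^ (-γ) * (|v 1| ^ (-(q / 2)) * |v 2| ^ (-(q / 2))) *
          (Real.exp (-κ * v 0 ^ 2) * Real.exp (-κ * v 1 ^ 2) * Real.exp (-κ * v 2 ^ 2)) := by
          gcongr
      _ = _ := by ring

/-- The space integral: a singularity of order less than `1` at the boundary of the ball. -/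
lemma integrableOn_norm_rpow_mul_boundary_rpow {r γ q : ℝ} (hr : 0 < r) (hγ : γ ≤ 2) (hq0 : 0 ≤ q)
    (hq : q < 2) : IntegrableOn (fun x : E3 => ‖x‖ ^ (-γ) * √(r ^ 2 - ‖x‖ ^ 2) ^ (-q))
      (Metric.ball 0 r) := by
  rw [integrableOn_fun_norm_addHaar (volume : Measure E3) (f := fun t : ℝ => t ^ (-γ) *
    √(r ^ 2 - t ^ 2) ^ (-q))]
  have h1 : IntegrableOn (fun t : ℝ => t ^ (-(q / 2))) (Ioo 0 r) :=
    (intervalIntegrable_iff_integrableOn_Ioo_of_le hr.le).1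
      (intervalIntegral.intervalIntegrable_rpow' (by linarith))
  have h2 : IntegrableOn (fun t : ℝ => (r - t) ^ (-(q / 2))) (Ioo 0 r) := by
    have := (intervalIntegral.intervalIntegrable_rpow' (a := r) (b := 0)
      (r := -(q / 2)) (by linarith)).comp_sub_left r
    rw [sub_self, sub_zero] at this
    exact (intervalIntegrable_iff_integrableOn_Ioo_of_le hr.le).1 this
  refine Integrable.mono' (h2.const_mul (r ^ (2 - γ) * r ^ (-(q / 2)))) ?_ ?_
  · refine Measurable.aestronglyMeasurable ?_
    fun_prop
  · filter_upwards [ae_restrict_mem measurableSet_Ioo] with t ht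
    have ht0 := ht.1
    have h3 : 0 < r - t := sub_pos.2 ht.2
    have hdim : Module.finrank ℝ E3 - 1 = 2 := by simp
    rw [hdim, smul_eq_mul, Real.norm_of_nonneg (by positivity), ← mul_assoc]
    have e1 : t ^ 2 * t ^ (-γ) ≤ r ^ (2 - γ) := by
      rw [← Real.rpow_natCast t 2, ← Real.rpow_add ht0]
      refine (Real.rpow_le_rpow ht0.le ht.2.le (by norm_num; linarith)).trans_eq ?_
      norm_num [sub_eq_add_neg]
    have e2 : √(r ^ 2 - t ^ 2) ^ (-q) ≤ r ^ (-(q / 2)) * (r - t) ^ (-(q / 2)) := by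
      rw [← Real.mul_rpow hr.le h3.le, Real.sqrt_eq_rpow, ← Real.rpow_mul (by nlinarith)]
      rw [show 1 / 2 * -q = -(q / 2) by ring]
      exact Real.rpow_le_rpow_of_nonpos (by positivity) (by nlinarith) (by linarith)
    calc _ ≤ r ^ (2 - γ) * (r ^ (-(q / 2)) * (r - t) ^ (-(q / 2))) := by gcongr
      _ = _ := by ring

/-- Rotation of `x` to the first coordinate axis. -/
lemma exists_isometry_inner (x : E3) : ∃ U : E3 ≃ₗᵢ[ℝ] E3, ∀ v, ⟪x, U v⟫ = ‖x‖ * v 0 := by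
  set y : E3 := ‖x‖ • basisVec 0 with hy
  have hn : ‖x‖ = ‖y‖ := by simp [hy, norm_smul, basisVec]
  refine ⟨(ℝ ∙ (x - y))ᗮ.reflection, fun v => ?_⟩
  rw [← (ℝ ∙ (x - y))ᗮ.reflection.inner_map_map x, Submodule.reflection_reflection,
    Submodule.reflection_sub hn, hy, inner_smul_left, basisVec, EuclideanSpace.inner_single_left]
  simp

lemma restrict_ball_prod_univ (r : ℝ) :
    (volume : Measure (E3 × E3)).restrict (Metric.ball (0 : E3) r ×ˢ (univ : Set E3)) =
      (volume.restrict (Metric.ball (0 : E3) r)).prod volume := by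
  rw [Measure.volume_eq_prod, ← Measure.prod_restrict, Measure.restrict_univ]

lemma measurable_sqrt_chordDiscr (r : ℝ) : Measurable fun z : E3 × E3 => √(chordDiscr r z) := by
  have : Continuous (chordDiscr r) := by unfold chordDiscr; fun_prop
  exact (Real.continuous_sqrt.comp this).measurable

/-- The grazing singularity is integrable to every power less than `3`. The power is distributed
between the two lower bounds `|⟪x, v⟫|` and `‖v‖ √(r² - ‖x‖²)` of `√(chordDiscr r z)`. -/
theorem integrable_grazing_rpow {r p κ : ℝ} (hr : 0 < r) (hp1 : 1 ≤ p) (hp3 : p < 3)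
    (hκ : 0 < κ) :
    Integrable (fun z : E3 × E3 => √(chordDiscr r z) ^ (-p) * Real.exp (-κ * ‖z.2‖ ^ 2))
      (volume.restrict (Metric.ball (0 : E3) r ×ˢ (univ : Set E3))) := by
  -- `γ + q = p` with `γ < 1` and `q < 2`, which is possible for `p < 3`
  set γ := (p - 1) / 2 with hγ
  set q := (p + 1) / 2 with hq
  have hmeas : Measurable fun z : E3 × E3 =>
      √(chordDiscr r z) ^ (-p) * Real.exp (-κ * ‖z.2‖ ^ 2) := by
    have := measurable_sqrt_chordDiscr r
    fun_prop
  have hI := integrable_coord_rpow_mul_norm_rpow (γ := γ) (q := q) (by linarith) (by linarith)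
    (by linarith) hκ
  have hX := integrableOn_norm_rpow_mul_boundary_rpow (γ := γ) (q := q) hr (by linarith)
    (by linarith) (by linarith)
  refine ⟨hmeas.aestronglyMeasurable, ?_⟩
  rw [hasFiniteIntegral_iff_ofReal (Eventually.of_forall fun z => by positivity),
    restrict_ball_prod_univ, lintegral_prod _ hmeas.ennreal_ofReal.aemeasurable]
  have hIf := hI.lintegral_lt_top
  have hXf := hX.lintegral_lt_top
  refine lt_of_le_of_lt (lintegral_mono_ae (g := fun x => ENNReal.ofReal (‖x‖ ^ (-γ) *
    √(r ^ 2 - ‖x‖ ^ 2) ^ (-q)) * ∫⁻ v : E3, ENNReal.ofReal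
      (|v 0| ^ (-γ) * ‖v‖ ^ (-q) * Real.exp (-κ * ‖v‖ ^ 2))) ?_) ?_
  · filter_upwards [ae_restrict_mem measurableSet_ball, ae_restrict_of_ae (ae_ne_point 0)]
      with x hx hx0
    rw [mem_ball_zero_iff] at hx
    obtain ⟨U, hU⟩ := exists_isometry_inner x
    have hn := norm_pos_iff.2 hx0
    rw [← U.measurePreserving.lintegral_comp_emb U.toHomeomorph.measurableEmbedding,
      ← lintegral_const_mul']
    · refine lintegral_mono_ae ?_
      filter_upwards [ae_coord_ne_zero] with v hv
      have hv0 := abs_pos.2 (hv 0)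
      have hnv : 0 < ‖v‖ := hv0.trans_le (abs_coord_le_norm v 0)
      rw [← ENNReal.ofReal_mul (by positivity)]
      refine ENNReal.ofReal_le_ofReal ?_
      have hs : 0 < √(r ^ 2 - ‖x‖ ^ 2) := Real.sqrt_pos.2 (sq_sub_sq_pos hx)
      have hmem : ((x, U v) : E3 × E3) ∈ movingPhase r :=
        mem_movingPhase.2 ⟨hx, by simpa using norm_pos_iff.1 hnv⟩
      have hD := Real.sqrt_pos.2 (chordDiscr_pos hmem)
      have b1 : ‖x‖ * |v 0| ≤ √(chordDiscr r (x, U v)) := by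
        have := (abs_inner_lt_sqrt_chordDiscr hmem).le
        simpa [hU, abs_mul] using this
      have b2 : ‖v‖ * √(r ^ 2 - ‖x‖ ^ 2) ≤ √(chordDiscr r (x, U v)) := by
        refine Real.le_sqrt_of_sq_le ?_
        rw [mul_pow, Real.sq_sqrt (sq_sub_sq_pos hx).le]
        simpa using chordDiscr_ge r (x, U v)
      have c1 : √(chordDiscr r (x, U v)) ^ (-p) ≤ (‖x‖ * |v 0|) ^ (-γ) *
          (‖v‖ * √(r ^ 2 - ‖x‖ ^ 2)) ^ (-q) := by
        rw [show -p = -γ + -q by rw [hγ, hq]; ring, Real.rpow_add hD]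
        exact mul_le_mul
          (Real.rpow_le_rpow_of_nonpos (by positivity) b1 (by linarith))
          (Real.rpow_le_rpow_of_nonpos (by positivity) b2 (by linarith))
          (by positivity) (by positivity)
      rw [Real.mul_rpow hn.le hv0.le, Real.mul_rpow hnv.le hs.le] at c1
      simp only [LinearIsometryEquiv.norm_map]
      calc _ ≤ (‖x‖ ^ (-γ) * |v 0| ^ (-γ) * (‖v‖ ^ (-q) * √(r ^ 2 - ‖x‖ ^ 2) ^ (-q))) *
            Real.exp (-κ * ‖v‖ ^ 2) := by gcongr
        _ = _ := by ring
    · exact ENNReal.ofReal_ne_top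
  · rw [lintegral_mul_const' _ _ hIf.ne]
    exact ENNReal.mul_lt_top hXf hIf

end GrazingIntegrability

/-! ### Weak derivatives and Sobolev regularity below the exponent `3` -/

section SobolevRegularity

/-- The cutoff `|v|² / (|v|² + ε²)` that removes zero velocities, with its derivative. -/
lemma hasFDerivAt_velocityCutoff {ε : ℝ} (hε : 0 < ε) (z : E3 × E3) :
    ∃ L : E3 × E3 →L[ℝ] ℝ,
      HasFDerivAt (fun z : E3 × E3 => ‖z.2‖ ^ 2 / (‖z.2‖ ^ 2 + ε ^ 2)) L z ∧
      ∀ e, L e = 2 * ε ^ 2 * ⟪z.2, e.2⟫ / (‖z.2‖ ^ 2 + ε ^ 2) ^ 2 := by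
  have h1 : HasFDerivAt (fun z : E3 × E3 => ‖z.2‖ ^ 2) _ z := hasFDerivAt_snd.norm_sq
  have hne : ‖z.2‖ ^ 2 + ε ^ 2 ≠ 0 := by positivity
  have h2 : HasDerivAt (fun t : ℝ => t / (t + ε ^ 2))
      ((1 * (‖z.2‖ ^ 2 + ε ^ 2) - ‖z.2‖ ^ 2 * 1) / (‖z.2‖ ^ 2 + ε ^ 2) ^ 2) (‖z.2‖ ^ 2) :=
    (hasDerivAt_id (‖z.2‖ ^ 2)).div ((hasDerivAt_id (‖z.2‖ ^ 2)).add_const (ε ^ 2)) hne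
  have h3 := h2.comp_hasFDerivAt z h1
  simp only [Function.comp_def] at h3
  refine ⟨_, h3, fun e => ?_⟩
  simp
  ring

/-- A bounded function that is differentiable away from zero velocities has a gradient of mean
zero, if it is integrable with its gradient and with the weight `|v|⁻¹`: zero velocities form a
set of codimension `3`. -/
lemma integral_fderiv_eq_zero_of_ne_zero {g : E3 × E3 → ℝ} {C : ℝ} {e : E3 × E3}
    (hd : ∀ z : E3 × E3, z.2 ≠ 0 → DifferentiableAt ℝ g z) (hb : ∀ z, |g z| ≤ C)
    (hg : Integrable g) (hg' : Integrable fun z => fderiv ℝ g z e)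
    (hgv : Integrable fun z => g z * ‖z.2‖⁻¹) : ∫ z, fderiv ℝ g z e = 0 := by
  have hae : ∀ᵐ z : E3 × E3, z.2 ≠ 0 :=
    (Measure.quasiMeasurePreserving_snd (μ := (volume : Measure E3))
      (ν := (volume : Measure E3))).ae (ae_ne_point 0)
  obtain ⟨χ, hχ⟩ : ∃ χ : ℝ → E3 × E3 → ℝ,
    χ = fun ε z => ‖z.2‖ ^ 2 / (‖z.2‖ ^ 2 + ε ^ 2) := ⟨_, rfl⟩
  obtain ⟨χ', hχ'⟩ : ∃ χ' : ℝ → E3 × E3 → ℝ,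
    χ' = fun ε z => 2 * ε ^ 2 * ⟪z.2, e.2⟫ / (‖z.2‖ ^ 2 + ε ^ 2) ^ 2 := ⟨_, rfl⟩
  have hχd : ∀ ε > 0, ∀ z, DifferentiableAt ℝ (χ ε) z ∧ fderiv ℝ (χ ε) z e = χ' ε z := by
    intro ε hε z
    obtain ⟨L, h1, h2⟩ := hasFDerivAt_velocityCutoff hε z
    rw [hχ, hχ']
    exact ⟨h1.differentiableAt, by rw [h1.fderiv]; exact h2 e⟩
  have hχ1 : ∀ ε > 0, ∀ z, |χ ε z| ≤ 1 := by
    intro ε hε z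
    rw [hχ, abs_of_nonneg (by positivity)]
    exact div_le_one_of_le₀ (by linarith [sq_nonneg ε]) (by positivity)
  have hχ'1 : ∀ ε > 0, ∀ z : E3 × E3, z.2 ≠ 0 → |χ' ε z| ≤ ‖z.2‖⁻¹ * ‖e.2‖ := by
    intro ε hε z hz
    have hv := norm_pos_iff.2 hz
    simp only [hχ']
    rw [abs_div, abs_mul, abs_of_pos (by positivity : 0 < 2 * ε ^ 2),
      abs_of_pos (by positivity : 0 < (‖z.2‖ ^ 2 + ε ^ 2) ^ 2), div_le_iff₀ (by positivity)]
    have h1 := abs_real_inner_le_norm z.2 e.2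
    have h2 : 2 * ε ^ 2 * ‖z.2‖ ≤ ‖z.2‖⁻¹ * (‖z.2‖ ^ 2 + ε ^ 2) ^ 2 := by
      rw [inv_mul_eq_div, le_div_iff₀ hv]
      nlinarith [sq_nonneg (‖z.2‖ ^ 2), sq_nonneg (ε ^ 2)]
    calc _ ≤ 2 * ε ^ 2 * (‖z.2‖ * ‖e.2‖) := by gcongr
      _ = (2 * ε ^ 2 * ‖z.2‖) * ‖e.2‖ := by ring
      _ ≤ (‖z.2‖⁻¹ * (‖z.2‖ ^ 2 + ε ^ 2) ^ 2) * ‖e.2‖ := by gcongr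
      _ = _ := by ring
  have hχm : ∀ ε > 0, Continuous (χ ε) ∧ Continuous (χ' ε) := by
    intro ε hε
    rw [hχ, hχ']
    have : ∀ z : E3 × E3, ‖z.2‖ ^ 2 + ε ^ 2 ≠ 0 := fun z => by positivity
    exact ⟨by fun_prop (disch := exact this _), by
      fun_prop (disch := intro z; exact pow_ne_zero _ (this _))⟩
  have hu : ∀ ε > 0, ∀ z : E3 × E3, DifferentiableAt ℝ (fun z => χ ε z * g z) z := by
    intro ε hε z
    by_cases hz : z.2 = 0
    · refine (Asymptotics.IsBigO.hasFDerivAt (n := 2) (Asymptotics.IsBigO.of_bound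
        (C / ε ^ 2) (Eventually.of_forall fun y => ?_)) (by norm_num)).differentiableAt
      have h1 : ‖y.2‖ ≤ ‖y - z‖ := by
        have := norm_snd_le (y - z)
        simpa [hz] using this
      have h2 : |χ ε y| ≤ ‖y - z‖ ^ 2 / ε ^ 2 := by
        simp only [hχ]
        rw [abs_of_nonneg (by positivity)]
        gcongr
        linarith [sq_nonneg ‖y.2‖]
      rw [norm_mul, Real.norm_eq_abs, Real.norm_eq_abs, norm_pow, norm_norm]
      calc _ ≤ ‖y - z‖ ^ 2 / ε ^ 2 * C := by gcongr; exact hb y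
        _ = _ := by ring
    · exact ((hχd ε hε z).1).mul (hd z hz)
  have hu' : ∀ ε > 0, ∀ z : E3 × E3, z.2 ≠ 0 → fderiv ℝ (fun z => χ ε z * g z) z e =
      χ ε z * fderiv ℝ g z e + g z * χ' ε z := by
    intro ε hε z hz
    rw [fderiv_fun_mul (hχd ε hε z).1 (hd z hz)]
    simp [(hχd ε hε z).2]
  have hi1 : ∀ ε > 0, Integrable fun z => χ ε z * fderiv ℝ g z e := fun ε hε =>
    hg'.bdd_mul (c := 1) (hχm ε hε).1.aestronglyMeasurable (Eventually.of_forall (hχ1 ε hε))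
  have hi2 : ∀ ε > 0, Integrable fun z => g z * χ' ε z := fun ε hε => by
    refine (hgv.norm.mul_const ‖e.2‖).mono'
      (hg.1.mul (hχm ε hε).2.aestronglyMeasurable) ?_
    filter_upwards [hae] with z hz
    rw [norm_mul, norm_mul, norm_inv, norm_norm, mul_assoc]
    exact mul_le_mul_of_nonneg_left (hχ'1 ε hε z hz) (norm_nonneg _)
  have hzero : ∀ ε > 0, ∫ z, (χ ε z * fderiv ℝ g z e + g z * χ' ε z) = 0 := by
    intro ε hε
    have hae' : (fun z => fderiv ℝ (fun z => χ ε z * g z) z e) =ᵐ[volume]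
        fun z => χ ε z * fderiv ℝ g z e + g z * χ' ε z := by
      filter_upwards [hae] with z hz using hu' ε hε z hz
    have h1 : Integrable fun z => fderiv ℝ (fun z => χ ε z * g z) z e :=
      ((hi1 ε hε).add (hi2 ε hε)).congr hae'.symm
    have h2 : Integrable fun z => χ ε z * g z :=
      hg.bdd_mul (c := 1) (hχm ε hε).1.aestronglyMeasurable (Eventually.of_forall (hχ1 ε hε))
    have hhaar : (volume : Measure (E3 × E3)).IsAddHaarMeasure := by
      rw [Measure.volume_eq_prod]; infer_instance
    have := integral_mul_fderiv_eq_neg_fderiv_mul_of_integrable (μ := (volume : Measure (E3 × E3)))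
      (f := fun z => χ ε z * g z) (g := fun _ => (1 : ℝ)) (v := e) (by simpa using h1)
      (by simp) (by simpa using h2) (fun z _ => hu ε hε z) (fun z _ => by fun_prop)
    simp only [fderiv_fun_const, Pi.zero_apply, zero_apply, mul_zero, integral_zero,
      mul_one] at this
    rw [← integral_congr_ae hae']
    linarith
  have hlim : Tendsto (fun n : ℕ => ∫ z, (χ (1 / ((n : ℝ) + 1)) z * fderiv ℝ g z e +
      g z * χ' (1 / ((n : ℝ) + 1)) z)) atTop (𝓝 (∫ z, fderiv ℝ g z e)) := by
    have hpos : ∀ n : ℕ, 0 < 1 / ((n : ℝ) + 1) := fun n => by positivity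
    refine tendsto_integral_of_dominated_convergence
      (fun z => |fderiv ℝ g z e| + |g z * ‖z.2‖⁻¹| * ‖e.2‖) (fun n =>
        ((hi1 _ (hpos n)).add (hi2 _ (hpos n))).1) (hg'.abs.add (hgv.abs.mul_const _))
      (fun n => ?_) ?_
    · filter_upwards [hae] with z hz
      refine (norm_add_le _ _).trans (add_le_add ?_ ?_)
      · rw [norm_mul]
        exact mul_le_of_le_one_left (norm_nonneg _) (hχ1 _ (hpos n) z)
      · rw [norm_mul, abs_mul, abs_inv, abs_norm, mul_assoc]
        exact mul_le_mul_of_nonneg_left (hχ'1 _ (hpos n) z hz) (norm_nonneg _)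
    · filter_upwards [hae] with z hz
      have hv := norm_pos_iff.2 hz
      have h0 : Tendsto (fun n : ℕ => 1 / ((n : ℝ) + 1)) atTop (𝓝 0) :=
        tendsto_one_div_add_atTop_nhds_zero_nat
      have c1 : ContinuousAt (fun ε => χ ε z) 0 := by
        simp only [hχ]
        exact ContinuousAt.div (by fun_prop) (by fun_prop) (by positivity)
      have c2 : ContinuousAt (fun ε => χ' ε z) 0 := by
        simp only [hχ']
        exact ContinuousAt.div (by fun_prop) (by fun_prop) (by positivity)
      have l1 := c1.tendsto.comp h0
      have l2 := c2.tendsto.comp h0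
      have v1 : χ 0 z = 1 := by
        simp only [hχ]
        rw [zero_pow two_ne_zero, add_zero, div_self (by positivity)]
      have v2 : χ' 0 z = 0 := by simp [hχ']
      rw [v1] at l1
      rw [v2] at l2
      simpa using (l1.mul_const (fderiv ℝ g z e)).add (l2.const_mul (g z))
  refine tendsto_nhds_unique hlim ?_
  refine tendsto_const_nhds.congr fun n => (hzero _ ?_).symm
  positivity

variable {r β C : ℝ} {f : E3 × E3 → ℝ}

lemma aestronglyMeasurable_of_continuousOn_movingPhase {F : Type*} [TopologicalSpace F]
    [TopologicalSpace.PseudoMetrizableSpace F] [SecondCountableTopologyEither (E3 × E3) F]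
    {g : E3 × E3 → F} (hg : ContinuousOn g (movingPhase r)) : AEStronglyMeasurable g
      (volume.restrict (Metric.ball (0 : E3) r ×ˢ (univ : Set E3))) := by
  have h : volume.restrict (Metric.ball (0 : E3) r ×ˢ (univ : Set E3)) =
      (volume : Measure (E3 × E3)).restrict (movingPhase r) := by
    refine Measure.restrict_congr_set ?_
    have h0 : ∀ᵐ z : E3 × E3, z.2 ≠ 0 :=
      (Measure.quasiMeasurePreserving_snd (μ := (volume : Measure E3))
        (ν := (volume : Measure E3))).ae (ae_ne_point 0)
    filter_upwards [h0] with z hz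
    refine propext ⟨fun hm => ?_, fun hm => ?_⟩
    · exact mem_movingPhase.2 ⟨by simpa using hm.1, hz⟩
    · exact ⟨by simpa using (mem_movingPhase.1 hm).1, mem_univ _⟩
  rw [h]
  exact hg.aestronglyMeasurable (isOpen_movingPhase r).measurableSet

lemma integrable_exp_velocity (r : ℝ) {κ : ℝ} (hκ : 0 < κ) :
    Integrable (fun z : E3 × E3 => Real.exp (-κ * ‖z.2‖ ^ 2))
      (volume.restrict (Metric.ball (0 : E3) r ×ˢ (univ : Set E3))) := by
  rw [restrict_ball_prod_univ]
  have : IsFiniteMeasure ((volume : Measure E3).restrict (Metric.ball (0 : E3) r)) :=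
    ⟨by simpa using (measure_ball_lt_top (μ := (volume : Measure E3)) (x := 0) (r := r))⟩
  exact (integrable_exp_neg_mul_sq_norm hκ).comp_snd _

lemma memLpWeighted_of_le_gaussWeight {F : Type*} [NormedAddCommGroup F] [NormedSpace ℝ F]
    {p α : ℝ} (hp : 1 ≤ p) (hα : α < β) {g : E3 × E3 → F}
    (hm : AEStronglyMeasurable g (volume.restrict (Metric.ball (0 : E3) r ×ˢ (univ : Set E3))))
    (hb : ∀ z ∈ movingPhase r, ‖g z‖ ≤ C * gaussWeight β z.2) :
    MemLpWeighted p α (Metric.ball (0 : E3) r) g := by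
  have hp0 : 0 < p := by linarith
  have hw : AEStronglyMeasurable (fun z : E3 × E3 => Real.exp (α * ‖z.2‖ ^ 2) • g z)
      (volume.restrict (Metric.ball (0 : E3) r ×ˢ (univ : Set E3))) :=
    AEStronglyMeasurable.smul (by fun_prop) hm
  refine (integrable_norm_rpow_iff hw (by simpa using hp0) ENNReal.ofReal_ne_top).1 ?_
  rw [ENNReal.toReal_ofReal hp0.le]
  have hκ : 0 < p * (β - α) := mul_pos hp0 (sub_pos.2 hα)
  refine ((integrable_exp_velocity r hκ).const_mul (|C| ^ p)).mono'
    (hw.norm.aemeasurable.pow_const p).aestronglyMeasurable ?_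
  filter_upwards [ae_mem_movingPhase r] with z hz
  rw [Real.norm_of_nonneg (by positivity), norm_smul, Real.norm_of_nonneg (Real.exp_pos _).le]
  have h1 : Real.exp (α * ‖z.2‖ ^ 2) * ‖g z‖ ≤ |C| * Real.exp (-(β - α) * ‖z.2‖ ^ 2) := by
    have hg := gaussWeight_pos β z.2
    calc _ ≤ Real.exp (α * ‖z.2‖ ^ 2) * (|C| * gaussWeight β z.2) := by
          gcongr
          exact (hb z hz).trans (by gcongr; exact le_abs_self C)
      _ = |C| * (Real.exp (α * ‖z.2‖ ^ 2) * Real.exp (-β * ‖z.2‖ ^ 2)) := by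
          rw [gaussWeight]; ring
      _ = _ := by rw [← Real.exp_add]; ring_nf
  refine (Real.rpow_le_rpow (by positivity) h1 hp0.le).trans_eq ?_
  rw [Real.mul_rpow (abs_nonneg C) (Real.exp_pos _).le, ← Real.exp_mul]
  ring_nf

/-- The surplus `β - α` of the Gaussian rate gives the decay in `v`. -/
lemma memLpWeighted_of_le_grazing {F : Type*} [NormedAddCommGroup F] [NormedSpace ℝ F]
    {p α : ℝ} (hr : 0 < r) (hp : 1 ≤ p) (hp3 : p < 3) (hα : α < β) {g : E3 × E3 → F}
    (hm : AEStronglyMeasurable g (volume.restrict (Metric.ball (0 : E3) r ×ˢ (univ : Set E3))))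
    (hb : ∀ z ∈ movingPhase r, ‖g z‖ ≤ C * (√(chordDiscr r z))⁻¹ * gaussWeight β z.2) :
    MemLpWeighted p α (Metric.ball (0 : E3) r) g := by
  have hp0 : 0 < p := by linarith
  have hw : AEStronglyMeasurable (fun z : E3 × E3 => Real.exp (α * ‖z.2‖ ^ 2) • g z)
      (volume.restrict (Metric.ball (0 : E3) r ×ˢ (univ : Set E3))) :=
    AEStronglyMeasurable.smul (by fun_prop) hm
  refine (integrable_norm_rpow_iff hw (by simpa using hp0) ENNReal.ofReal_ne_top).1 ?_
  rw [ENNReal.toReal_ofReal hp0.le]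
  have hκ : 0 < p * (β - α) := mul_pos hp0 (sub_pos.2 hα)
  refine ((integrable_grazing_rpow hr hp hp3 hκ).const_mul (|C| ^ p)).mono'
    (hw.norm.aemeasurable.pow_const p).aestronglyMeasurable ?_
  filter_upwards [ae_mem_movingPhase r] with z hz
  have hD := Real.sqrt_pos.2 (chordDiscr_pos hz)
  rw [Real.norm_of_nonneg (by positivity), norm_smul, Real.norm_of_nonneg (Real.exp_pos _).le]
  have h1 : Real.exp (α * ‖z.2‖ ^ 2) * ‖g z‖ ≤
      |C| * ((√(chordDiscr r z))⁻¹ * Real.exp (-(β - α) * ‖z.2‖ ^ 2)) := by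
    have hg := gaussWeight_pos β z.2
    calc _ ≤ Real.exp (α * ‖z.2‖ ^ 2) * (|C| * (√(chordDiscr r z))⁻¹ * gaussWeight β z.2) := by
          gcongr
          exact (hb z hz).trans (by gcongr; exact le_abs_self C)
      _ = |C| * ((√(chordDiscr r z))⁻¹ *
          (Real.exp (α * ‖z.2‖ ^ 2) * Real.exp (-β * ‖z.2‖ ^ 2))) := by
          rw [gaussWeight]; ring
      _ = _ := by rw [← Real.exp_add]; ring_nf
  refine (Real.rpow_le_rpow (by positivity) h1 hp0.le).trans_eq ?_
  rw [Real.mul_rpow (abs_nonneg C) (by positivity), Real.mul_rpow (by positivity)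
    (Real.exp_pos _).le, ← Real.exp_mul, Real.inv_rpow hD.le, Real.rpow_neg hD.le]
  ring_nf

end SobolevRegularity

section WeakDerivatives

variable {r β C : ℝ} {f : E3 × E3 → ℝ}

lemma GrazingBound.continuousOn_fderiv (H : GrazingBound r β C f) :
    ContinuousOn (fderiv ℝ f) (movingPhase r) :=
  H.contDiffOn.continuousOn_fderiv_of_isOpen (isOpen_movingPhase r) le_rfl

lemma GrazingBound.differentiableAt (H : GrazingBound r β C f) {z : E3 × E3}
    (hz : z ∈ movingPhase r) : DifferentiableAt ℝ f z :=
  (H.contDiffOn.differentiableOn (by simp)).differentiableAt ((isOpen_movingPhase r).mem_nhds hz)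

lemma GrazingBound.abs_fderiv_le (H : GrazingBound r β C f) {z : E3 × E3}
    (hz : z ∈ movingPhase r) (e : E3 × E3) :
    |fderiv ℝ f z e| ≤ C * ‖e‖ * (√(chordDiscr r z))⁻¹ * gaussWeight β z.2 := by
  refine ((fderiv ℝ f z).le_opNorm e).trans ?_
  calc _ ≤ C * (√(chordDiscr r z))⁻¹ * gaussWeight β z.2 * ‖e‖ := by
        gcongr; exact H.bound_fderiv z hz
    _ = _ := by ring

lemma GrazingBound.integrableOn (H : GrazingBound r β C f) (hβ : 0 < β) :
    IntegrableOn f (Metric.ball (0 : E3) r ×ˢ (univ : Set E3)) := by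
  have := memLpWeighted_of_le_gaussWeight (p := 1) (α := 0) le_rfl hβ
    (aestronglyMeasurable_of_continuousOn_movingPhase H.contDiffOn.continuousOn) H.bound
  simpa [MemLpWeighted, memLp_one_iff_integrable, IntegrableOn] using this

lemma GrazingBound.integrableOn_fderiv (H : GrazingBound r β C f) (hr : 0 < r) (hβ : 0 < β)
    (e : E3 × E3) : IntegrableOn (fun z => fderiv ℝ f z e)
      (Metric.ball (0 : E3) r ×ˢ (univ : Set E3)) := by
  have := memLpWeighted_of_le_grazing (p := 1) (α := 0) hr le_rfl (by norm_num) hβ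
    (aestronglyMeasurable_of_continuousOn_movingPhase
      (H.continuousOn_fderiv.clm_apply continuousOn_const)) fun z hz => H.abs_fderiv_le hz e
  simpa [MemLpWeighted, memLp_one_iff_integrable, IntegrableOn] using this

/-- Since the singular set is small enough, the classical derivatives are the weak ones. -/
theorem GrazingBound.isWeakDeriv (H : GrazingBound r β C f) (hr : 0 < r) (hβ : 0 < β)
    (e : E3 × E3) :
    IsWeakDeriv (Metric.ball (0 : E3) r ×ˢ univ) e f fun z => fderiv ℝ f z e := by
  have hf := H.integrableOn hβ
  have hf' := H.integrableOn_fderiv hr hβ e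
  refine ⟨hf.locallyIntegrableOn, hf'.locallyIntegrableOn, fun φ hφ hφc hφs => ?_⟩
  set U : Set (E3 × E3) := Metric.ball (0 : E3) r ×ˢ (univ : Set E3) with hU
  have hUm : MeasurableSet U := (Metric.isOpen_ball.prod isOpen_univ).measurableSet
  have hMU : movingPhase r ⊆ U := fun z hz =>
    ⟨by simpa using (mem_movingPhase.1 hz).1, mem_univ _⟩
  have hUM : ∀ z ∈ U, z.2 ≠ 0 → z ∈ movingPhase r := fun z hz h0 =>
    mem_movingPhase.2 ⟨by simpa using hz.1, h0⟩
  have hMm : MeasurableSet (movingPhase r) := (isOpen_movingPhase r).measurableSet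
  have hφd : Differentiable ℝ φ := hφ.differentiable (by simp)
  have hφ'c : Continuous fun z => fderiv ℝ φ z e :=
    (hφ.continuous_fderiv (by simp)).clm_apply continuous_const
  obtain ⟨A, hA⟩ := hφc.exists_bound_of_continuous hφ.continuous
  obtain ⟨A', hA'⟩ := (hφc.fderiv_apply (𝕜 := ℝ) e).exists_bound_of_continuous hφ'c
  have hA0 : 0 ≤ A := (norm_nonneg _).trans (hA 0)
  have hae : ∀ᵐ z : E3 × E3, z.2 ≠ 0 :=
    (Measure.quasiMeasurePreserving_snd (μ := (volume : Measure E3))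
      (ν := (volume : Measure E3))).ae (ae_ne_point 0)
  -- The values of `f` off the phase space are arbitrary and have to be cut off.
  set g : E3 × E3 → ℝ := (movingPhase r).indicator fun z => f z * φ z with hg
  have hg1 : ∀ z ∈ movingPhase r, g =ᶠ[𝓝 z] fun z => f z * φ z := fun z hz => by
    filter_upwards [(isOpen_movingPhase r).mem_nhds hz] with y hy using indicator_of_mem hy _
  have hg2 : ∀ z ∉ U, g =ᶠ[𝓝 z] fun _ => 0 := fun z hz => by
    have hz' : z ∉ tsupport φ := fun h => hz (hφs h)
    filter_upwards [notMem_tsupport_iff_eventuallyEq.1 hz'] with y hy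
    rw [hg, indicator_apply_eq_zero]
    intro _
    simp [hy]
  have hD : ∀ z : E3 × E3, z.2 ≠ 0 → DifferentiableAt ℝ g z := by
    intro z h0
    by_cases hz : z ∈ U
    · exact ((H.differentiableAt (hUM z hz h0)).mul hφd.differentiableAt).congr_of_eventuallyEq
        (hg1 z (hUM z hz h0))
    · exact (differentiableAt_const (0 : ℝ)).congr_of_eventuallyEq (hg2 z hz)
  have hder : ∀ z : E3 × E3, z.2 ≠ 0 → fderiv ℝ g z e =
      U.indicator (fun z => f z * fderiv ℝ φ z e + fderiv ℝ f z e * φ z) z := by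
    intro z h0
    by_cases hz : z ∈ U
    · rw [indicator_of_mem hz, (hg1 z (hUM z hz h0)).fderiv_eq,
        fderiv_fun_mul (H.differentiableAt (hUM z hz h0)) hφd.differentiableAt]
      simp [mul_comm]
    · rw [indicator_of_notMem hz, (hg2 z hz).fderiv_eq]
      simp
  have i1 : IntegrableOn (fun z => f z * fderiv ℝ φ z e) U :=
    hf.mul_bdd (c := A') hφ'c.aestronglyMeasurable (Eventually.of_forall hA')
  have i2 : IntegrableOn (fun z => fderiv ℝ f z e * φ z) U :=
    hf'.mul_bdd (c := A) hφ.continuous.aestronglyMeasurable (Eventually.of_forall hA)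
  have i3 : IntegrableOn (fun z => f z * φ z) U :=
    hf.mul_bdd (c := A) hφ.continuous.aestronglyMeasurable (Eventually.of_forall hA)
  have hC0 : ∀ z ∈ movingPhase r, 0 ≤ C := fun z hz =>
    nonneg_of_mul_nonneg_left ((abs_nonneg _).trans (H.bound z hz)) (gaussWeight_pos β z.2)
  have hgU : g =ᵐ[volume] U.indicator fun z => f z * φ z := by
    filter_upwards [hae] with z h0
    by_cases hz : z ∈ U
    · rw [indicator_of_mem hz, hg, indicator_of_mem (hUM z hz h0)]
    · rw [indicator_of_notMem hz, hg, indicator_of_notMem fun h => hz (hMU h)]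
  have key := integral_fderiv_eq_zero_of_ne_zero (g := g) (C := |C| * A) (e := e) hD ?_ ?_ ?_ ?_
  · have hcongr : ∫ z, fderiv ℝ g z e =
        ∫ z, U.indicator (fun z => f z * fderiv ℝ φ z e + fderiv ℝ f z e * φ z) z := by
      refine integral_congr_ae ?_
      filter_upwards [hae] with z h0 using hder z h0
    rw [hcongr, integral_indicator hUm, integral_add i1 i2] at key
    linarith
  · intro z
    rw [hg]
    by_cases hz : z ∈ movingPhase r
    · rw [indicator_of_mem hz, abs_mul]
      have h1 := H.bound z hz
      have h2 := gaussWeight_le_one hβ.le z.2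
      have h3 : |f z| ≤ |C| := h1.trans
        ((mul_le_of_le_one_right (hC0 z hz) h2).trans (le_abs_self C))
      exact mul_le_mul h3 (hA z) (abs_nonneg _) (abs_nonneg _)
    · rw [indicator_of_notMem hz, abs_zero]
      positivity
  · exact ((integrable_indicator_iff hUm).2 i3).congr hgU.symm
  · refine ((integrable_indicator_iff hUm).2 (i1.add i2)).congr ?_
    filter_upwards [hae] with z h0 using (hder z h0).symm
  · have hm : AEStronglyMeasurable g := (((integrable_indicator_iff hUm).2 i3).congr hgU.symm).1
    have hint := (integrable_indicator_iff hUm).2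
      ((integrable_grazing_rpow hr le_rfl (by norm_num) hβ).const_mul (|C| * A * r))
    refine hint.mono' (hm.mul (by fun_prop)) ?_
    filter_upwards [hae] with z h0
    by_cases hz : z ∈ movingPhase r
    · rw [indicator_of_mem (hMU hz), hg, indicator_of_mem hz, norm_mul, norm_mul, norm_inv,
        norm_norm, Real.norm_eq_abs, Real.norm_eq_abs]
      have hDp := Real.sqrt_pos.2 (chordDiscr_pos hz)
      have h1 : |f z| ≤ |C| * gaussWeight β z.2 := (H.bound z hz).trans
        (mul_le_mul_of_nonneg_right (le_abs_self C) (gaussWeight_pos β z.2).le)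
      have h2 := inv_norm_le_div_sqrt hr hz
      have h3 : |φ z| ≤ A := hA z
      have hgw := gaussWeight_pos β z.2
      calc _ ≤ (|C| * gaussWeight β z.2) * A * (r / √(chordDiscr r z)) := by gcongr
        _ = _ := by rw [Real.rpow_neg_one, gaussWeight]; ring
    · rw [hg, indicator_of_notMem hz, zero_mul, norm_zero]
      refine indicator_nonneg (fun z _ => ?_) z
      positivity

/-- The partial gradient of `f` along an embedding `L` of `ℝ³` into phase space. -/
def partialGradient (f : E3 × E3 → ℝ) (L : E3 → E3 × E3) (z : E3 × E3) : E3 :=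
  WithLp.toLp 2 fun i => fderiv ℝ f z (L (basisVec i))

lemma memLpWeighted_partialGradient (H : GrazingBound r β C f) (hr : 0 < r) {p α : ℝ}
    (hp : 1 ≤ p) (hp3 : p < 3) (hα : α < β) {L : E3 → E3 × E3} (hL : ∀ i, ‖L (basisVec i)‖ ≤ 1) :
    MemLpWeighted p α (Metric.ball (0 : E3) r) (partialGradient f L) := by
  refine memLpWeighted_of_le_grazing (C := 2 * C) hr hp hp3 hα ?_ fun z hz => ?_
  · refine aestronglyMeasurable_of_continuousOn_movingPhase ?_
    refine (PiLp.continuous_toLp 2 _).comp_continuousOn ?_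
    exact continuousOn_pi.2 fun i => H.continuousOn_fderiv.clm_apply continuousOn_const
  · set B := C * (√(chordDiscr r z))⁻¹ * gaussWeight β z.2 with hB
    have hi : ∀ i, |fderiv ℝ f z (L (basisVec i))| ≤ B := fun i => by
      refine ((fderiv ℝ f z).le_opNorm _).trans ?_
      refine (mul_le_of_le_one_right (norm_nonneg _) (hL i)).trans (H.bound_fderiv z hz)
    have hB0 : 0 ≤ B := (abs_nonneg _).trans (hi 0)
    rw [show 2 * C * (√(chordDiscr r z))⁻¹ * gaussWeight β z.2 = 2 * B by rw [hB]; ring]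
    refine abs_le_of_sq_le_sq' ?_ (by positivity) |>.2
    rw [EuclideanSpace.norm_sq_eq, Fin.sum_univ_three]
    simp only [partialGradient, Real.norm_eq_abs]
    have := fun i => pow_le_pow_left₀ (abs_nonneg _) (hi i) 2
    nlinarith [this 0, this 1, this 2, sq_nonneg B]

theorem GrazingBound.memW1pWeighted (H : GrazingBound r β C f) (hr : 0 < r) {p α : ℝ}
    (hp : 1 ≤ p) (hp3 : p < 3) (hα0 : 0 ≤ α) (hα : α < β) :
    MemW1pWeighted p α (Metric.ball (0 : E3) r) f := by
  have hβ : 0 < β := hα0.trans_lt hα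
  refine ⟨memLpWeighted_of_le_gaussWeight hp hα
    (aestronglyMeasurable_of_continuousOn_movingPhase H.contDiffOn.continuousOn) H.bound,
    partialGradient f fun ξ => (ξ, 0), partialGradient f fun η => (0, η), fun i => ?_, fun i => ?_,
    ?_, ?_⟩
  · exact H.isWeakDeriv hr hβ _
  · exact H.isWeakDeriv hr hβ _
  · exact memLpWeighted_partialGradient H hr hp hp3 hα fun i => by simp [basisVec, Prod.norm_def]
  · exact memLpWeighted_partialGradient H hr hp hp3 hα fun i => by simp [basisVec, Prod.norm_def]

lemma GrazingBound.memLp_three (H : GrazingBound r β C f) (hβ : 0 < β) :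
    MemLp f 3 (volume.restrict (Metric.ball (0 : E3) r ×ˢ (univ : Set E3))) := by
  have := memLpWeighted_of_le_gaussWeight (p := 3) (α := 0) (by norm_num) hβ
    (aestronglyMeasurable_of_continuousOn_movingPhase H.contDiffOn.continuousOn) H.bound
  have h3 : ENNReal.ofReal 3 = 3 := by simp
  simpa [MemLpWeighted, h3] using this

/-- Any weak gradient coincides with the classical one. -/
theorem GrazingBound.ae_eq_of_isWeakDeriv (H : GrazingBound r β C f) (hr : 0 < r) (hβ : 0 < β)
    {e : E3 × E3} {g : E3 × E3 → ℝ}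
    (hg : IsWeakDeriv (Metric.ball (0 : E3) r ×ˢ univ) e f g) :
    ∀ᵐ z ∂(volume.restrict (Metric.ball (0 : E3) r ×ˢ (univ : Set E3))), g z = fderiv ℝ f z e := by
  obtain ⟨-, h1, h2⟩ := hg
  obtain ⟨-, h3, h4⟩ := H.isWeakDeriv hr hβ e
  have hU : IsOpen (Metric.ball (0 : E3) r ×ˢ (univ : Set E3)) := Metric.isOpen_ball.prod isOpen_univ
  have := hU.ae_eq_zero_of_integral_contDiff_smul_eq_zero (h1.sub h3) fun φ hφ hφc hφs => ?_
  · rw [ae_restrict_iff' hU.measurableSet]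
    filter_upwards [this] with z hz hzU
    exact sub_eq_zero.1 (hz hzU)
  · have e1 := h2 φ hφ hφc hφs
    have e2 := h4 φ hφ hφc hφs
    have hint : ∀ u : E3 × E3 → ℝ, LocallyIntegrableOn u (Metric.ball (0 : E3) r ×ˢ univ) →
        Integrable fun z => φ z * u z := fun u hu => by
      have h5 := hu.integrableOn_compact_subset hφs hφc
      have h6 : IntegrableOn (fun z => φ z * u z) (tsupport φ) :=
        h5.continuousOn_mul hφ.continuous.continuousOn hφc
      refine (integrableOn_iff_integrable_of_support_subset fun z hz => ?_).1 h6
      exact subset_tsupport φ (left_ne_zero_of_mul hz)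
    have hset : ∀ u : E3 × E3 → ℝ, ∫ z in Metric.ball (0 : E3) r ×ˢ univ, u z * φ z =
        ∫ z, φ z * u z := fun u => by
      rw [setIntegral_eq_integral_of_forall_compl_eq_zero]
      · simp only [mul_comm]
      · intro z hz
        rw [image_eq_zero_of_notMem_tsupport fun h => hz (hφs h), mul_zero]
    rw [hset] at e1 e2
    simp only [Pi.sub_apply, smul_eq_mul, mul_sub]
    rw [integral_sub (hint _ h1) (hint _ h3)]
    linarith

end WeakDerivatives

/-! ### The gain term near the pole -/

section Pole

lemma rpow_neg_half_pos : 0 < (2 : ℝ) ^ (-(1 / 2) : ℝ) := by positivity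

/-- A majorant of the positive part of `k(0, w) exp(-|w|² / 2)`, from `1 - s / 2 ≤ exp(-s / 2)`. -/
def restGain (w : E3) : ℝ :=
  (2 : ℝ) ^ (-(3 / 2) : ℝ) * Real.pi⁻¹ * 2 * (‖w‖⁻¹ * Real.exp (-(3 / 2) * ‖w‖ ^ 2))

lemma restGain_nonneg (w : E3) : 0 ≤ restGain w := by unfold restGain; positivity

/-- For `v = 0` the gain and the loss part of the kernel have the same Gaussian factor. -/
lemma max_hardSphereK_zero_mul_le {w : E3} (hw : w ≠ 0) :
    max (hardSphereK 0 w) 0 * gaussWeight (1 / 2) w ≤ restGain w := by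
  have hn := norm_pos_iff.2 hw
  have hM := gaussWeight_pos (1 / 2) w
  rw [max_mul_of_nonneg _ _ hM.le, zero_mul]
  refine max_le ?_ (restGain_nonneg w)
  have e : hardSphereK 0 w = (2 : ℝ) ^ (-(3 / 2) : ℝ) * Real.pi⁻¹ *
      (2 * ‖w‖⁻¹ * (1 - ‖w‖ ^ 2 / 2) * Real.exp (-(1 / 2) * ‖w‖ ^ 2)) := by
    rw [hardSphereK_eq]
    have h1 : (‖w‖ ^ 2 - ‖(0 : E3)‖ ^ 2) ^ 2 / ‖w - 0‖ ^ 2 = ‖w‖ ^ 2 := by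
      rw [norm_zero, sub_zero]; field_simp; ring
    rw [h1, sub_zero, norm_zero]
    have h2 : -(1 / 4) * ‖w‖ ^ 2 - 1 / 4 * ‖w‖ ^ 2 = -(1 / 2) * ‖w‖ ^ 2 := by ring
    have h3 : -(1 / 2) * (‖w‖ ^ 2 + 0 ^ 2) = -(1 / 2) * ‖w‖ ^ 2 := by ring
    rw [h2, h3]
    field_simp
  have h4 : 1 - ‖w‖ ^ 2 / 2 ≤ Real.exp (-(1 / 2) * ‖w‖ ^ 2) := by
    have := Real.add_one_le_exp (-(1 / 2) * ‖w‖ ^ 2)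
    linarith
  have h5 : Real.exp (-(3 / 2) * ‖w‖ ^ 2) = Real.exp (-(1 / 2) * ‖w‖ ^ 2) *
      Real.exp (-(1 / 2) * ‖w‖ ^ 2) * Real.exp (-(1 / 2) * ‖w‖ ^ 2) := by
    rw [← Real.exp_add, ← Real.exp_add]; ring_nf
  rw [e, restGain, gaussWeight, h5]
  set X := Real.exp (-(1 / 2) * ‖w‖ ^ 2) with hX
  have hX0 : 0 < X := Real.exp_pos _
  calc (2 : ℝ) ^ (-(3 / 2) : ℝ) * Real.pi⁻¹ * (2 * ‖w‖⁻¹ * (1 - ‖w‖ ^ 2 / 2) * X) * X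
      ≤ (2 : ℝ) ^ (-(3 / 2) : ℝ) * Real.pi⁻¹ * (2 * ‖w‖⁻¹ * X * X) * X := by gcongr
    _ = _ := by ring

/-- Integration in polar coordinates. The value is `4 / 3` of `ν(0) = 2^(-1/2)`; what matters is that
half of it is less than `ν(0)`. -/
lemma integral_restGain : Integrable restGain ∧
    ∫ w, restGain w = 4 / 3 * (2 : ℝ) ^ (-(1 / 2) : ℝ) := by
  have hE : EqOn (fun y : ℝ => y ^ (1 : ℝ) * Real.exp (-(3 / 2) * y ^ (2 : ℝ)))
      (fun y : ℝ => y ^ (Module.finrank ℝ E3 - 1) • (y⁻¹ * Real.exp (-(3 / 2) * y ^ 2)))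
      (Ioi 0) := by
    intro y hy
    have hy0 : (0 : ℝ) < y := hy
    have hdim : Module.finrank ℝ E3 - 1 = 2 := by simp
    simp only [hdim, smul_eq_mul, Real.rpow_one, Real.rpow_two]
    field_simp
  have hi : Integrable fun w : E3 => ‖w‖⁻¹ * Real.exp (-(3 / 2) * ‖w‖ ^ 2) := by
    refine (integrable_fun_norm_addHaar (volume : Measure E3)
      (f := fun y => y⁻¹ * Real.exp (-(3 / 2) * y ^ 2))).2 ?_
    exact (integrableOn_rpow_mul_exp_neg_mul_rpow (by norm_num) two_pos
      (by norm_num)).congr_fun hE measurableSet_Ioi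
  refine ⟨hi.const_mul _, ?_⟩
  unfold restGain
  rw [integral_const_mul, integral_fun_norm_addHaar (volume : Measure E3)
    (fun y => y⁻¹ * Real.exp (-(3 / 2) * y ^ 2)), ← setIntegral_congr_fun measurableSet_Ioi hE,
    integral_rpow_mul_exp_neg_mul_rpow two_pos (by norm_num) (by norm_num)]
  have hv : (volume : Measure E3).real (Metric.ball 0 1) = Real.pi * 4 / 3 := by
    rw [Measure.real, EuclideanSpace.volume_ball_fin_three]
    simp
    positivity
  rw [hv, rpow_neg_half_eq]
  have hg : (-((1 : ℝ) + 1) / 2) = -1 := by norm_num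
  have hg2 : (((1 : ℝ) + 1) / 2) = 1 := by norm_num
  rw [hg, hg2, Real.Gamma_one, Real.rpow_neg_one]
  simp only [finrank_euclideanSpace, Fintype.card_fin, smul_eq_mul, nsmul_eq_mul]
  have := Real.pi_ne_zero
  push_cast
  field_simp

/-- By symmetry, a half-space carries half of the integral. -/
lemma setIntegral_restGain_le : ∫ w in {w : E3 | w 0 ≤ 0}, restGain w ≤
    2 / 3 * (2 : ℝ) ^ (-(1 / 2) : ℝ) := by
  obtain ⟨hi, hval⟩ := integral_restGain
  have hm : Measurable fun w : E3 => w 0 := by fun_prop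
  have m1 : MeasurableSet {w : E3 | w 0 < 0} := measurableSet_lt hm measurable_const
  have m2 : MeasurableSet {w : E3 | 0 < w 0} := measurableSet_lt measurable_const hm
  have e1 : ∫ w in {w : E3 | w 0 ≤ 0}, restGain w = ∫ w in {w : E3 | w 0 < 0}, restGain w := by
    refine setIntegral_congr_set ?_
    filter_upwards [ae_coord_ne_zero] with w hw
    exact propext ⟨fun h => lt_of_le_of_ne h (hw 0), fun h => le_of_lt h⟩
  have e2 : ∫ w in {w : E3 | w 0 < 0}, restGain w = ∫ w in {w : E3 | 0 < w 0}, restGain w := by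
    rw [← integral_indicator m1, ← integral_indicator m2, ← integral_neg_eq_self]
    refine integral_congr_ae (Eventually.of_forall fun w => ?_)
    simp [indicator, restGain]
  have e3 : (∫ w in {w : E3 | w 0 < 0}, restGain w) + ∫ w in {w : E3 | 0 < w 0}, restGain w ≤
      ∫ w, restGain w := by
    have hd : Disjoint {w : E3 | w 0 < 0} {w : E3 | 0 < w 0} := by
      refine Set.disjoint_left.2 fun w h1 h2 => ?_
      simp only [mem_ofPred_eq] at h1 h2
      linarith
    rw [← setIntegral_union hd m2 hi.integrableOn hi.integrableOn]
    exact setIntegral_le_integral hi (Eventually.of_forall restGain_nonneg)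
  linarith

/-- Slightly more than a half-space still carries much less than the full gain. -/
lemma exists_setIntegral_restGain_le : ∃ ε : ℝ, 0 < ε ∧ ε ≤ 1 ∧
    ∫ w in {w : E3 | w 0 < 2 * ε * ‖w‖}, restGain w ≤ 3 / 4 * (2 : ℝ) ^ (-(1 / 2) : ℝ) := by
  obtain ⟨hi, -⟩ := integral_restGain
  set s : ℕ → Set E3 := fun n => {w : E3 | w 0 < 2 * (1 / ((n : ℝ) + 1)) * ‖w‖} with hs
  have hsm : ∀ n, MeasurableSet (s n) := fun n => measurableSet_lt (by fun_prop) (by fun_prop)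
  have hanti : Antitone s := by
    intro m n hmn w hw
    simp only [hs, mem_ofPred_eq] at hw ⊢
    refine lt_of_lt_of_le hw ?_
    gcongr
  have hlim := tendsto_setIntegral_of_antitone hsm hanti ⟨0, hi.integrableOn⟩
  have hsub : ⋂ n, s n ⊆ {w : E3 | w 0 ≤ 0} := by
    intro w hw
    rw [mem_iInter] at hw
    have h0 : Tendsto (fun n : ℕ => 2 * (1 / ((n : ℝ) + 1)) * ‖w‖) atTop (𝓝 (2 * 0 * ‖w‖)) :=
      (tendsto_one_div_add_atTop_nhds_zero_nat.const_mul 2).mul_const _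
    rw [mul_zero, zero_mul] at h0
    exact ge_of_tendsto' h0 fun n => (hw n).le
  have hle : ∫ w in ⋂ n, s n, restGain w ≤ 2 / 3 * (2 : ℝ) ^ (-(1 / 2) : ℝ) :=
    (setIntegral_mono_set hi.integrableOn (Eventually.of_forall restGain_nonneg)
      (LE.le.eventuallyLE hsub)).trans setIntegral_restGain_le
  have hν := rpow_neg_half_pos
  obtain ⟨n, hn⟩ := (hlim.eventually_lt_const
    (u := 3 / 4 * (2 : ℝ) ^ (-(1 / 2) : ℝ)) (by linarith)).exists
  exact ⟨1 / ((n : ℝ) + 1), by positivity, div_le_one_of_le₀ (by linarith [Nat.cast_nonneg (α := ℝ) n])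
    (by positivity), hn.le⟩

/-- A cutoff that equals `1` where `w 0 ≤ ε ‖w‖` and vanishes where `w 0 ≥ 2 ε ‖w‖`. -/
def coneCutoff (ε : ℝ) (w : E3) : ℝ := max 0 (min 1 (2 - w 0 / (ε * ‖w‖)))

lemma coneCutoff_mem (ε : ℝ) (w : E3) : 0 ≤ coneCutoff ε w ∧ coneCutoff ε w ≤ 1 :=
  ⟨le_max_left _ _, max_le zero_le_one (min_le_left _ _)⟩

lemma coneCutoff_eq_one {ε : ℝ} (hε : 0 < ε) {w : E3} (hw : w ≠ 0) (h : w 0 ≤ ε * ‖w‖) :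
    coneCutoff ε w = 1 := by
  have hn := norm_pos_iff.2 hw
  have : w 0 / (ε * ‖w‖) ≤ 1 := (div_le_one (by positivity)).2 h
  rw [coneCutoff, min_eq_left (by linarith), max_eq_right zero_le_one]

lemma coneCutoff_eq_zero {ε : ℝ} (hε : 0 < ε) {w : E3} (hw : w ≠ 0) (h : 2 * ε * ‖w‖ ≤ w 0) :
    coneCutoff ε w = 0 := by
  have hn := norm_pos_iff.2 hw
  have : 2 ≤ w 0 / (ε * ‖w‖) := (le_div_iff₀ (by positivity)).2 (by linarith)
  exact max_eq_left ((min_le_right _ _).trans (by linarith))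

lemma measurable_coneCutoff (ε : ℝ) : Measurable (coneCutoff ε) := by
  unfold coneCutoff
  fun_prop

lemma continuousAt_coneCutoff {ε : ℝ} (hε : 0 < ε) {w : E3} (hw : w ≠ 0) :
    ContinuousAt (coneCutoff ε) w := by
  have hn := norm_pos_iff.2 hw
  unfold coneCutoff
  refine continuousAt_const.max (continuousAt_const.min (continuousAt_const.sub ?_))
  exact ContinuousAt.div (by fun_prop) (by fun_prop) (by positivity)

/-- The gain of slow particles from a cone slightly larger than a half-space. -/
lemma exists_coneGain_le : ∃ ε : ℝ, 0 < ε ∧ ε ≤ 1 ∧ ∃ δ : ℝ, 0 < δ ∧ ∀ v : E3, ‖v‖ < δ →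
    (Integrable fun w => max (hardSphereK v w) 0 * gaussWeight (1 / 2) w * coneCutoff ε w) ∧
    ∫ w, max (hardSphereK v w) 0 * gaussWeight (1 / 2) w * coneCutoff ε w ≤
      hardSphereNu v * gaussWeight (1 / 2) v - 1 / 8 * (2 : ℝ) ^ (-(1 / 2) : ℝ) := by
  obtain ⟨ε, hε, hε1, hle⟩ := exists_setIntegral_restGain_le
  obtain ⟨hi, -⟩ := integral_restGain
  obtain ⟨C₁, hC₁, hpoly⟩ := exists_poly_mul_gaussWeight_le (n := 1) (β := 0) (γ := 1 / 2)
    (by norm_num) (by norm_num)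
  obtain ⟨C, hC, hk, -⟩ := exists_kernel_majorant (β := 0) le_rfl (by norm_num)
  have hκ := kernelRate_pos (β := 0) (by norm_num)
  have hν := rpow_neg_half_pos
  obtain ⟨C', hC', hs⟩ := exists_singularMajorant_bound hκ
  obtain ⟨a, ha⟩ : ∃ a : E3 → E3 → ℝ, a = fun v w =>
    max (hardSphereK v w) 0 * gaussWeight (1 / 2) w * coneCutoff ε w := ⟨_, rfl⟩
  have hmeas : ∀ v, AEStronglyMeasurable (a v) := fun v => by
    have h1 : Measurable fun w => hardSphereK v w :=
      by unfold hardSphereK; fun_prop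
    have h2 := measurable_coneCutoff ε
    rw [ha]
    unfold gaussWeight
    exact (((h1.max measurable_const).mul (by fun_prop)).mul h2).aestronglyMeasurable
  have hbd : ∀ v w, w ≠ 0 → w ≠ v → ‖a v w‖ ≤ C * C₁ * singularMajorant (kernelRate 0) v w := by
    intro v w h0 h1
    have hM := gaussWeight_pos (1 / 2) w
    obtain ⟨c0, c1⟩ := coneCutoff_mem ε w
    simp only [ha]
    rw [Real.norm_of_nonneg (by positivity)]
    have h2 : gaussWeight (1 / 2) w ≤ C₁ * ‖w‖⁻¹ * gaussWeight 0 w := by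
      have hn := norm_pos_iff.2 h0
      have := hpoly w
      rw [pow_one] at this
      rw [mul_right_comm, ← div_eq_mul_inv, le_div_iff₀ hn]
      nlinarith
    have h3 := hk v w h0 h1 C₁ _ hC₁.le h2
    have h4 : gaussWeight 0 v = 1 := by simp [gaussWeight]
    rw [h4, mul_one] at h3
    have h5 : max (hardSphereK v w) 0 ≤ |hardSphereK v w| := max_le (le_abs_self _) (abs_nonneg _)
    calc _ ≤ |hardSphereK v w| * gaussWeight (1 / 2) w * 1 := by gcongr
      _ ≤ _ := by rw [mul_one]; exact h3
  have hcont : ContinuousAt (fun v => ∫ w, a v w) 0 := by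
    refine continuousAt_integral_of_singular (vel := fun v : E3 => v) continuousAt_id hκ
      (C := C * C₁) (Eventually.of_forall hmeas) (Eventually.of_forall hbd) fun w h0 h1 => ?_
    rw [ha]
    have e1 : ContinuousAt (fun z : E3 × E3 => hardSphereK z.1 z.2) (0, w) :=
      (contDiffAt_hardSphereK h1).continuousAt
    have e2 : ContinuousAt (fun z : E3 × E3 => coneCutoff ε z.2) (0, w) :=
      ContinuousAt.comp (g := coneCutoff ε) (f := fun z : E3 × E3 => z.2)
        (continuousAt_coneCutoff hε h0) continuousAt_snd
    have e3 : ContinuousAt (fun z : E3 × E3 => gaussWeight (1 / 2) z.2) (0, w) := by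
      unfold gaussWeight; fun_prop
    exact ((e1.max continuousAt_const).mul e3).mul e2
  have hzero : ∫ w, a 0 w ≤ 3 / 4 * (2 : ℝ) ^ (-(1 / 2) : ℝ) := by
    have hm : MeasurableSet {w : E3 | w 0 < 2 * ε * ‖w‖} :=
      measurableSet_lt (by fun_prop) (by fun_prop)
    refine le_trans ?_ hle
    rw [← integral_indicator hm]
    refine integral_mono_ae (((hs 0).1.const_mul (C * C₁)).mono' (hmeas 0) ?_)
      ((integrable_indicator_iff hm).2 hi.integrableOn) ?_
    · filter_upwards [ae_ne_point 0] with w h0 using hbd 0 w h0 h0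
    · filter_upwards [ae_ne_point 0] with w h0
      obtain ⟨c0, c1⟩ := coneCutoff_mem ε w
      have hG := max_hardSphereK_zero_mul_le h0
      simp only [ha]
      by_cases hw : w 0 < 2 * ε * ‖w‖
      · rw [indicator_of_mem (by exact hw)]
        exact (mul_le_of_le_one_right (by have := gaussWeight_pos (1 / 2) w; positivity) c1).trans hG
      · rw [indicator_of_notMem (by exact hw), coneCutoff_eq_zero hε h0 (not_lt.1 hw), mul_zero]
  -- `19 / 24` is between `3 / 4` and `23 / 24 - 1 / 8`, so that the bound at `v = 0` extends to
  -- small `v` with the required gap.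
  have hE : ∀ᶠ v : E3 in 𝓝 0, 23 / 24 < Real.exp (-(3 / 2) * ‖v‖ ^ 2) := by
    have : ContinuousAt (fun v : E3 => Real.exp (-(3 / 2) * ‖v‖ ^ 2)) 0 := by fun_prop
    refine this.eventually_const_lt ?_
    norm_num
  have hev := (hcont.eventually_lt_const (u := 19 / 24 * (2 : ℝ) ^ (-(1 / 2) : ℝ))
    (by linarith)).and hE
  obtain ⟨δ, hδ, hball⟩ := Metric.eventually_nhds_iff_ball.1 hev
  refine ⟨ε, hε, hε1, δ, hδ, fun v hv => ?_⟩
  obtain ⟨h1, h2⟩ := hball v (by simpa using hv)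
  rw [ha] at h1
  constructor
  · have : Integrable (a v) := ((hs v).1.const_mul (C * C₁)).mono' (hmeas v) (by
      filter_upwards [ae_ne_point 0, ae_ne_point v] with w h0 h1 using hbd v w h0 h1)
    rwa [ha] at this
  · have h3 : (2 : ℝ) ^ (-(1 / 2) : ℝ) * Real.exp (-(3 / 2) * ‖v‖ ^ 2) ≤
        hardSphereNu v * gaussWeight (1 / 2) v := by
      have hg := gaussWeight_pos (1 / 2) v
      calc _ = ((2 : ℝ) ^ (-(1 / 2) : ℝ) * Real.exp (-‖v‖ ^ 2)) * gaussWeight (1 / 2) v := by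
            rw [gaussWeight, mul_assoc, ← Real.exp_add]; ring_nf
        _ ≤ _ := by gcongr; exact hardSphereNu_ge v
    nlinarith

end Pole

section PoleGap

variable {r θ₁ θ₂ : ℝ} {φ : E3 → ℝ}

lemma inner_basisVec_zero (w : E3) : ⟪w, basisVec 0⟫ = w 0 := by
  rw [basisVec, EuclideanSpace.inner_single_right]; simp

lemma norm_basisVec (i : Fin 3) : ‖basisVec i‖ = 1 := by simp [basisVec]

lemma IsCapCutoff.mem_Icc_of_mem_sphere (hφ : IsCapCutoff r θ₁ θ₂ φ) {x : E3}
    (hx : x ∈ Metric.sphere (0 : E3) r) : φ x ∈ Icc (0 : ℝ) 1 := by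
  by_cases h2 : x ∈ polarCap r θ₂
  · by_cases h1 : x ∈ polarCap r θ₁
    · rw [hφ.eq_one x h1]; simp
    · exact hφ.mem_Icc x ⟨h2, h1⟩
  · rw [hφ.eq_zero x ⟨hx, h2⟩]; simp

lemma IsCapCutoff.abs_le_one (hφ : IsCapCutoff r θ₁ θ₂ φ) {x : E3}
    (hx : x ∈ Metric.sphere (0 : E3) r) : |φ x| ≤ 1 := by
  obtain ⟨h0, h1⟩ := hφ.mem_Icc_of_mem_sphere hx
  rwa [abs_of_nonneg h0]

/-- A chord of the sphere is shorter than the arc. -/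
lemma norm_sub_pole_le (hr : 0 < r) {x : E3} (hx : x ∈ polarCap r θ₂) :
    ‖x - r • basisVec 0‖ ≤ r * θ₂ := by
  obtain ⟨h1, h2⟩ := hx
  have hn : ‖x‖ = r := by simpa using h1
  have hc := InnerProductGeometry.cos_angle_mul_norm_mul_norm x (basisVec 0)
  have h0 := InnerProductGeometry.angle_nonneg x (basisVec 0)
  rw [hn, norm_basisVec, mul_one] at hc
  set t := InnerProductGeometry.angle x (basisVec 0)
  have hcos := Real.one_sub_sq_div_two_le_cos (x := t)
  have hsq : ‖x - r • basisVec 0‖ ^ 2 = 2 * r ^ 2 * (1 - Real.cos t) := by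
    rw [norm_sub_sq_real, inner_smul_right, ← hc, norm_smul, norm_basisVec, hn,
      Real.norm_of_nonneg hr.le]
    ring
  have h3 : ‖x - r • basisVec 0‖ ^ 2 ≤ (r * t) ^ 2 := by rw [hsq]; nlinarith [sq_nonneg r]
  calc _ ≤ r * t := (abs_le_of_sq_le_sq' h3 (by positivity)).2
    _ ≤ _ := by gcongr

lemma opJ_capData_mem (hr : 0 < r) (hφ : IsCapCutoff r θ₁ θ₂ φ) {z : E3 × E3}
    (hz : z ∈ movingPhase r) :
    0 ≤ opJ hardSphereNu (Metric.ball 0 r) (capData φ) z ∧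
      opJ hardSphereNu (Metric.ball 0 r) (capData φ) z ≤ gaussWeight (1 / 2) z.2 := by
  obtain ⟨h0, h1⟩ := hφ.mem_Icc_of_mem_sphere (mem_sphere_zero_iff_norm.2 (norm_ballExit hr hz))
  have hM := gaussWeight_pos (1 / 2) z.2
  have hE : Real.exp (-(hardSphereNu z.2 * ballTime r z)) ≤ 1 := Real.exp_le_one_iff.2 (by
    have := mul_pos (hardSphereNu_pos z.2) (ballTime_pos hz); linarith)
  rw [opJ_capData hr φ hz]
  refine ⟨by positivity, ?_⟩
  calc _ ≤ 1 * (1 * gaussWeight (1 / 2) z.2) := by gcongr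
    _ = _ := by ring

/-- Near the pole, only velocities from a cone slightly larger than a half-space carry data: the
backward ray of the others leaves the ball outside the cap. -/
lemma opJ_capData_eq_zero (hr : 0 < r) (hφ : IsCapCutoff r θ₁ θ₂ φ) {ε : ℝ}
    (hθ : θ₂ < ε / 2) {z : E3 × E3} (hz : z ∈ movingPhase r)
    (hx : ‖z.1 - r • basisVec 0‖ < r * ε / 4) (hw : ε * ‖z.2‖ < z.2 0) :
    opJ hardSphereNu (Metric.ball 0 r) (capData φ) z = 0 := by
  rw [opJ_capData hr φ hz]
  have hq := mem_sphere_zero_iff_norm.2 (norm_ballExit hr hz)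
  have hv := norm_pos_iff.2 (mem_movingPhase.1 hz).2
  have hT := ballTime_pos hz
  suffices h : φ (ballExit r z) = 0 by rw [h]; ring
  refine hφ.eq_zero _ ⟨hq, fun hcap => ?_⟩
  have h1 := norm_sub_pole_le hr hcap
  have h2 : ballTime r z * ‖z.2‖ ≤ ‖z.1 - r • basisVec 0‖ + ‖ballExit r z - r • basisVec 0‖ := by
    have e : ballTime r z • z.2 = (z.1 - r • basisVec 0) - (ballExit r z - r • basisVec 0) := by
      rw [ballExit]; abel
    rw [← Real.norm_of_nonneg hT.le, ← norm_smul, e]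
    exact norm_sub_le _ _
  have h3 : r * (ε * ‖z.2‖) - r * ε / 4 * ‖z.2‖ ≤ ⟪z.1, z.2⟫ := by
    have e : ⟪z.1, z.2⟫ = r * z.2 0 + ⟪z.1 - r • basisVec 0, z.2⟫ := by
      have e1 : ⟪basisVec 0, z.2⟫ = z.2 0 := by rw [real_inner_comm, inner_basisVec_zero]
      rw [inner_sub_left, inner_smul_left, e1]
      simp
    have := neg_le_of_abs_le (abs_real_inner_le_norm (z.1 - r • basisVec 0) z.2)
    rw [e]
    have h5 : ‖z.1 - r • basisVec 0‖ * ‖z.2‖ ≤ r * ε / 4 * ‖z.2‖ := by gcongr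
    have h6 : r * (ε * ‖z.2‖) ≤ r * z.2 0 := by gcongr
    linarith
  have h4 : ⟪z.1, z.2⟫ ≤ ballTime r z * ‖z.2‖ ^ 2 := by
    rw [ballTime_mul_sq (mem_movingPhase.1 hz).2]
    linarith [Real.sqrt_nonneg (chordDiscr r z)]
  have h7 : (r * ε - r * ε / 4) * ‖z.2‖ ≤ (ballTime r z * ‖z.2‖) * ‖z.2‖ := by nlinarith
  have h8 := le_of_mul_le_mul_right h7 hv
  nlinarith

/-- Near the pole, the gain produced by the data falls short of the loss `ν M` for slow particles
by a fixed amount. -/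
theorem exists_gain_gap : ∃ ε : ℝ, 0 < ε ∧ ε ≤ 1 ∧ ∃ δ : ℝ, 0 < δ ∧
    ∀ (r θ₁ θ₂ : ℝ) (φ : E3 → ℝ), 0 < r → θ₂ < ε / 2 → IsCapCutoff r θ₁ θ₂ φ →
      ∀ z ∈ phaseSpace r, ‖z.1 - r • basisVec 0‖ < r * ε / 4 → ‖z.2‖ < δ →
        opK hardSphereK (opJ hardSphereNu (Metric.ball 0 r) (capData φ)) z ≤
          hardSphereNu z.2 * gaussWeight (1 / 2) z.2 - 1 / 8 * (2 : ℝ) ^ (-(1 / 2) : ℝ) := by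
  obtain ⟨ε, hε, hε1, δ, hδ, hgain⟩ := exists_coneGain_le
  obtain ⟨CK, hCK, hK⟩ := exists_opK_gainBound (β := 0) le_rfl (by norm_num)
  obtain ⟨CJ, hCJ, hJ⟩ := exists_opJ_transportBound (β := 0) (by norm_num)
  refine ⟨ε, hε, hε1, δ, hδ, fun r θ₁ θ₂ φ hr hθ hφ z hz hx hv => ?_⟩
  obtain ⟨b, hb, hTJ⟩ := hJ r φ hr hφ.smooth fun x hx => hφ.abs_le_one hx
  have hint := (hK r _ CJ 1 b hCJ.le zero_le_one hb hTJ).2 z hz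
  obtain ⟨hi, hle⟩ := hgain z.2 hv
  refine le_trans (integral_mono_ae hint hi ?_) hle
  filter_upwards [ae_ne_point 0] with w hw
  have hmem : ((z.1, w) : E3 × E3) ∈ movingPhase r := mem_movingPhase.2 ⟨mem_phaseSpace.1 hz, hw⟩
  obtain ⟨j0, j1⟩ := opJ_capData_mem hr hφ hmem
  obtain ⟨c0, c1⟩ := coneCutoff_mem ε w
  have hM := gaussWeight_pos (1 / 2) w
  have hk0 : 0 ≤ max (hardSphereK z.2 w) 0 := le_max_right _ _
  by_cases hcone : ε * ‖w‖ < w 0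
  · rw [opJ_capData_eq_zero hr hφ hθ hmem hx hcone, mul_zero]
    positivity
  · rw [coneCutoff_eq_one hε hw (not_lt.1 hcone), mul_one]
    exact mul_le_mul (le_max_left _ _) j1 j0 hk0

end PoleGap

/-! ### The gradient at the grazing set -/

section GrazingGradient

variable {r β a b c : ℝ} {h : E3 × E3 → ℝ} {φ : E3 → ℝ}

/-- The part of `∂ₓ(S h)` that multiplies `∂ₓ τ` is the integral of a total derivative, and is
therefore bounded by the values of `h` near the exit point. -/
lemma integral_chord_derivative_le (hr : 0 < r) (H : GainBound r β a b c h) (hβ : 0 ≤ β)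
    {z : E3 × E3} (hz : z ∈ movingPhase r) {K : ℝ}
    (hK : ∀ θ ∈ Ioo (0 : ℝ) 1, h (chordPoint r z θ) ≤ K) :
    let F' : ℝ → ℝ := fun θ => Real.exp (-(hardSphereNu z.2 * (θ * ballTime r z))) *
      ((1 - hardSphereNu z.2 * (θ * ballTime r z)) * h (chordPoint r z θ) -
        θ * ballTime r z * fderiv ℝ h (chordPoint r z θ) (z.2, 0))
    IntegrableOn F' (Ioo 0 1) ∧
      ∫ θ in Ioo (0 : ℝ) 1, F' θ ≤ Real.exp (-(hardSphereNu z.2 * ballTime r z)) * K := by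
  intro F'
  obtain ⟨ha, hb, -⟩ := gainBound_nonneg hr H
  have hT := ballTime_pos hz
  have hν := hardSphereNu_pos z.2
  set ν := hardSphereNu z.2
  set T := ballTime r z with hTdef
  have hpt : ∀ θ, chordPoint r z θ = (z.1 - (θ * T) • z.2, z.2) := fun θ => rfl
  have hcp : Continuous (chordPoint r z) := by
    have : chordPoint r z = fun θ => (z.1 - (θ * T) • z.2, z.2) := funext hpt
    rw [this]; fun_prop
  have hmem : ∀ θ ∈ Ico (0 : ℝ) 1, chordPoint r z θ ∈ phaseSpace r := fun θ hθ =>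
    mem_phaseSpace.2 (mem_ball_zero_iff.1 (chord_mem_ball hr hz hθ.1 hθ.2))
  have hhc : ContinuousOn (fun θ => h (chordPoint r z θ)) (Ico 0 1) :=
    H.contDiffOn.continuousOn.comp hcp.continuousOn hmem
  have hh'c : ContinuousOn (fun θ => fderiv ℝ h (chordPoint r z θ) (z.2, 0)) (Ico 0 1) :=
    ((H.contDiffOn.continuousOn_fderiv_of_isOpen (isOpen_phaseSpace r) le_rfl).comp
      hcp.continuousOn hmem).clm_apply continuousOn_const
  have hF'c : ContinuousOn F' (Ico 0 1) := by
    refine ContinuousOn.mul (by fun_prop) (ContinuousOn.sub (ContinuousOn.mul (by fun_prop) hhc)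
      (ContinuousOn.mul (by fun_prop) hh'c))
  set F : ℝ → ℝ := fun θ => θ * Real.exp (-(ν * (θ * T))) * h (chordPoint r z θ) with hF
  have hFc : ContinuousOn F (Ico 0 1) := ContinuousOn.mul (by fun_prop) hhc
  have hder : ∀ θ ∈ Ioo (0 : ℝ) 1, HasDerivAt F (F' θ) θ := by
    intro θ hθ
    have d1 : HasDerivAt (chordPoint r z) (-(T • z.2), 0) θ := by
      have h1 : HasDerivAt (fun θ : ℝ => z.1 - (θ * T) • z.2) (-((1 * T) • z.2)) θ :=
        (((hasDerivAt_id θ).mul_const T).smul_const z.2).const_sub z.1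
      rw [one_mul] at h1
      exact h1.prodMk (hasDerivAt_const θ z.2)
    have d2 : HasFDerivAt h (fderiv ℝ h (chordPoint r z θ)) (chordPoint r z θ) :=
      ((H.contDiffOn.differentiableOn (by simp)).differentiableAt
        ((isOpen_phaseSpace r).mem_nhds (hmem θ ⟨hθ.1.le, hθ.2⟩))).hasFDerivAt
    have d3 : HasDerivAt (fun θ => h (chordPoint r z θ)) _ θ := d2.comp_hasDerivAt θ d1
    have d4 : HasDerivAt (fun θ : ℝ => Real.exp (-(ν * (θ * T))))
        (Real.exp (-(ν * (θ * T))) * (-(ν * (1 * T)))) θ :=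
      ((((hasDerivAt_id θ).mul_const T).const_mul ν).neg).exp
    have d5 := ((hasDerivAt_id θ).mul d4).mul d3
    refine d5.congr_deriv ?_
    have e : ((-(T • z.2), 0) : E3 × E3) = (-T) • (z.2, 0) := by simp
    rw [e, map_smul, smul_eq_mul]
    have e2 : F' θ = Real.exp (-(ν * (θ * T))) * ((1 - ν * (θ * T)) * h (chordPoint r z θ) -
        θ * T * fderiv ℝ h (chordPoint r z θ) (z.2, 0)) := rfl
    rw [e2]
    simp only [Pi.mul_apply, id]
    ring
  have hint : IntegrableOn F' (Ioo 0 1) := by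
    have hi : IntegrableOn (fun θ => (1 + ν * T) * a + T * (b * (T * ‖z.2‖)⁻¹ * ‖z.2‖) *
        arcsineDensity θ) (Ioo 0 1) :=
      (integrableOn_const (by simp)).add (integrableOn_arcsineDensity.const_mul _)
    refine hi.mono' ((hF'c.mono Ioo_subset_Ico_self).aestronglyMeasurable measurableSet_Ioo) ?_
    filter_upwards [ae_restrict_mem measurableSet_Ioo] with θ hθ
    have hg := gaussWeight_pos β z.2
    have hg1 := gaussWeight_le_one hβ z.2
    have hs := arcsineDensity_nonneg θ
    have p1 := H.bound _ (chordPoint_mem hr hz hθ)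
    have p2 := abs_fderiv_chordPoint_fst_le hr H hz hθ z.2
    have p3 : Real.exp (-(ν * (θ * T))) ≤ 1 := Real.exp_le_one_iff.2 (by
      have := mul_pos hν (mul_pos hθ.1 hT); linarith)
    have p4 : |1 - ν * (θ * T)| ≤ 1 + ν * T := by
      refine (abs_sub _ _).trans ?_
      rw [abs_one, abs_of_nonneg (by have := hθ.1; positivity)]
      gcongr
      exact mul_le_of_le_one_left hT.le hθ.2.le
    have p5 : |h (chordPoint r z θ)| ≤ a := p1.trans (mul_le_of_le_one_right ha hg1)
    have p6 : |fderiv ℝ h (chordPoint r z θ) (z.2, 0)| ≤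
        b * (T * ‖z.2‖)⁻¹ * ‖z.2‖ * arcsineDensity θ := by
      refine p2.trans ?_
      calc _ ≤ b * ((T * ‖z.2‖)⁻¹ * arcsineDensity θ) * 1 * ‖z.2‖ := by gcongr
        _ = _ := by ring
    have p7 : |θ * T| ≤ T := by
      rw [abs_of_nonneg (by have := hθ.1; positivity)]
      exact mul_le_of_le_one_left hT.le hθ.2.le
    simp only [F']
    rw [norm_mul, Real.norm_of_nonneg (Real.exp_pos _).le]
    refine (mul_le_of_le_one_left (norm_nonneg _) p3).trans ((abs_sub _ _).trans ?_)
    rw [abs_mul, abs_mul]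
    calc _ ≤ (1 + ν * T) * a + T * (b * (T * ‖z.2‖)⁻¹ * ‖z.2‖ * arcsineDensity θ) := by gcongr
      _ = _ := by ring
  refine ⟨hint, ?_⟩
  -- `h` need not extend to the exit point, so integrate up to `t < 1` and let `t` tend to `1`.
  have hicc : IntegrableOn F' (uIcc 0 1) := by
    rw [uIcc_of_le zero_le_one, integrableOn_Icc_iff_integrableOn_Ioo]; exact hint
  have hcontp := (intervalIntegral.continuousOn_primitive_interval hicc) 1 (by simp)
  rw [uIcc_of_le zero_le_one] at hcontp
  have hlim : Tendsto (fun t => ∫ θ in (0 : ℝ)..t, F' θ) (𝓝[Ioo 0 1] 1)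
      (𝓝 (∫ θ in (0 : ℝ)..1, F' θ)) := hcontp.mono Ioo_subset_Icc_self
  have hlim2 : Tendsto (fun t => t * Real.exp (-(ν * (t * T))) * K) (𝓝[Ioo 0 1] 1)
      (𝓝 (Real.exp (-(ν * T)) * K)) := by
    have : ContinuousAt (fun t => t * Real.exp (-(ν * (t * T))) * K) 1 := by fun_prop
    have h1 := this.tendsto.mono_left (nhdsWithin_le_nhds (s := Ioo 0 1))
    simpa using h1
  have hne : (𝓝[Ioo (0 : ℝ) 1] 1).NeBot := by
    rw [nhdsWithin_Ioo_eq_nhdsLT zero_lt_one]; infer_instance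
  rw [← integral_Ioc_eq_integral_Ioo, ← intervalIntegral.integral_of_le zero_le_one]
  refine le_of_tendsto_of_tendsto hlim hlim2 ?_
  filter_upwards [self_mem_nhdsWithin] with t ht
  have hsub : Icc 0 t ⊆ Ico 0 1 := fun s hs => ⟨hs.1, hs.2.trans_lt ht.2⟩
  have hsub2 : Ioo 0 t ⊆ Ioo 0 1 := fun s hs => ⟨hs.1, hs.2.trans ht.2⟩
  rw [intervalIntegral.integral_eq_sub_of_hasDerivAt_of_le ht.1.le (hFc.mono hsub)
    (fun s hs => hder s (hsub2 hs)) ((intervalIntegrable_iff_integrableOn_Ioo_of_le ht.1.le).2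
      (hint.mono_set hsub2))]
  simp only [hF, zero_mul, sub_zero]
  have := ht.1
  gcongr
  exact hK t ht

/-- The radial derivative at a chord along which the gain stays below the loss by `κ` is at least
of the order of the reciprocal of `√(chordDiscr r z)`. -/
theorem le_fderiv_transportSolution (hr : 0 < r) (H : GainBound r β a b c h) (hβ : 0 ≤ β)
    (hφ : ContDiff ℝ ∞ φ) {z : E3 × E3} (hz : z ∈ movingPhase r)
    (hφ1 : ∀ᶠ y in 𝓝 z, φ (ballExit r y) = 1) {κ : ℝ}
    (hgap : ∀ θ ∈ Ioo (0 : ℝ) 1,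
      h (chordPoint r z θ) ≤ hardSphereNu z.2 * gaussWeight (1 / 2) z.2 - κ) :
    r / √(chordDiscr r z) * (Real.exp (-(hardSphereNu z.2 * ballTime r z)) * κ) -
        b * ‖z.2‖⁻¹ * arcsineMass ≤
      fderiv ℝ (transportSolution r φ h) z (r⁻¹ • ballExit r z, 0) := by
  obtain ⟨ha, hb, -⟩ := gainBound_nonneg hr H
  have hT := ballTime_pos hz
  have hν := hardSphereNu_pos z.2
  have hD := Real.sqrt_pos.2 (chordDiscr_pos hz)
  have hv := norm_pos_iff.2 (mem_movingPhase.1 hz).2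
  set ξ : E3 := r⁻¹ • ballExit r z with hξ
  have hξn : ‖ξ‖ = 1 := by
    rw [hξ, norm_smul, norm_ballExit hr hz, Real.norm_of_nonneg (by positivity)]
    field_simp
  have hτ' : fderiv ℝ (ballTime r) z (ξ, 0) = -(r / √(chordDiscr r z)) := by
    rw [fderiv_ballTime hr hz, smul_zero, sub_zero, hξ, inner_smul_right,
      real_inner_self_eq_norm_sq, norm_ballExit hr hz]
    field_simp
  obtain ⟨hi1, hX⟩ := integral_chord_derivative_le hr H hβ hz hgap
  set F' : ℝ → ℝ := fun θ => Real.exp (-(hardSphereNu z.2 * (θ * ballTime r z))) *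
      ((1 - hardSphereNu z.2 * (θ * ballTime r z)) * h (chordPoint r z θ) -
        θ * ballTime r z * fderiv ℝ h (chordPoint r z θ) (z.2, 0)) with hF'
  set G : ℝ → ℝ := fun θ => ballTime r z * (Real.exp (-(hardSphereNu z.2 * (θ * ballTime r z))) *
    fderiv ℝ h (chordPoint r z θ) (ξ, 0)) with hG
  have hS := opS_transportBound hr hβ H
  have hJd : DifferentiableAt ℝ (opJ hardSphereNu (Metric.ball 0 r) (capData φ)) z :=
    ((contDiffOn_opJ hr hφ).differentiableOn (by simp)).differentiableAt
      ((isOpen_movingPhase r).mem_nhds hz)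
  have hSd : DifferentiableAt ℝ (opS hardSphereNu (Metric.ball 0 r) h) z :=
    (hS.contDiffOn.differentiableOn (by simp)).differentiableAt
      ((isOpen_movingPhase r).mem_nhds hz)
  have hJ : fderiv ℝ (opJ hardSphereNu (Metric.ball 0 r) (capData φ)) z (ξ, 0) =
      Real.exp (-(hardSphereNu z.2 * ballTime r z)) * gaussWeight (1 / 2) z.2 *
        (hardSphereNu z.2 * (r / √(chordDiscr r z))) := by
    have he : opJ hardSphereNu (Metric.ball 0 r) (capData φ) =ᶠ[𝓝 z]
        opJ hardSphereNu (Metric.ball 0 r) (capData fun _ => 1) := by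
      filter_upwards [hφ1, (isOpen_movingPhase r).mem_nhds hz] with y hy hm
      rw [opJ_capData hr _ hm, opJ_capData hr _ hm, hy]
    rw [he.fderiv_eq, fderiv_opJ hr contDiff_const hz, hτ']
    simp
  -- `F'` collects the terms with the derivative of the exit time, `G` the derivative of `h` in the
  -- direction `ξ`. Only the first is multiplied by the singular factor.
  have hIF : ∀ θ ∈ Ioo (0 : ℝ) 1, fderiv ℝ (fun y => chordIntegrand r h (y, θ)) z (ξ, 0) =
      -(r / √(chordDiscr r z)) * F' θ + G θ := by
    intro θ hθ
    rw [fderiv_chordIntegrand hr H.contDiffOn hz hθ, hτ']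
    have e : ((ξ - (θ * -(r / √(chordDiscr r z))) • z.2 - (θ * ballTime r z) • 0, 0) : E3 × E3) =
        (ξ, 0) - (θ * -(r / √(chordDiscr r z))) • ((z.2, 0) : E3 × E3) := by simp
    simp only [e, map_sub, map_smul, smul_eq_mul, hF', hG, map_zero, mul_zero, zero_mul, sub_zero]
    have e0 : fderiv ℝ h (chordPoint r z θ) (0, 0) = 0 := map_zero _
    rw [e0]
    ring
  have hGb : ∀ θ ∈ Ioo (0 : ℝ) 1, |G θ| ≤ b * ‖z.2‖⁻¹ * arcsineDensity θ := by
    intro θ hθ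
    have p1 : Real.exp (-(hardSphereNu z.2 * (θ * ballTime r z))) ≤ 1 := Real.exp_le_one_iff.2 (by
      have := mul_pos hν (mul_pos hθ.1 hT); linarith)
    have p2 := abs_fderiv_chordPoint_fst_le hr H hz hθ ξ
    have hs := arcsineDensity_nonneg θ
    have hg1 := gaussWeight_le_one hβ z.2
    have hg := gaussWeight_pos β z.2
    rw [hξn, mul_one] at p2
    simp only [hG]
    rw [abs_mul, abs_mul, abs_of_pos hT, abs_of_pos (Real.exp_pos _)]
    calc _ ≤ ballTime r z * (1 * (b * ((ballTime r z * ‖z.2‖)⁻¹ * arcsineDensity θ) * 1)) := by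
          gcongr
          exact p2.trans (by gcongr)
      _ = _ := by field_simp
  have hGi : IntegrableOn G (Ioo 0 1) := by
    refine (integrableOn_arcsineDensity.const_mul (b * ‖z.2‖⁻¹)).mono' ?_ ?_
    · refine ContinuousOn.aestronglyMeasurable ?_ measurableSet_Ioo
      have hcp : Continuous (chordPoint r z) := by
        unfold chordPoint; fun_prop
      have h1 : ContinuousOn (fun θ => fderiv ℝ h (chordPoint r z θ) (ξ, 0)) (Ioo 0 1) :=
        ((H.contDiffOn.continuousOn_fderiv_of_isOpen (isOpen_phaseSpace r) le_rfl).comp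
          hcp.continuousOn fun θ hθ => chordPoint_mem hr hz hθ).clm_apply continuousOn_const
      exact continuousOn_const.mul (ContinuousOn.mul (by fun_prop) h1)
    · filter_upwards [ae_restrict_mem measurableSet_Ioo] with θ hθ using hGb θ hθ
  have hGint : -(b * ‖z.2‖⁻¹ * arcsineMass) ≤ ∫ θ in Ioo (0 : ℝ) 1, G θ := by
    have := norm_integral_le_of_norm_le (μ := volume.restrict (Ioo (0 : ℝ) 1)) (f := G)
      (integrableOn_arcsineDensity.const_mul (b * ‖z.2‖⁻¹)) (by
        filter_upwards [ae_restrict_mem measurableSet_Ioo] with θ hθ using hGb θ hθ)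
    have e : ∫ θ in Ioo (0 : ℝ) 1, b * ‖z.2‖⁻¹ * arcsineDensity θ =
        b * ‖z.2‖⁻¹ * arcsineMass := integral_const_mul _ _
    rw [e] at this
    exact neg_le_of_abs_le this
  have hSf : fderiv ℝ (opS hardSphereNu (Metric.ball 0 r) h) z (ξ, 0) =
      -(r / √(chordDiscr r z)) * (∫ θ in Ioo (0 : ℝ) 1, F' θ) + ∫ θ in Ioo (0 : ℝ) 1, G θ := by
    rw [fderiv_opS hr hβ H hz, setIntegral_congr_fun measurableSet_Ioo hIF,
      integral_add (hi1.const_mul _) hGi, integral_const_mul]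
  have hsum : fderiv ℝ (transportSolution r φ h) z (ξ, 0) =
      fderiv ℝ (opJ hardSphereNu (Metric.ball 0 r) (capData φ)) z (ξ, 0) +
      fderiv ℝ (opS hardSphereNu (Metric.ball 0 r) h) z (ξ, 0) := by
    have : transportSolution r φ h = fun z => opJ hardSphereNu (Metric.ball 0 r) (capData φ) z +
      opS hardSphereNu (Metric.ball 0 r) h z := rfl
    rw [this, fderiv_fun_add hJd hSd]
    rfl
  rw [hsum, hJ, hSf]
  have hR : 0 < r / √(chordDiscr r z) := div_pos hr hD
  have := mul_le_mul_of_nonneg_left hX hR.le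
  nlinarith

end GrazingGradient

/-! ### The volume of the grazing region -/

section GrazingRegion

variable {r η δ s : ℝ}

/-- The part in the ball of radius `ρ` of an open cone around the first coordinate axis. -/
def poleCone (η ρ : ℝ) : Set E3 := {x | ‖x - ‖x‖ • basisVec 0‖ < η * ‖x‖ ∧ ‖x‖ < ρ}

/-- Points of the cone at depth at most `s²` below the sphere, with velocities of size comparable
to `δ` that are tangential up to an error `s`. -/
def grazingRegion (r η δ s : ℝ) : Set (E3 × E3) :=
  {z | z.1 ∈ poleCone η r \ poleCone η (r - s ^ 2) ∧
    (δ / 2 < ‖z.2‖ ∧ ‖z.2‖ < δ) ∧ |⟪z.1, z.2⟫| ≤ s}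

lemma isOpen_poleCone (η ρ : ℝ) : IsOpen (poleCone η ρ) := by
  have h1 : IsOpen {x : E3 | ‖x - ‖x‖ • basisVec 0‖ < η * ‖x‖} :=
    isOpen_lt (by fun_prop) (by fun_prop)
  have h2 : IsOpen {x : E3 | ‖x‖ < ρ} := isOpen_lt (by fun_prop) (by fun_prop)
  exact h1.inter h2

lemma measurableSet_grazingRegion (r η δ s : ℝ) : MeasurableSet (grazingRegion r η δ s) := by
  have h1 : MeasurableSet {z : E3 × E3 | δ / 2 < ‖z.2‖} :=
    (isOpen_lt (by fun_prop) (by fun_prop)).measurableSet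
  have h2 : MeasurableSet {z : E3 × E3 | ‖z.2‖ < δ} :=
    (isOpen_lt (by fun_prop) (by fun_prop)).measurableSet
  have h3 : MeasurableSet {z : E3 × E3 | |⟪z.1, z.2⟫| ≤ s} :=
    (isClosed_le (by fun_prop) (by fun_prop)).measurableSet
  have h4 : MeasurableSet {z : E3 × E3 | z.1 ∈ poleCone η r \ poleCone η (r - s ^ 2)} :=
    measurable_fst ((isOpen_poleCone _ _).measurableSet.diff (isOpen_poleCone _ _).measurableSet)
  exact h4.inter ((h1.inter h2).inter h3)

open scoped Pointwise in
/-- By homogeneity, the volume of the part of a shell in the cone is explicit. -/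
lemma poleCone_eq_smul (η : ℝ) {ρ : ℝ} (hρ : 0 < ρ) : poleCone η ρ = ρ • poleCone η 1 := by
  ext x
  rw [mem_smul_set_iff_inv_smul_mem₀ hρ.ne']
  have h1 : ‖ρ⁻¹ • x‖ = ρ⁻¹ * ‖x‖ := by rw [norm_smul, Real.norm_of_nonneg (by positivity)]
  have h2 : ρ⁻¹ • x - ‖ρ⁻¹ • x‖ • basisVec 0 = ρ⁻¹ • (x - ‖x‖ • basisVec 0) := by
    rw [h1, smul_sub, smul_smul]
  have h3 : ‖ρ⁻¹ • x - ‖ρ⁻¹ • x‖ • basisVec 0‖ = ρ⁻¹ * ‖x - ‖x‖ • basisVec 0‖ := by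
    rw [h2, norm_smul, Real.norm_of_nonneg (by positivity)]
  simp only [poleCone, mem_ofPred_eq]
  rw [h3, h1]
  have hρ' : 0 < ρ⁻¹ := inv_pos.2 hρ
  refine and_congr ?_ ?_
  · rw [show η * (ρ⁻¹ * ‖x‖) = ρ⁻¹ * (η * ‖x‖) by ring, mul_lt_mul_iff_right₀ hρ']
  · rw [inv_mul_lt_iff₀ hρ, mul_one]

open scoped Pointwise in
lemma volume_poleCone (η : ℝ) {ρ : ℝ} (hρ : 0 < ρ) :
    volume (poleCone η ρ) = ENNReal.ofReal (ρ ^ 3) * volume (poleCone η 1) := by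
  rw [poleCone_eq_smul η hρ, Measure.addHaar_smul]
  simp [abs_of_pos hρ]

lemma volume_poleCone_one_lt_top (η : ℝ) : volume (poleCone η 1) < ⊤ :=
  (measure_mono fun x hx => by simpa using hx.2).trans_lt
    (measure_ball_lt_top (x := (0 : E3)) (r := 1))

lemma volume_poleCone_one_pos (hη : 0 < η) : 0 < volume (poleCone η 1) := by
  refine (isOpen_poleCone η 1).measure_pos volume ⟨(1 / 2 : ℝ) • basisVec 0, ?_⟩
  have h : ‖(1 / 2 : ℝ) • basisVec 0‖ = 1 / 2 := by rw [norm_smul, norm_basisVec]; norm_num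
  simp only [poleCone, mem_ofPred_eq]
  rw [h, sub_self, norm_zero]
  exact ⟨by positivity, by norm_num⟩

lemma volume_poleCone_diff (hs : s ^ 2 < r) :
    volume (poleCone η r \ poleCone η (r - s ^ 2)) =
      ENNReal.ofReal (r ^ 3 - (r - s ^ 2) ^ 3) * volume (poleCone η 1) := by
  have h1 : 0 < r - s ^ 2 := by linarith
  have hr : 0 < r := by nlinarith [sq_nonneg s]
  have hsub : poleCone η (r - s ^ 2) ⊆ poleCone η r := fun x hx =>
    ⟨hx.1, hx.2.trans_le (by nlinarith [sq_nonneg s])⟩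
  have hfin := volume_poleCone_one_lt_top η
  rw [measure_sdiff hsub (isOpen_poleCone _ _).measurableSet.nullMeasurableSet
    (by rw [volume_poleCone η h1]; exact (ENNReal.mul_lt_top (by simp) hfin).ne),
    volume_poleCone η h1, volume_poleCone η hr, ENNReal.ofReal_sub _ (by positivity),
    ENNReal.sub_mul fun _ _ => hfin.ne]

/-- The velocities in the region fill a box, after rotation of `x` to the first axis. -/
lemma le_volume_tangential {x : E3} (hx : ‖x‖ < r) (hs : 0 < s) (hδ : 0 < δ)
    (hsr : s ≤ r * δ / 2) : ENNReal.ofReal (s / r * (δ ^ 2 / 10)) ≤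
      volume {v : E3 | (δ / 2 < ‖v‖ ∧ ‖v‖ < δ) ∧ |⟪x, v⟫| ≤ s} := by
  have hr : 0 < r := (norm_nonneg x).trans_lt hx
  obtain ⟨U, hU⟩ := exists_isometry_inner x
  rw [← U.measurePreserving.measure_preimage_emb U.toHomeomorph.measurableEmbedding]
  -- In the box, `|v| ≥ 3δ/5 > δ/2`, and `|v|² ≤ (1/4 + 49/100 + 1/4) δ² < δ²`.
  have hbox : (WithLp.ofLp ⁻¹' (Icc ![-(s / r), 3 / 5 * δ, 0] ![s / r, 7 / 10 * δ, δ / 2]) :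
      Set E3) ⊆ U ⁻¹' {v : E3 | (δ / 2 < ‖v‖ ∧ ‖v‖ < δ) ∧ |⟪x, v⟫| ≤ s} := by
    intro v hv
    obtain ⟨h1, h2⟩ := hv
    have a0 := h1 0
    have a1 := h1 1
    have a2 := h1 2
    have b0 := h2 0
    have b1 := h2 1
    have b2 := h2 2
    simp only [Matrix.cons_val] at a0 a1 a2 b0 b1 b2
    have hsr' : s / r ≤ δ / 2 := by rw [div_le_iff₀ hr]; linarith
    have hv0 : |v 0| ≤ s / r := abs_le.2 ⟨a0, b0⟩
    have hn : ‖v‖ ^ 2 = v 0 ^ 2 + v 1 ^ 2 + v 2 ^ 2 := by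
      rw [EuclideanSpace.norm_sq_eq, Fin.sum_univ_three]; simp
    have hn0 : v 0 ^ 2 ≤ (δ / 2) ^ 2 := by
      rw [← sq_abs]
      exact pow_le_pow_left₀ (abs_nonneg _) (hv0.trans hsr') 2
    simp only [mem_preimage, mem_ofPred_eq, LinearIsometryEquiv.norm_map]
    refine ⟨⟨?_, ?_⟩, ?_⟩
    · have := (le_abs_self _).trans (abs_coord_le_norm v 1)
      linarith
    · refine lt_of_pow_lt_pow_left₀ 2 hδ.le ?_
      rw [hn]
      nlinarith
    · rw [hU, abs_mul, abs_norm]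
      calc ‖x‖ * |v 0| ≤ r * (s / r) := by gcongr
        _ = s := by field_simp
  refine le_trans (le_of_eq ?_) (measure_mono hbox)
  rw [(PiLp.volume_preserving_ofLp (Fin 3)).measure_preimage measurableSet_Icc.nullMeasurableSet,
    Real.volume_Icc_pi, Fin.prod_univ_three]
  simp only [Matrix.cons_val]
  rw [← ENNReal.ofReal_mul (by linarith [div_pos hs hr]), ← ENNReal.ofReal_mul (by
    have := div_pos hs hr
    have h2 : 0 < 7 / 10 * δ - 3 / 5 * δ := by linarith
    have h3 : 0 < s / r - -(s / r) := by linarith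
    positivity)]
  congr 1
  ring

/-- A factor `s` comes from the velocities and a factor `s²` from the thickness of the shell. -/
lemma le_volume_grazingRegion (hs : 0 < s) (hδ : 0 < δ) (hsr : s ≤ r * δ / 2) (hs2 : s ^ 2 < r) :
    ENNReal.ofReal (s ^ 3 * (r * δ ^ 2 / 10)) * volume (poleCone η 1) ≤
      volume (grazingRegion r η δ s) := by
  have hr : 0 < r := by nlinarith
  rw [Measure.volume_eq_prod, Measure.prod_apply (measurableSet_grazingRegion _ _ _ _)]
  have hA : MeasurableSet (poleCone η r \ poleCone η (r - s ^ 2)) :=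
    (isOpen_poleCone _ _).measurableSet.diff (isOpen_poleCone _ _).measurableSet
  calc _ ≤ ENNReal.ofReal (s / r * (δ ^ 2 / 10)) *
        volume (poleCone η r \ poleCone η (r - s ^ 2)) := by
        rw [volume_poleCone_diff hs2, ← mul_assoc, ← ENNReal.ofReal_mul (by positivity)]
        refine mul_le_mul_left (ENNReal.ofReal_le_ofReal ?_) _
        have h1 : r ^ 2 * s ^ 2 ≤ r ^ 3 - (r - s ^ 2) ^ 3 := by
          have e : r ^ 3 - (r - s ^ 2) ^ 3 = s ^ 2 * (r ^ 2 + r * (r - s ^ 2) + (r - s ^ 2) ^ 2) := by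
            ring
          rw [e]
          have h2 : 0 ≤ r * (r - s ^ 2) := mul_nonneg hr.le (by linarith)
          nlinarith [sq_nonneg (r - s ^ 2), sq_nonneg s, mul_nonneg (sq_nonneg s) h2,
            mul_nonneg (sq_nonneg s) (sq_nonneg (r - s ^ 2))]
        calc s ^ 3 * (r * δ ^ 2 / 10) = s / r * (δ ^ 2 / 10) * (r ^ 2 * s ^ 2) := by
              field_simp
          _ ≤ _ := by gcongr
    _ = ∫⁻ x in poleCone η r \ poleCone η (r - s ^ 2),
        ENNReal.ofReal (s / r * (δ ^ 2 / 10)) := by rw [setLIntegral_const]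
    _ ≤ ∫⁻ x in poleCone η r \ poleCone η (r - s ^ 2),
        volume (Prod.mk x ⁻¹' grazingRegion r η δ s) := by
        refine setLIntegral_mono' hA fun x hx => ?_
        refine (le_volume_tangential hx.1.2 hs hδ hsr).trans (measure_mono fun v hv => ?_)
        exact ⟨hx, hv⟩
    _ ≤ _ := setLIntegral_le_lintegral _ _

lemma volume_grazingRegion_le (hs2 : s ^ 2 < r) : volume (grazingRegion r η δ s) ≤
    ENNReal.ofReal (r ^ 3 - (r - s ^ 2) ^ 3) * volume (poleCone η 1) *
      volume (Metric.ball (0 : E3) δ) := by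
  rw [← volume_poleCone_diff hs2, Measure.volume_eq_prod, ← Measure.prod_prod]
  exact measure_mono fun z hz => ⟨hz.1, by simpa using hz.2.1.2⟩

lemma tendsto_volume_grazingRegion (hr : 0 < r) :
    Tendsto (fun s => volume (grazingRegion r η δ s)) (𝓝[>] 0) (𝓝 0) := by
  have hm := volume_poleCone_one_lt_top η
  have hb := measure_ball_lt_top (μ := (volume : Measure E3)) (x := 0) (r := δ)
  have h1 : Tendsto (fun s : ℝ => ENNReal.ofReal (r ^ 3 - (r - s ^ 2) ^ 3)) (𝓝[>] 0) (𝓝 0) := by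
    have hc : Continuous fun s : ℝ => ENNReal.ofReal (r ^ 3 - (r - s ^ 2) ^ 3) :=
      ENNReal.continuous_ofReal.comp (by fun_prop)
    have := (hc.tendsto 0).mono_left (nhdsWithin_le_nhds (s := Ioi 0))
    simpa using this
  have h2 := ENNReal.Tendsto.mul_const (ENNReal.Tendsto.mul_const h1 (Or.inr hm.ne)) (Or.inr hb.ne)
  rw [zero_mul, zero_mul] at h2
  refine tendsto_of_tendsto_of_tendsto_of_le_of_le' tendsto_const_nhds h2
    (Eventually.of_forall fun _ => zero_le) ?_
  have hev : ∀ᶠ s : ℝ in 𝓝[>] 0, s ^ 2 < r := by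
    have : ContinuousAt (fun s : ℝ => s ^ 2) 0 := by fun_prop
    exact (this.eventually_lt_const (by simpa using hr)).filter_mono nhdsWithin_le_nhds
  filter_upwards [hev] with s hs using volume_grazingRegion_le hs

/-- A function that is at least of the order `s⁻³` on the grazing region of width `s`, for all
small `s`, is not integrable. -/
theorem lintegral_eq_top_of_grazing {F : E3 × E3 → ENNReal} {μ : Measure (E3 × E3)} {c : ℝ}
    (hr : 0 < r) (hη : 0 < η) (hδ : 0 < δ) (hc : 0 < c)
    (hμ : ∀ᶠ s in 𝓝[>] (0 : ℝ), μ.restrict (grazingRegion r η δ s) =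
      volume.restrict (grazingRegion r η δ s))
    (hF : ∀ᶠ s in 𝓝[>] (0 : ℝ), ∀ᵐ z ∂(volume.restrict (grazingRegion r η δ s)),
      ENNReal.ofReal (c / s ^ 3) ≤ F z) : ∫⁻ z, F z ∂μ = ⊤ := by
  by_contra hne
  set m := volume (poleCone η 1) with hm
  have hm0 : 0 < m := volume_poleCone_one_pos hη
  -- The integral over every small grazing region is at least `κ`, contrary to absolute continuity.
  set κ := ENNReal.ofReal (c * (r * δ ^ 2 / 10)) * m with hκ
  have hκ0 : κ ≠ 0 := mul_ne_zero (by simp; positivity) hm0.ne'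
  obtain ⟨ε, hε, hsmall⟩ := exists_pos_setLIntegral_lt_of_measure_lt hne hκ0
  have hev := (tendsto_volume_grazingRegion (η := η) (δ := δ) hr).eventually_lt_const hε
  have hs1 : ∀ᶠ s : ℝ in 𝓝[>] 0, s ≤ r * δ / 2 :=
    (eventually_le_nhds (by positivity)).filter_mono nhdsWithin_le_nhds
  have hs2 : ∀ᶠ s : ℝ in 𝓝[>] 0, s ^ 2 < r := by
    have : ContinuousAt (fun s : ℝ => s ^ 2) 0 := by fun_prop
    exact (this.eventually_lt_const (by simpa using hr)).filter_mono nhdsWithin_le_nhds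
  have hne' : (𝓝[>] (0 : ℝ)).NeBot := inferInstance
  obtain ⟨s, h1, h2, h3, h4, h5, h6⟩ := (hμ.and (hF.and (hev.and (hs1.and (hs2.and
    self_mem_nhdsWithin))))).exists
  have hs : 0 < s := h6
  have hvol : μ (grazingRegion r η δ s) = volume (grazingRegion r η δ s) := by
    rw [← Measure.restrict_apply_self μ, h1, Measure.restrict_apply_self]
  have h7 := hsmall _ (by rw [hvol]; exact h3)
  rw [h1] at h7
  refine absurd h7 (not_lt.2 ?_)
  calc κ = ENNReal.ofReal (c / s ^ 3) * (ENNReal.ofReal (s ^ 3 * (r * δ ^ 2 / 10)) * m) := by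
        rw [hκ, ← mul_assoc, ← ENNReal.ofReal_mul (by positivity)]
        congr 2
        field_simp
    _ ≤ ENNReal.ofReal (c / s ^ 3) * volume (grazingRegion r η δ s) := by
        gcongr
        exact le_volume_grazingRegion hs hδ h4 h5
    _ = ∫⁻ z in grazingRegion r η δ s, ENNReal.ofReal (c / s ^ 3) := by rw [setLIntegral_const]
    _ ≤ _ := lintegral_mono_ae h2

end GrazingRegion

/-! ### Failure of the gradient to be cube integrable -/

section NotSobolev

variable {r η δ s β a b c κ : ℝ} {h : E3 × E3 → ℝ} {φ : E3 → ℝ}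

lemma grazingRegion_subset_movingPhase (hδ : 0 < δ) : grazingRegion r η δ s ⊆ movingPhase r := by
  intro z hz
  refine mem_movingPhase.2 ⟨hz.1.1.2, fun h0 => ?_⟩
  have := hz.2.1.1
  rw [h0, norm_zero] at this
  linarith

lemma le_norm_of_mem_grazingRegion {z : E3 × E3} (hz : z ∈ grazingRegion r η δ s) :
    r - s ^ 2 ≤ ‖z.1‖ := by
  by_contra hlt
  exact hz.1.2 ⟨hz.1.1.1, not_le.1 hlt⟩

lemma sqrt_chordDiscr_le_of_mem_grazingRegion (hr : 0 < r) (hs : 0 < s) {z : E3 × E3}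
    (hz : z ∈ grazingRegion r η δ s) : √(chordDiscr r z) ≤ s * (1 + 2 * r * δ ^ 2) := by
  have h1 := le_norm_of_mem_grazingRegion hz
  have h2 : ‖z.1‖ < r := hz.1.1.2
  have h3 : ‖z.2‖ < δ := hz.2.1.2
  have h4 : |⟪z.1, z.2⟫| ≤ s := hz.2.2
  have h5 : ⟪z.1, z.2⟫ ^ 2 ≤ s ^ 2 := by
    rw [← sq_abs]
    exact pow_le_pow_left₀ (abs_nonneg _) h4 2
  have h6 : r ^ 2 - ‖z.1‖ ^ 2 ≤ 2 * r * s ^ 2 := by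
    have h7 : (r - ‖z.1‖) * (r + ‖z.1‖) ≤ s ^ 2 * (2 * r) :=
      mul_le_mul (by linarith) (by linarith) (by positivity) (by positivity)
    nlinarith
  have h7 : ‖z.2‖ ^ 2 ≤ δ ^ 2 := pow_le_pow_left₀ (norm_nonneg _) h3.le 2
  have h8 : ‖z.2‖ ^ 2 * (r ^ 2 - ‖z.1‖ ^ 2) ≤ δ ^ 2 * (2 * r * s ^ 2) :=
    mul_le_mul h7 h6 (by nlinarith [norm_nonneg z.1]) (by positivity)
  refine Real.sqrt_le_iff.2 ⟨by positivity, ?_⟩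
  have h9 : 0 ≤ 2 * r * δ ^ 2 := by positivity
  calc chordDiscr r z ≤ s ^ 2 + δ ^ 2 * (2 * r * s ^ 2) := add_le_add h5 h8
    _ = s ^ 2 * (1 + 2 * r * δ ^ 2) := by ring
    _ ≤ s ^ 2 * (1 + 2 * r * δ ^ 2) ^ 2 := by
        refine mul_le_mul_of_nonneg_left ?_ (sq_nonneg s)
        nlinarith
    _ = _ := by ring

lemma ballTime_le_of_mem_grazingRegion (hr : 0 < r) (hs : 0 < s) (hδ : 0 < δ) {z : E3 × E3}
    (hz : z ∈ grazingRegion r η δ s) :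
    ballTime r z ≤ 8 / δ ^ 2 * (1 + 2 * r * δ ^ 2) * s := by
  have h1 := sqrt_chordDiscr_le_of_mem_grazingRegion hr hs hz
  have h2 : δ / 2 < ‖z.2‖ := hz.2.1.1
  calc ballTime r z ≤ 2 * √(chordDiscr r z) / ‖z.2‖ ^ 2 :=
        ballTime_le (grazingRegion_subset_movingPhase hδ hz)
    _ ≤ 2 * (s * (1 + 2 * r * δ ^ 2)) / (δ / 2) ^ 2 := by gcongr
    _ = _ := by field_simp; ring

/-- The whole backward chord from a point of the grazing region stays close to the pole. -/
lemma norm_chord_sub_pole_le (hr : 0 < r) (hs : 0 < s) (hδ : 0 < δ) (hη : 0 ≤ η) {z : E3 × E3}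
    (hz : z ∈ grazingRegion r η δ s) {θ : ℝ} (hθ0 : 0 ≤ θ) (hθ1 : θ ≤ 1) :
    ‖z.1 - (θ * ballTime r z) • z.2 - r • basisVec 0‖ ≤
      η * r + s ^ 2 + 8 / δ * (1 + 2 * r * δ ^ 2) * s := by
  have hT := (ballTime_pos (grazingRegion_subset_movingPhase hδ hz)).le
  have h1 : ‖z.1 - ‖z.1‖ • basisVec 0‖ ≤ η * r :=
    hz.1.1.1.le.trans (mul_le_mul_of_nonneg_left hz.1.1.2.le hη)
  have h2 : ‖(‖z.1‖ - r) • basisVec 0‖ ≤ s ^ 2 := by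
    rw [norm_smul, norm_basisVec, mul_one, Real.norm_eq_abs, abs_sub_comm,
      abs_of_nonneg (sub_nonneg.2 hz.1.1.2.le)]
    linarith [le_norm_of_mem_grazingRegion hz]
  have h3 : ‖(θ * ballTime r z) • z.2‖ ≤ 8 / δ * (1 + 2 * r * δ ^ 2) * s := by
    rw [norm_smul, Real.norm_of_nonneg (mul_nonneg hθ0 hT)]
    calc θ * ballTime r z * ‖z.2‖ ≤ 1 * (8 / δ ^ 2 * (1 + 2 * r * δ ^ 2) * s) * δ := by
          gcongr
          · exact ballTime_le_of_mem_grazingRegion hr hs hδ hz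
          · exact hz.2.1.2.le
      _ = _ := by field_simp
  have e : z.1 - (θ * ballTime r z) • z.2 - r • basisVec 0 =
      (z.1 - ‖z.1‖ • basisVec 0) + (‖z.1‖ - r) • basisVec 0 - (θ * ballTime r z) • z.2 := by
    rw [sub_smul]; abel
  rw [e]
  exact (norm_sub_le _ _).trans (add_le_add ((norm_add_le _ _).trans (add_le_add h1 h2)) h3)

lemma continuousOn_ballExit (r : ℝ) : ContinuousOn (ballExit r) (movingPhase r) := by
  have h1 : ContinuousOn (ballTime r) (movingPhase r) := (contDiffOn_ballTime r).continuousOn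
  have h2 : ContinuousOn (fun z : E3 × E3 => z.1 - ballTime r z • z.2) (movingPhase r) :=
    continuous_fst.continuousOn.sub (h1.smul continuous_snd.continuousOn)
  exact h2

/-- Near the pole of the sphere the polar angle is small. -/
lemma exists_angle_lt (hr : 0 < r) {θ₁ : ℝ} (hθ : 0 < θ₁) : ∃ d > 0, ∀ y : E3,
    ‖y - r • basisVec 0‖ < d → InnerProductGeometry.angle y (basisVec 0) < θ₁ := by
  have hb : basisVec 0 ≠ 0 := norm_ne_zero_iff.1 (by rw [norm_basisVec]; norm_num)
  have hrb : r • basisVec 0 ≠ 0 := smul_ne_zero hr.ne' hb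
  have h1 : ContinuousAt (fun y : E3 => InnerProductGeometry.angle y (basisVec 0))
      (r • basisVec 0) := by
    have h2 := InnerProductGeometry.continuousAt_angle (x := (r • basisVec 0, basisVec 0)) hrb hb
    exact h2.comp (f := fun y : E3 => (y, basisVec 0)) (by fun_prop)
  have h3 : InnerProductGeometry.angle (r • basisVec 0) (basisVec 0) < θ₁ := by
    rwa [InnerProductGeometry.angle_smul_left_of_pos _ _ hr, InnerProductGeometry.angle_self hb]
  obtain ⟨d, hd, hball⟩ := Metric.eventually_nhds_iff.1 (h1.eventually_lt_const h3)
  exact ⟨d, hd, fun y hy => hball (by rwa [dist_eq_norm])⟩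

/-- On the grazing region of width `s` near the pole, the derivative of the solution in the
direction of the exit point is at least of order `1 / s`. -/
lemma eventually_le_fderiv_transportSolution (hr : 0 < r) (H : GainBound r β a b c h)
    (hβ : 0 ≤ β) {θ₁ θ₂ : ℝ} (hθ : 0 < θ₁) (hφ : IsCapCutoff r θ₁ θ₂ φ) {d : ℝ} (hd : 0 < d)
    (hδ : 0 < δ) (hδ1 : δ ≤ 1) (hκ : 0 < κ)
    (hgap : ∀ z ∈ phaseSpace r, ‖z.1 - r • basisVec 0‖ < d → ‖z.2‖ < δ →
      h z ≤ hardSphereNu z.2 * gaussWeight (1 / 2) z.2 - κ) :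
    ∃ η > 0, ∃ m > 0, ∀ᶠ s in 𝓝[>] (0 : ℝ), ∀ z ∈ grazingRegion r η δ s,
      m / s ≤ fderiv ℝ (transportSolution r φ h) z (r⁻¹ • ballExit r z, 0) := by
  obtain ⟨d', hd', hangle⟩ := exists_angle_lt hr hθ
  set ε := min d d' with hε
  have hε0 : 0 < ε := lt_min hd hd'
  set B := 1 + 2 * r * δ ^ 2 with hB
  have hB0 : 0 < B := by positivity
  set m := r * (Real.exp (-1) * κ) / (2 * B) with hm
  have hm0 : 0 < m := by positivity
  have hη : 0 < ε / (2 * r) := by positivity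
  -- A cone of this opening is within `ε / 2` of the pole, which leaves `ε / 2` for the chord.
  refine ⟨ε / (2 * r), hη, m, hm0, ?_⟩
  have small : ∀ {g : ℝ → ℝ} {K : ℝ}, Continuous g → g 0 = 0 → 0 < K →
      ∀ᶠ s in 𝓝[>] (0 : ℝ), g s < K := fun hg h0 hK =>
    (hg.continuousAt.eventually_lt_const (by rwa [h0])).filter_mono nhdsWithin_le_nhds
  have e1 := small (g := fun s => s ^ 2 + 8 / δ * B * s) (by fun_prop) (by simp) (half_pos hε0)
  have e2 := small (g := fun s => 4 * (8 / δ ^ 2 * B * s)) (by fun_prop) (by simp) one_pos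
  have e3 := small (g := fun s => b * (2 / δ) * arcsineMass * s) (by fun_prop) (by simp) hm0
  filter_upwards [e1, e2, e3, self_mem_nhdsWithin] with s h1 h2 h3 hs z hz
  have hs : 0 < s := hs
  have hzm := grazingRegion_subset_movingPhase hδ hz
  have hb : 0 ≤ b := (gainBound_nonneg hr H).2.1
  have hA := arcsineMass_nonneg
  have hchord : ∀ θ : ℝ, 0 ≤ θ → θ ≤ 1 →
      ‖z.1 - (θ * ballTime r z) • z.2 - r • basisVec 0‖ < ε := fun θ a1 a2 => by
    have e := norm_chord_sub_pole_le hr hs hδ hη.le hz a1 a2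
    have e' : ε / (2 * r) * r = ε / 2 := by field_simp
    rw [e'] at e
    linarith
  have hexit : ∀ᶠ y in 𝓝 z, φ (ballExit r y) = 1 := by
    have hU := (isOpen_movingPhase r).mem_nhds hzm
    have hc : ContinuousAt (fun y => ‖ballExit r y - r • basisVec 0‖) z :=
      (((continuousOn_ballExit r).continuousAt hU).sub continuousAt_const).norm
    have hlt : ‖ballExit r z - r • basisVec 0‖ < d' := by
      have := hchord 1 zero_le_one le_rfl
      rw [one_mul] at this
      exact this.trans_le (min_le_right _ _)
    filter_upwards [hc.eventually_lt_const hlt, hU] with y hy hyU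
    exact hφ.eq_one _ ⟨by simpa using norm_ballExit hr hyU, hangle _ hy⟩
  have hmain := le_fderiv_transportSolution hr H hβ hφ.smooth hzm hexit (κ := κ) fun θ hθ' =>
    hgap (chordPoint r z θ) (chordPoint_mem hr hzm hθ')
      ((hchord θ hθ'.1.le hθ'.2.le).trans_le (min_le_left _ _)) hz.2.1.2
  refine le_trans ?_ hmain
  have hD := Real.sqrt_pos.2 (chordDiscr_pos hzm)
  have hDs := sqrt_chordDiscr_le_of_mem_grazingRegion hr hs hz
  have hv : δ / 2 < ‖z.2‖ := hz.2.1.1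
  have hv1 : ‖z.2‖ ≤ 1 := hz.2.1.2.le.trans hδ1
  have hexp : Real.exp (-1) ≤ Real.exp (-(hardSphereNu z.2 * ballTime r z)) := by
    refine Real.exp_le_exp.2 (neg_le_neg ?_)
    have n1 : hardSphereNu z.2 ≤ 4 := (hardSphereNu_le z.2).trans (by
      nlinarith [norm_nonneg z.2])
    calc hardSphereNu z.2 * ballTime r z ≤ 4 * (8 / δ ^ 2 * B * s) :=
          mul_le_mul n1 (ballTime_le_of_mem_grazingRegion hr hs hδ hz) (ballTime_pos hzm).le
            (by norm_num)
      _ ≤ 1 := h2.le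
  have f1 : 2 * m / s ≤ r / √(chordDiscr r z) *
      (Real.exp (-(hardSphereNu z.2 * ballTime r z)) * κ) := by
    calc 2 * m / s = r / (s * B) * (Real.exp (-1) * κ) := by rw [hm]; field_simp
      _ ≤ _ := by gcongr
  have f2 : b * ‖z.2‖⁻¹ * arcsineMass ≤ m / s := by
    rw [le_div_iff₀ hs]
    refine le_trans ?_ h3.le
    have : ‖z.2‖⁻¹ ≤ 2 / δ := by
      rw [inv_le_comm₀ (by linarith) (by positivity), inv_div]
      exact hv.le
    gcongr
  have f3 : 2 * m / s = m / s + m / s := by ring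
  linarith

/-- A function whose derivative in the direction of the exit point is of order `1 / s` on the
grazing regions has no cube integrable weak gradient, even without a velocity weight. -/
theorem GrazingBound.not_memW1pWeighted_three {f : E3 × E3 → ℝ} {C α m : ℝ}
    (H : GrazingBound r β C f) (hr : 0 < r) (hβ : 0 < β) (hα : 0 ≤ α) (hη : 0 < η) (hδ : 0 < δ)
    (hm : 0 < m) (hf : ∀ᶠ s in 𝓝[>] (0 : ℝ), ∀ z ∈ grazingRegion r η δ s,
      m / s ≤ fderiv ℝ f z (r⁻¹ • ballExit r z, 0)) :
    ¬ MemW1pWeighted 3 α (Metric.ball (0 : E3) r) f := by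
  rintro ⟨-, Gx, -, hGx, -, hmem, -⟩
  set μ := (volume : Measure (E3 × E3)).restrict (Metric.ball (0 : E3) r ×ˢ (univ : Set E3))
    with hμ
  have hsub : ∀ s, grazingRegion r η δ s ⊆ Metric.ball (0 : E3) r ×ˢ (univ : Set E3) :=
    fun s z hz => ⟨by simpa using hz.1.1.2, mem_univ _⟩
  have hrestr : ∀ s, μ.restrict (grazingRegion r η δ s) =
      volume.restrict (grazingRegion r η δ s) := fun s => by
    rw [hμ, Measure.restrict_restrict (measurableSet_grazingRegion _ _ _ _),
      inter_eq_left.2 (hsub s)]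
  have hfin := lintegral_rpow_enorm_lt_top_of_eLpNorm_lt_top (by simp) (by simp) hmem.2
  refine hfin.ne (lintegral_eq_top_of_grazing hr hη hδ (pow_pos hm 3)
    (Eventually.of_forall hrestr) ?_)
  have hG : ∀ᵐ z ∂μ, ∀ i, Gx z i = fderiv ℝ f z (basisVec i, 0) :=
    ae_all_iff.2 fun i => H.ae_eq_of_isWeakDeriv hr hβ (hGx i)
  filter_upwards [hf, self_mem_nhdsWithin] with s hs hs0
  have hs0 : 0 < s := hs0
  rw [← hrestr]
  filter_upwards [ae_restrict_of_ae hG,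
    ae_restrict_mem (measurableSet_grazingRegion _ _ _ _)] with z hz hzs
  have hzm := grazingRegion_subset_movingPhase hδ hzs
  set ξ := r⁻¹ • ballExit r z with hξ
  have hξ1 : ‖ξ‖ = 1 := by
    rw [hξ, norm_smul, norm_ballExit hr hzm, Real.norm_of_nonneg (by positivity),
      inv_mul_cancel₀ hr.ne']
  have hsum : ξ = ∑ i, ξ i • basisVec i := by
    ext j
    simp [basisVec, Pi.single_apply]
  have hinner : fderiv ℝ f z (ξ, 0) = ⟪ξ, Gx z⟫ := by
    have e : ((ξ, 0) : E3 × E3) = ∑ i, ξ i • ((basisVec i, 0) : E3 × E3) := by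
      refine Prod.ext ?_ ?_
      · rw [Prod.fst_sum]
        exact hsum
      · simp [Prod.snd_sum]
    rw [e, map_sum, PiLp.inner_apply]
    refine Finset.sum_congr rfl fun i _ => ?_
    rw [map_smul, hz i]
    simp [mul_comm]
  have hle : m / s ≤ ‖Real.exp (α * ‖z.2‖ ^ 2) • Gx z‖ := by
    have h1 : 1 ≤ Real.exp (α * ‖z.2‖ ^ 2) := Real.one_le_exp (by positivity)
    calc m / s ≤ ⟪ξ, Gx z⟫ := hinner ▸ hs z hzs
      _ ≤ ‖ξ‖ * ‖Gx z‖ := real_inner_le_norm _ _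
      _ = ‖Gx z‖ := by rw [hξ1, one_mul]
      _ ≤ Real.exp (α * ‖z.2‖ ^ 2) * ‖Gx z‖ := le_mul_of_one_le_left (norm_nonneg _) h1
      _ = _ := by rw [norm_smul, Real.norm_of_nonneg (by positivity)]
  have h3 : (ENNReal.ofReal 3).toReal = 3 := by simp
  rw [h3, ← ofReal_norm, ENNReal.ofReal_rpow_of_nonneg (norm_nonneg _) (by norm_num)]
  refine ENNReal.ofReal_le_ofReal ?_
  rw [← div_pow]
  calc (m / s) ^ 3 ≤ ‖Real.exp (α * ‖z.2‖ ^ 2) • Gx z‖ ^ 3 :=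
        pow_le_pow_left₀ (by positivity) hle 3
    _ = _ := (Real.rpow_natCast _ 3).symm

end NotSobolev

end Boltzmann

end

theorem lemma1p9 (ρ p α : ℝ) (hρ0 : 0 < ρ) (hρ1 : ρ < 1) (hp2 : 2 ≤ p) (hp3 : p < 3)
    (hα0 : 0 ≤ α) (hα : α < (1 - ρ) / 2) :
    ∃ r₀ : ℝ, 0 < r₀ ∧ ∀ r : ℝ, 0 < r → r < r₀ →
      Boltzmann.IsConvexDomainPosCurvature (Metric.ball (0 : Boltzmann.E3) r) ∧
      ∃ θ₀ : ℝ, 0 < θ₀ ∧ θ₀ < Real.pi ∧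
        ∀ (θ₁ θ₂ : ℝ) (φ : Boltzmann.E3 → ℝ), 0 < θ₁ → θ₁ < θ₂ → θ₂ < θ₀ →
          Boltzmann.IsCapCutoff r θ₁ θ₂ φ →
          ∃ f : Boltzmann.E3 × Boltzmann.E3 → ℝ,
            Boltzmann.IsSolution Boltzmann.hardSphereNu Boltzmann.hardSphereK
              (Metric.ball (0 : Boltzmann.E3) r) (Boltzmann.capData φ) f ∧
            MeasureTheory.MemLp f 3
              (MeasureTheory.volume.restrict
                (Metric.ball (0 : Boltzmann.E3) r ×ˢ (Set.univ : Set Boltzmann.E3))) ∧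
            Boltzmann.MemW1pWeighted p α (Metric.ball (0 : Boltzmann.E3) r) f ∧
            ¬ Boltzmann.MemW1pWeighted 3 α (Metric.ball (0 : Boltzmann.E3) r) f := by
  obtain ⟨β', hαβ', hβ'⟩ : ∃ β', α < β' ∧ β' < 1 / 2 := exists_between (by linarith)
  obtain ⟨β, hβ'β, hβ⟩ := exists_between hβ'
  have hβ'0 : 0 < β' := hα0.trans_lt hαβ'
  have hβ0 : 0 ≤ β := (hβ'0.trans hβ'β).le
  obtain ⟨C, hC, r₁, hr₁, hfix⟩ := Boltzmann.exists_gain_fixedPoint hβ0 hβ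
  obtain ⟨ε, hε, hε1, δ, hδ, hgap⟩ := Boltzmann.exists_gain_gap
  set κ := 1 / 16 * (2 : ℝ) ^ (-(1 / 2) : ℝ) with hκ
  have hκ0 : 0 < κ := by positivity
  -- For `r < κ / C` the error `C r` uses up at most half of the gap `2 κ`.
  refine ⟨min r₁ (κ / C), lt_min hr₁ (div_pos hκ0 hC), fun r hr hr0 =>
    ⟨Boltzmann.isConvexDomainPosCurvature_ball hr, ε / 2, half_pos hε, ?_, ?_⟩⟩
  · linarith [Real.pi_gt_three]
  intro θ₁ θ₂ φ hθ₁ _ hθ₂ hφ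
  have hφ1 : ∀ x ∈ Metric.sphere (0 : Boltzmann.E3) r, |φ x| ≤ 1 := fun x hx => hφ.abs_le_one hx
  obtain ⟨h, b, c, H, hh⟩ := hfix r φ hr (hr0.trans_le (min_le_left _ _)) hφ.smooth hφ1
  obtain ⟨C', -, G⟩ := Boltzmann.exists_grazingBound_transportSolution hr hφ.smooth hφ1 H hβ0
    hβ'β hβ
  refine ⟨Boltzmann.transportSolution r φ h,
    Boltzmann.isSolution_transportSolution hr H hβ0 fun z hz => ⟨(hh z hz).1, (hh z hz).2.1⟩,
    G.memLp_three hβ'0, G.memW1pWeighted hr (by linarith) hp3 hα0 hαβ', ?_⟩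
  have hCr : C * r ≤ κ := by
    have := (lt_div_iff₀ hC).1 (hr0.trans_le (min_le_right _ _))
    linarith
  have hδ' : 0 < min δ 1 := lt_min hδ one_pos
  obtain ⟨η, hη, m, hm, hev⟩ := Boltzmann.eventually_le_fderiv_transportSolution hr H hβ0 hθ₁ hφ
    (d := r * ε / 4) (by positivity) hδ' (min_le_right _ _) hκ0 fun z hz hx hv => by
      have h1 := hgap r θ₁ θ₂ φ hr hθ₂ hφ z hz hx (hv.trans_le (min_le_left _ _))
      have h2 := (abs_le.1 (hh z hz).2.2).2
      linarith
  exact G.not_memW1pWeighted_three hr hβ'0 hα0 hη hδ' hm hev
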